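/- Throughout, $q=e^{2\pi i\tau}$ with $\operatorname{Im}\tau>0$, a prime on a function denotes $q\,\frac{d}{dq}=\frac{1}{2\pi i}\frac{d}{d\tau}$, and $\sum'_{m,k}$ denotes summation over all $(m,k)\in\mathbb Z^2$ with $(m,k)\neq(0,0)$. For a function with Fourier expansion $f=\sum_{n\ge 0}b_nq^n$ put $L(f,s)=\sum_{n\ge1}b_n n^{-s}$. For an integer $a\ge1$ let $\theta_a=\sum_{n\in\mathbb Z}q^{an^2}$ (a form of weight $1/2$), and for $g,h$ of weights $k,l$ let $[g,h]=k\,g\,h'-l\,g'\,h$ be the Rankin–Cohen bracket. Put $$f_1=[\theta_3,\theta_5],\qquad f_2=[\theta_{15},\theta_1],\qquad f^+(\tau)=\eta(\tau)\eta(3\tau)\eta(5\tau)\eta(15\tau)\sum_{m,n\in\mathbb Z}q^{m^2+mn+4n^2},$$ where $\eta$ is the Dedekind eta function (this $f^+$ is the weight-$3$, level-$15$ CM newform attached to the $K3$ surface $X+\frac1X+Y+\frac1Y+Z+\frac1Z+XY+\frac1{XY}+ZY+\frac1{ZY}+XYZ+\frac1{XYZ}+3=0$). (a) Both of the following double sums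 converge absolutely, and they are equal: $$\sum_{m,k}{}'\left(\frac{m^2-15k^2}{(m^2+15k^2)^3}+\frac{5k^2-3m^2}{(3m^2+5k^2)^3}\right)=\sum_{m,k}{}'\left(\frac12\,\frac{2m^2+2mk-7k^2}{(m^2+mk+4k^2)^3}+\frac12\,\frac{m^2+8mk+k^2}{(2m^2+mk+2k^2)^3}\right).$$ (b) Equivalently, $L(f_1,3)+L(f_2,3)=L(f^+,3)$. (c) For every complex $s$ with $\operatorname{Re}s>2$ the Dirichlet series $L(f_1,s)$, $L(f_2,s)$, $L(f^+,s)$ converge absolutely, as do the double sums in $$L(f_1,s)=\frac12\sum_{m,k}{}'\frac{5k^2-3m^2}{(3m^2+5k^2)^s},\qquad L(f_2,s)=\frac12\sum_{m,k}{}'\frac{m^2-15k^2}{(m^2+15k^2)^s},$$ $$L(f^+,s)=\sum_{m,k}{}'\left(\frac14\,\frac{2m^2+2mk-7k^2}{(m^2+mk+4k^2)^s}+\frac14\,\frac{m^2+8mk+k^2}{(2m^2+mk+2k^2)^s}\right),$$ and the $L$-series of $f_1+f_2$ and of $f^+$ agree up to the Euler factor at $2$: $$L(f_1,s)+L(f_2,s)=\left(1-2^{-s}+2^{3-2s}\right)L(f^+,s).$$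 -/

import Mathlib

open Complex
open UpperHalfPlane hiding I

noncomputable section

/-- The index set of the primed double sums: pairs of integers other than `(0, 0)`. -/
abbrev NonzeroPair : Type := {p : ℤ × ℤ // p ≠ 0}

/-- The unary theta function `θ_a(τ) = ∑_{n ∈ ℤ} q ^ (a n²)`, `q = exp (2 π i τ)`. -/
def unaryTheta (a : ℕ) (τ : ℍ) : ℂ :=
  ∑' n : ℤ, cexp (2 * Real.pi * I * (a * (n : ℂ) ^ 2) * τ)

/-- The binary theta function `∑_{m, n ∈ ℤ} q ^ (m² + m n + 4 n²)`, `q = exp (2 π i τ)`. -/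
def binaryTheta (τ : ℍ) : ℂ :=
  ∑' p : ℤ × ℤ,
    cexp (2 * Real.pi * I * ((p.1 : ℂ) ^ 2 + p.1 * p.2 + 4 * (p.2 : ℂ) ^ 2) * τ)

/-- The Rankin-Cohen bracket `[g, h] = k g h' - l g' h` of functions `g`, `h` of weights `k`, `l`,
where `' = q d/dq = (2 π i)⁻¹ d/dτ`. -/
def rankinCohen (k l : ℂ) (g h : ℍ → ℂ) (τ : ℍ) : ℂ :=
  k * g τ * Derivative.normalizedDerivOfComplex h τ
    - l * Derivative.normalizedDerivOfComplex g τ * h τ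

/-- The bracket `[θ₃, θ₅]` of forms of weight `1/2`. -/
def bracketForm₁ : ℍ → ℂ := rankinCohen (1 / 2) (1 / 2) (unaryTheta 3) (unaryTheta 5)

/-- The bracket `[θ₁₅, θ₁]` of forms of weight `1/2`. -/
def bracketForm₂ : ℍ → ℂ := rankinCohen (1 / 2) (1 / 2) (unaryTheta 15) (unaryTheta 1)

/-- `f⁺(τ) = η(τ) η(3τ) η(5τ) η(15τ) ∑_{m, n} q ^ (m² + m n + 4 n²)`. -/
def fPlus (τ : ℍ) : ℂ :=
  ModularForm.eta τ * ModularForm.eta (3 * τ) * ModularForm.eta (5 * τ) *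
    ModularForm.eta (15 * τ) * binaryTheta τ

/-- The coefficient `b_n` in the Fourier expansion `f = ∑ b_n q ^ n`, `q = exp (2 π i τ)`. -/
def fourierCoefficient (f : ℍ → ℂ) (n : ℕ) : ℂ := (qExpansion 1 f).coeff n

/-- `L(f, s) = ∑_{n ≥ 1} b_n n ^ (-s)`, where `f = ∑ b_n q ^ n`. -/
def formLSeries (f : ℍ → ℂ) (s : ℂ) : ℂ := LSeries (fourierCoefficient f) s

/-- The term of the left-hand lattice sum at `(m, k)`. -/
def leftTerm (m k : ℝ) : ℝ :=
  (m ^ 2 - 15 * k ^ 2) / (m ^ 2 + 15 * k ^ 2) ^ 3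
    + (5 * k ^ 2 - 3 * m ^ 2) / (3 * m ^ 2 + 5 * k ^ 2) ^ 3

/-- The term of the right-hand lattice sum at `(m, k)`. -/
def rightTerm (m k : ℝ) : ℝ :=
  1 / 2 * ((2 * m ^ 2 + 2 * m * k - 7 * k ^ 2) / (m ^ 2 + m * k + 4 * k ^ 2) ^ 3)
    + 1 / 2 * ((m ^ 2 + 8 * m * k + k ^ 2) / (2 * m ^ 2 + m * k + 2 * k ^ 2) ^ 3)

end

/-!
The forms `A = m² + m k + 4 k²` and `B = 2 m² + m k + 2 k²` represent the two classes of
discriminant `-15`. Let `P_A = 2 m² + 2 m k - 7 k²` and `P_B = m² + 8 m k + k²` be the harmonic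
weights, and let `Θ_A`, `Θ_B` be the theta series of `A` and `B` without weights.

*The form `f⁺` as a lattice sum.* With `x = η(3τ) η(5τ)` and `y = η(τ) η(15τ)` the form is
`f⁺ = x y Θ_A`, and the main point is that `4 f⁺ = ∑ P_A q ^ A + ∑ P_B q ^ B` (`fPlus_eq`).
This follows from two facts.

* In weight one, `Θ_A + Θ_B = 2 x² / y` and `Θ_A - Θ_B = 2 y² / x`, so that `x y Θ_A = x³ + y³`
  (`latticeTheta_formA_mul_eta`). Consider the quotients of the two sides of these identities.
  Under `SL(2, ℤ)` the absolute values of their transforms are permuted like the points of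
  `P¹(𝔽₃) × P¹(𝔽₅)`, the cosets of `Γ₀(15)`, and at each cusp the transform is again one of the two
  quotients, holomorphic in `q` with value `1` at `q = 0`. By the maximum principle
  (`eq_one_of_maximum_principle`) both are constant. No dimension formula or valence formula is
  needed. The transforms of the theta series are computed by Poisson summation and by the Weil
  representation, whose relevant vectors are the quadratic phases `weilVector`.
* By Jacobi's identity `η³ = ∑ (4 n + 1) q ^ ((4 n + 1)² / 8)` (`eta_pow_three`), which is another
  instance of the maximum principle, `x³` and `y³` are sums over `ℤ²`. They are lattice sums for `A`
  and `B` after a linear substitution, and symmetrizing the weights under the automorphisms of the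
  forms gives `P_A` and `P_B` (`tsum_weightA`, `tsum_weightB`).

*The `L`-series.* The brackets are lattice sums of the forms `3 m² + 5 k²` and `m² + 15 k²`, which
are the restrictions of `B` and `A` to sublattices of index two. So `L(f₁, s)` and `L(f₂, s)` are
`1 / 4` times the parts of `∑ P_B B ^ (-s)` with `m ≡ k` and of `∑ P_A A ^ (-s)` with `k` even,
modulo `2`. Since `A(2m, k) = 2 B(m, k)` and `B(2m, k) = 2 A(k, m)`, and since the automorphisms of
the forms permute the parity classes, these parts can be expressed through the full sums
(`tsum_weightA_even_snd`, `tsum_weightB_even_diag`), and this produces the Euler factor. At `s = 3`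
the factor is `1 - 1/8 + 8/64 = 1`, and the identity of lattice sums is the identity of `L`-values.
-/

/-! ### Lattice sums, their Fourier coefficients and their L-series -/

/-- The value `a x² + b x y + c y²` of a binary quadratic form, as a natural number. It is only
used for forms that are non-negative, where truncation does not occur. -/
def quadForm (a b c : ℤ) (v : ℤ × ℤ) : ℕ := (a * v.1 ^ 2 + b * v.1 * v.2 + c * v.2 ^ 2).toNat

/-- A function `Q : ℤ² → ℕ` that grows at least like the square of the norm. -/
def GrowsQuadratically (Q : ℤ × ℤ → ℕ) : Prop := ∀ v, v.1 ^ 2 + v.2 ^ 2 ≤ 2 * (Q v : ℤ)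

lemma quadForm_le {a b c : ℤ} (ha : 1 ≤ a) (hd : b ^ 2 ≤ (2 * a - 1) * (2 * c - 1))
    (v : ℤ × ℤ) : v.1 ^ 2 + v.2 ^ 2 ≤ 2 * (a * v.1 ^ 2 + b * v.1 * v.2 + c * v.2 ^ 2) := by
  obtain ⟨x, y⟩ := v
  have h1 : 0 ≤ (2 * a - 1) * ((2 * a - 1) * x ^ 2 + 2 * b * x * y + (2 * c - 1) * y ^ 2) := by
    nlinarith [sq_nonneg ((2 * a - 1) * x + b * y), mul_nonneg (sub_nonneg.2 hd) (sq_nonneg y)]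
  have h2 := nonneg_of_mul_nonneg_right h1 (by linarith)
  simp only
  linarith

lemma quadForm_cast {a b c : ℤ} (ha : 1 ≤ a) (hd : b ^ 2 ≤ (2 * a - 1) * (2 * c - 1))
    (v : ℤ × ℤ) :
    (quadForm a b c v : ℤ) = a * v.1 ^ 2 + b * v.1 * v.2 + c * v.2 ^ 2 := by
  rw [quadForm, Int.toNat_of_nonneg]
  nlinarith [quadForm_le ha hd v, sq_nonneg v.1, sq_nonneg v.2]

lemma quadForm_growsQuadratically {a b c : ℤ} (ha : 1 ≤ a)
    (hd : b ^ 2 ≤ (2 * a - 1) * (2 * c - 1)) : GrowsQuadratically (quadForm a b c) := fun v ↦ by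
  rw [quadForm_cast ha hd]
  exact quadForm_le ha hd v

namespace GrowsQuadratically

variable {Q : ℤ × ℤ → ℕ} (hQ : GrowsQuadratically Q)
include hQ

lemma pos {v : ℤ × ℤ} (hv : v ≠ 0) : 0 < Q v := by
  have h := hQ v
  rcases Nat.eq_zero_or_pos (Q v) with h0 | h0
  · rw [h0] at h
    refine absurd (Prod.ext ?_ ?_) hv <;> simp only [Prod.fst_zero, Prod.snd_zero] <;>
      push_cast at h <;> nlinarith [sq_nonneg v.1, sq_nonneg v.2]
  · exact h0

lemma norm_sq_le (v : ℤ × ℤ) : ‖v‖ ^ 2 ≤ 2 * (Q v : ℝ) := by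
  have h : ((v.1 ^ 2 + v.2 ^ 2 : ℤ) : ℝ) ≤ ((2 * (Q v : ℤ) : ℤ) : ℝ) := by exact_mod_cast hQ v
  push_cast at h
  rw [Prod.norm_def]
  rcases max_cases ‖v.1‖ ‖v.2‖ with ⟨h1, -⟩ | ⟨h1, -⟩ <;> rw [h1, Int.norm_eq_abs, sq_abs] <;>
    nlinarith [sq_nonneg (v.1 : ℝ), sq_nonneg (v.2 : ℝ)]

lemma summable_rpow {σ : ℝ} (hσ : 1 < σ) : Summable fun v ↦ (Q v : ℝ) ^ (-σ) := by
  have h0 : Summable fun v : ℤ × ℤ ↦ ‖v‖ ^ (-(2 * σ)) := by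
    have := EisensteinSeries.summable_one_div_norm_rpow (k := 2 * σ) (by linarith)
    rw [← (finTwoArrowEquiv ℤ).symm.summable_iff] at this
    refine this.congr fun v ↦ ?_
    simp only [Function.comp_def, finTwoArrowEquiv_symm_apply]
    congr 1
    rw [EisensteinSeries.norm_eq_max_natAbs, Prod.norm_def, Int.norm_eq_abs, Int.norm_eq_abs]
    simp [Nat.cast_natAbs]
  refine .of_norm_bounded_eventually (h0.mul_left (2 ^ σ)) ?_
  rw [Filter.eventually_cofinite]
  refine (Set.finite_singleton (0 : ℤ × ℤ)).subset fun v hv ↦ ?_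
  by_contra hne
  refine hv ?_
  have hv0 : 0 < ‖v‖ := norm_pos_iff.2 hne
  have hQ0 : 0 < (Q v : ℝ) := by exact_mod_cast hQ.pos hne
  rw [Real.norm_of_nonneg (by positivity), Real.rpow_neg hQ0.le, Real.rpow_neg hv0.le,
    ← div_eq_mul_inv, inv_le_comm₀ (by positivity) (by positivity), inv_div,
    div_le_iff₀ (by positivity), mul_comm 2 σ, mul_comm σ 2, Real.rpow_mul hv0.le,
    ← Real.mul_rpow hQ0.le (by norm_num)]
  refine Real.rpow_le_rpow (by positivity) ?_ (by linarith)
  have := hQ.norm_sq_le v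
  rw [Real.rpow_two]
  linarith

/-- Convergence of the lattice Dirichlet series `∑ w(v) Q(v)^{-s}` for a weight `w` of degree two.
The term at `v = 0` vanishes because `w 0 = 0`. -/
lemma summable_cpow {w : ℤ × ℤ → ℂ} {C : ℝ} (hw : ∀ v, ‖w v‖ ≤ C * Q v) {s : ℂ} (hs : 2 < s.re) :
    Summable fun v ↦ w v / (Q v : ℂ) ^ s := by
  refine .of_norm_bounded ((hQ.summable_rpow (σ := s.re - 1) (by linarith)).mul_left C) fun v ↦ ?_
  rcases Nat.eq_zero_or_pos (Q v) with h0 | h0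
  · have := hw v
    rw [h0] at this
    have h1 : w v = 0 := by simpa using this
    rw [h0, h1]
    simp [Real.zero_rpow (show 1 - s.re ≠ 0 by linarith)]
  · have h1 : 0 < (Q v : ℝ) := by exact_mod_cast h0
    rw [norm_div, norm_natCast_cpow_of_pos h0, div_le_iff₀ (by positivity), mul_assoc,
      ← Real.rpow_add h1]
    simpa using hw v

lemma summable_pow {w : ℤ × ℤ → ℂ} {C : ℝ} (hw : ∀ v, ‖w v‖ ≤ C * (Q v + 1)) {q : ℂ}
    (hq : ‖q‖ < 1) : Summable fun v ↦ w v * q ^ Q v := by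
  have hC : 0 ≤ C := by
    by_contra! h
    have h1 := hw 0
    have : (0 : ℝ) < Q 0 + 1 := by positivity
    nlinarith [norm_nonneg (w 0)]
  have ht : Filter.Tendsto (fun n : ℕ ↦ (n : ℝ) ^ 3 * ‖q‖ ^ n + (n : ℝ) ^ 2 * ‖q‖ ^ n)
      Filter.atTop (nhds (0 + 0)) :=
    (tendsto_pow_const_mul_const_pow_of_abs_lt_one 3 (by simpa)).add
      (tendsto_pow_const_mul_const_pow_of_abs_lt_one 2 (by simpa))
  obtain ⟨K, hK⟩ := ht.bddAbove_range
  refine .of_norm_bounded_eventually ((hQ.summable_rpow (σ := 2) (by norm_num)).mul_left (C * K)) ?_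
  rw [Filter.eventually_cofinite]
  refine (Set.finite_singleton (0 : ℤ × ℤ)).subset fun v hv ↦ ?_
  by_contra hne
  refine hv ?_
  have hQ0 : 0 < (Q v : ℝ) := by exact_mod_cast hQ.pos hne
  have h1 : (Q v : ℝ) ^ 3 * ‖q‖ ^ Q v + (Q v : ℝ) ^ 2 * ‖q‖ ^ Q v ≤ K := hK ⟨Q v, rfl⟩
  rw [norm_mul, norm_pow, Real.rpow_neg hQ0.le, ← div_eq_mul_inv, Real.rpow_two,
    le_div_iff₀ (by positivity)]
  calc ‖w v‖ * ‖q‖ ^ Q v * (Q v : ℝ) ^ 2 ≤ C * (Q v + 1) * ‖q‖ ^ Q v * (Q v : ℝ) ^ 2 := by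
        gcongr; exact hw v
    _ = C * ((Q v : ℝ) ^ 3 * ‖q‖ ^ Q v + (Q v : ℝ) ^ 2 * ‖q‖ ^ Q v) := by ring
    _ ≤ C * K := by gcongr

end GrowsQuadratically

/-- The coefficient `∑_{Q v = n} w v` of `q ^ n` in `∑ w(v) q ^ Q(v)`. -/
noncomputable def fiberSum {ι : Type*} (w : ι → ℂ) (Q : ι → ℕ) (n : ℕ) : ℂ :=
  ∑' v : Q ⁻¹' {n}, w v

/-- Collecting the terms of a lattice sum according to the value of `Q`. Both the `q`-series and
the Dirichlet series are instances, for `φ n = q ^ n` and `φ n = n ^ (-s)`. -/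
lemma hasSum_fiberSum {ι : Type*} {w : ι → ℂ} {Q : ι → ℕ} {φ : ℕ → ℂ} {a : ℂ}
    (h : HasSum (fun v ↦ w v * φ (Q v)) a) : HasSum (fun n ↦ fiberSum w Q n * φ n) a := by
  refine (h.tsum_fiberwise Q).congr_fun fun n ↦ ?_
  rw [fiberSum, ← tsum_mul_right]
  refine tsum_congr fun v ↦ ?_
  rw [show Q v = n from v.2]

/-- A power series that converges on the open unit disc represents its sum there. -/
lemma hasFPowerSeriesOnBall_tsum {c : ℕ → ℂ}
    (hc : ∀ q : ℂ, ‖q‖ < 1 → Summable fun n ↦ c n * q ^ n) :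
    HasFPowerSeriesOnBall (fun q ↦ ∑' n, c n * q ^ n) (.ofScalars ℂ c) 0 1 where
  r_le := by
    refine le_of_forall_lt_imp_le_of_dense fun r hr ↦ ?_
    lift r to NNReal using hr.ne_top
    refine FormalMultilinearSeries.le_radius_of_summable _ ?_
    have h := (hc (r : ℝ) (by simpa using hr)).norm
    simpa [norm_mul] using h
  r_pos := by simp
  hasSum := by
    intro y hy
    rw [← ENNReal.coe_one, Metric.eball_coe, NNReal.coe_one, mem_ball_zero_iff] at hy
    simpa [mul_comm] using (hc y hy).hasSum

lemma differentiableOn_tsum_pow {c : ℕ → ℂ}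
    (hc : ∀ q : ℂ, ‖q‖ < 1 → Summable fun n ↦ c n * q ^ n) :
    DifferentiableOn ℂ (fun q ↦ ∑' n, c n * q ^ n) (Metric.ball 0 1) := by
  have := (hasFPowerSeriesOnBall_tsum hc).differentiableOn
  rwa [← ENNReal.coe_one, Metric.eball_coe, NNReal.coe_one] at this

lemma hasDerivAt_tsum_pow_zero {c : ℕ → ℂ}
    (hc : ∀ q : ℂ, ‖q‖ < 1 → Summable fun n ↦ c n * q ^ n) :
    HasDerivAt (fun q ↦ ∑' n, c n * q ^ n) (c 1) 0 := by
  simpa using (hasFPowerSeriesOnBall_tsum hc).hasFPowerSeriesAt.hasDerivAt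

lemma qParam_one (z : ℂ) : Function.Periodic.qParam 1 z = cexp (2 * Real.pi * I * z) := by
  simp [Function.Periodic.qParam]

lemma hasSum_cuspFunction {f : ℍ → ℂ} {c : ℕ → ℂ}
    (hf : ∀ τ : ℍ, HasSum (fun n ↦ c n * cexp (2 * Real.pi * I * τ) ^ n) (f τ)) {q : ℂ}
    (hq1 : ‖q‖ < 1) (hq0 : q ≠ 0) : HasSum (fun n ↦ c n * q ^ n) (cuspFunction 1 f q) := by
  have h1 := Function.Periodic.im_invQParam_pos_of_norm_lt_one one_pos hq1 hq0
  have h2 := hf ⟨_, h1⟩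
  rw [← qParam_one, coe_mk, Function.Periodic.qParam_right_inv one_ne_zero hq0] at h2
  rwa [cuspFunction, Function.Periodic.cuspFunction_eq_of_nonzero _ _ hq0, Function.comp_apply,
    ofComplex_apply_of_im_pos h1]

/-- The cusp function of a convergent power series in `q` is analytic at `q = 0`, because its value
there is defined as the limit. -/
lemma analyticAt_cuspFunction_of_hasSum {f : ℍ → ℂ} {c : ℕ → ℂ}
    (hf : ∀ τ : ℍ, HasSum (fun n ↦ c n * cexp (2 * Real.pi * I * τ) ^ n) (f τ)) :
    AnalyticAt ℂ (cuspFunction 1 f) 0 := by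
  have hc (q : ℂ) (hq1 : ‖q‖ < 1) : Summable fun n ↦ c n * q ^ n := by
    rcases eq_or_ne q 0 with rfl | hq0
    · exact summable_of_ne_finset_zero (s := {0}) fun n hn ↦ by simp_all
    · exact (hasSum_cuspFunction hf hq1 hq0).summable
  have han := (hasFPowerSeriesOnBall_tsum hc).analyticAt
  have hev : ∀ᶠ q in nhdsWithin 0 {0}ᶜ, cuspFunction 1 f q = ∑' n, c n * q ^ n := by
    filter_upwards [self_mem_nhdsWithin, mem_nhdsWithin_of_mem_nhds
      (Metric.ball_mem_nhds (0 : ℂ) one_pos)] with q hq0 hq1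
    exact (hasSum_cuspFunction hf (by simpa using hq1) hq0).tsum_eq.symm
  refine han.congr ?_
  rw [← nhdsNE_sup_pure (0 : ℂ), Filter.EventuallyEq, Filter.eventually_sup]
  refine ⟨hev.mono fun _ h ↦ h.symm, ?_⟩
  rw [Filter.eventually_pure, cuspFunction,
    Function.Periodic.cuspFunction_zero_eq_limUnder_nhds_ne]
  refine (Filter.Tendsto.limUnder_eq ?_).symm
  exact (han.continuousAt.tendsto.mono_left nhdsWithin_le_nhds).congr'
    (hev.mono fun _ h ↦ h.symm)

/-- The Fourier coefficients of a convergent power series in `q` are its coefficients. -/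
lemma fourierCoefficient_eq {f : ℍ → ℂ} {c : ℕ → ℂ}
    (hf : ∀ τ : ℍ, HasSum (fun n ↦ c n * cexp (2 * Real.pi * I * τ) ^ n) (f τ)) :
    fourierCoefficient f = c := by
  have han := analyticAt_cuspFunction_of_hasSum hf
  have h1 := (hasFPowerSeriesOnBall_cuspFunction one_pos han (c := c)
    (fun τ ↦ by rw [qParam_one]; exact hf τ)).hasFPowerSeriesAt
  funext n
  have h2 := congr_arg (FormalMultilinearSeries.coeff · n)
    (h1.eq_formalMultilinearSeries han.hasFPowerSeriesAt)
  simp only [FormalMultilinearSeries.coeff_ofScalars] at h2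
  rw [fourierCoefficient, qExpansion_coeff, h2, div_eq_inv_mul]

/-- The `L`-series of a form given by a lattice sum `∑ w(v) q ^ Q(v)`. -/
lemma lSeries_fiberSum {w : ℤ × ℤ → ℂ} {Q : ℤ × ℤ → ℕ} (hQ : GrowsQuadratically Q) {C : ℝ}
    (hw : ∀ v, ‖w v‖ ≤ C * Q v) {s : ℂ} (hs : 2 < s.re) :
    LSeriesSummable (fiberSum w Q) s ∧
      HasSum (fun v ↦ w v / (Q v : ℂ) ^ s) (LSeries (fiberSum w Q) s) := by
  have hs0 : s ≠ 0 := fun h ↦ by norm_num [h] at hs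
  have h := (hQ.summable_cpow hw hs).hasSum
  have h1 : HasSum (LSeries.term (fiberSum w Q) s) (∑' v, w v / (Q v : ℂ) ^ s) := by
    simp_rw [div_eq_mul_inv] at h ⊢
    refine (hasSum_fiberSum (φ := fun n ↦ ((n : ℂ) ^ s)⁻¹) h).congr_fun fun n ↦ ?_
    rcases eq_or_ne n 0 with rfl | hn
    · simp [hs0]
    · rw [LSeries.term_of_ne_zero hn, div_eq_mul_inv]
  exact ⟨h1.summable, by rw [LSeries, h1.tsum_eq]; exact h⟩

/-- The Fourier coefficients of a lattice sum `∑ w(v) q ^ Q(v)`. -/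
lemma fourierCoefficient_latticeSum {ι : Type*} {f : ℍ → ℂ} {w : ι → ℂ} {Q : ι → ℕ}
    (hf : ∀ τ : ℍ, HasSum (fun v ↦ w v * cexp (2 * Real.pi * I * τ) ^ Q v) (f τ)) :
    fourierCoefficient f = fiberSum w Q :=
  fourierCoefficient_eq fun τ ↦ hasSum_fiberSum (hf τ)

/-! ### A maximum principle for families of modular functions -/

open ModularGroup in
/-- If `S` and `T` permute a family of functions on the upper half-plane, so does `SL(2, ℤ)`. -/
lemma exists_perm_of_generators {ι α : Type*} {h : ι → ℍ → α}
    (hS : ∃ σ : Equiv.Perm ι, ∀ i τ, h i (S • τ) = h (σ i) τ)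
    (hT : ∃ σ : Equiv.Perm ι, ∀ i τ, h i (T • τ) = h (σ i) τ)
    (γ : Matrix.SpecialLinearGroup (Fin 2) ℤ) :
    ∃ σ : Equiv.Perm ι, ∀ i τ, h i (γ • τ) = h (σ i) τ := by
  have hγ : γ ∈ Subgroup.closure {S, T} := by simp [SpecialLinearGroup.SL2Z_generators]
  induction hγ using Subgroup.closure_induction with
  | mem x hx =>
    rcases hx with rfl | rfl
    exacts [hS, hT]
  | one => exact ⟨1, by simp⟩
  | mul x y _ _ hx hy =>
    obtain ⟨σ, hσ⟩ := hx
    obtain ⟨σ', hσ'⟩ := hy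
    exact ⟨σ' * σ, fun i τ ↦ by rw [mul_smul, hσ, hσ', Equiv.Perm.mul_apply]⟩
  | inv x _ hx =>
    obtain ⟨σ, hσ⟩ := hx
    refine ⟨σ⁻¹, fun i τ ↦ ?_⟩
    have := hσ (σ⁻¹ i) (x⁻¹ • τ)
    rw [smul_inv_smul, Equiv.Perm.coe_inv, Equiv.apply_symm_apply] at this
    exact this.symm

/-- A maximum principle on a modular curve, in terms of absolute values. A finite family of
functions `h i`, permuted by `S` and `T`, consists of the absolute values of functions `ρ k` of
`q` at points `(τ + b) / d`, where each `ρ k` is holomorphic on the unit disc and equal to `1` at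
the cusp `q = 0`. Moving points of the upper half-plane to imaginary part at least `1 / 2`, one
sees that the supremum of all `‖ρ k‖` is attained inside the disc, so all `ρ k` are constant. -/
theorem eq_one_of_maximum_principle {ι κ : Type*} [Finite κ] {h : ι → ℍ → ℝ} {ρ : κ → ℂ → ℂ}
    (hS : ∃ σ : Equiv.Perm ι, ∀ i τ, h i (ModularGroup.S • τ) = h (σ i) τ)
    (hT : ∃ σ : Equiv.Perm ι, ∀ i τ, h i (ModularGroup.T • τ) = h (σ i) τ)
    (hρ : ∀ k, DifferentiableOn ℂ (ρ k) (Metric.ball 0 1)) (h0 : ∀ k, ρ k 0 = 1) {N : ℕ}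
    (hcusp : ∀ i, ∃ (k : κ) (d : ℕ) (b : ℤ), 0 < d ∧ d ≤ N ∧
      ∀ τ : ℍ, h i τ = ‖ρ k (cexp (2 * Real.pi * I * ((τ + b) / d)))‖)
    (hall : ∀ k, ∃ (i : ι) (d : ℕ), 0 < d ∧
      ∀ τ τ' : ℍ, (τ' : ℂ) = d * τ → ‖ρ k (cexp (2 * Real.pi * I * τ))‖ = h i τ')
    (k : κ) {q : ℂ} (hq : ‖q‖ < 1) : ρ k q = 1 := by
  have hN : 0 < N := by
    obtain ⟨i, -⟩ := hall k
    obtain ⟨_, d, _, hd, hdN, -⟩ := hcusp i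
    omega
  have hN' : (0 : ℝ) < N := by exact_mod_cast hN
  set r : ℝ := Real.exp (-Real.pi / N) with hr
  have hr1 : r < 1 := by
    rw [hr, Real.exp_lt_one_iff, neg_div]
    exact neg_neg_of_pos (by positivity)
  have hsub : Metric.closedBall (0 : ℂ) r ⊆ Metric.ball 0 1 := Metric.closedBall_subset_ball hr1
  have hmax (k : κ) : ∃ p ∈ Metric.closedBall (0 : ℂ) r,
      IsMaxOn (fun q ↦ ‖ρ k q‖) (Metric.closedBall 0 r) p :=
    (isCompact_closedBall 0 r).exists_isMaxOn ⟨0, by simp [hr, Real.exp_nonneg]⟩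
      ((hρ k).continuousOn.mono hsub).norm
  choose p hp hpmax using hmax
  have : Nonempty κ := ⟨k⟩
  obtain ⟨k₀, hk₀⟩ := Finite.exists_max fun k ↦ ‖ρ k (p k)‖
  have hle (k : κ) {q : ℂ} (hq : ‖q‖ < 1) : ‖ρ k q‖ ≤ ‖ρ k₀ (p k₀)‖ := by
    have hsmall (k : κ) {q : ℂ} (hq : ‖q‖ ≤ r) : ‖ρ k q‖ ≤ ‖ρ k₀ (p k₀)‖ :=
      (hpmax k (by simpa using hq)).trans (hk₀ k)
    rcases eq_or_ne q 0 with rfl | hq0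
    · exact hsmall k (by simp [hr, Real.exp_nonneg])
    have h1 := Function.Periodic.im_invQParam_pos_of_norm_lt_one one_pos hq hq0
    set τ : ℍ := ⟨_, h1⟩ with hτ
    have hqτ : q = cexp (2 * Real.pi * I * τ) := by
      rw [← qParam_one, hτ, coe_mk, Function.Periodic.qParam_right_inv one_ne_zero hq0]
    obtain ⟨i, d, hd, hi⟩ := hall k
    have hd' : 0 < (d : ℝ) := by exact_mod_cast hd
    set τ' : ℍ := ⟨d * τ, by simpa using mul_pos hd' τ.im_pos⟩ with hτ'
    obtain ⟨γ, hγ⟩ := ModularGroup.exists_one_half_le_im_smul τ'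
    obtain ⟨σ, hσ⟩ := exists_perm_of_generators hS hT γ⁻¹
    obtain ⟨k', d', b, hd0', hdN, hk'⟩ := hcusp (σ i)
    have hd0 : (0 : ℝ) < d' := by exact_mod_cast hd0'
    rw [hqτ, hi τ τ' rfl, ← inv_smul_smul γ τ', hσ, hk']
    refine hsmall k' ?_
    rw [Complex.norm_exp, hr, Real.exp_le_exp]
    have : (2 * Real.pi * I * (((γ • τ' : ℍ) + b) / d' : ℂ)).re
        = -(2 * Real.pi * (γ • τ').im / d') := by
      rw [show (2 * Real.pi * I * (((γ • τ' : ℍ) + b) / d' : ℂ))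
        = ((2 * Real.pi / d' : ℝ) : ℂ) * (((γ • τ' : ℍ) + (b : ℝ) : ℂ) * I) by push_cast; ring,
        re_ofReal_mul]
      simp
      ring
    rw [this, neg_div, neg_le_neg_iff]
    have hdN' : (d' : ℝ) ≤ N := by exact_mod_cast hdN
    calc Real.pi / N ≤ Real.pi / d' := by gcongr
      _ ≤ _ := by gcongr; nlinarith [Real.pi_pos]
  have hconn : IsPreconnected (Metric.ball (0 : ℂ) 1) := (convex_ball 0 1).isPreconnected
  have hone : ‖ρ k₀ (p k₀)‖ = 1 := by
    have := Complex.eqOn_of_isPreconnected_of_isMaxOn_norm hconn Metric.isOpen_ball (hρ k₀)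
      (hsub (hp k₀)) (fun z hz ↦ hle k₀ (by simpa using hz))
    have h1 := this (Metric.mem_ball_self one_pos)
    rw [Function.const_apply, h0] at h1
    rw [← h1, norm_one]
  have := Complex.eqOn_of_isPreconnected_of_isMaxOn_norm hconn Metric.isOpen_ball (hρ k)
    (Metric.mem_ball_self one_pos) (fun z hz ↦ by
      have := hle k (q := z) (by simpa using hz)
      rw [hone] at this
      simpa [h0] using this)
  rw [this (by simpa using hq), Function.const_apply, h0]

/-! ### The absolute value of the eta function under modular transformations -/

/-- Euler's product `∏ (1 - q ^ n)`. -/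
noncomputable def eulerProduct (q : ℂ) : ℂ := ∏' n : ℕ, (1 - q ^ (n + 1))

lemma differentiableOn_eulerProduct : DifferentiableOn ℂ eulerProduct (Metric.ball 0 1) :=
  ModularForm.differentiableOn_tprod_one_sub_pow

lemma eulerProduct_zero : eulerProduct 0 = 1 := by
  simp [eulerProduct]

lemma eta_eq (z : ℂ) : ModularForm.eta z
    = cexp (2 * Real.pi * I * z / 24) * eulerProduct (cexp (2 * Real.pi * I * z)) := by
  rw [ModularForm.eta, eulerProduct]
  simp only [ModularForm.eta_q_eq_pow]
  simp [Function.Periodic.qParam]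

lemma eulerProduct_ne_zero {q : ℂ} (hq : ‖q‖ < 1) : eulerProduct q ≠ 0 := by
  rcases eq_or_ne q 0 with rfl | hq0
  · simp [eulerProduct_zero]
  · have h1 := Function.Periodic.im_invQParam_pos_of_norm_lt_one one_pos hq hq0
    have h2 := ModularForm.eta_ne_zero h1
    rw [eta_eq, ← qParam_one, Function.Periodic.qParam_right_inv one_ne_zero hq0] at h2
    exact right_ne_zero_of_mul h2

lemma eta_add_one (z : ℂ) :
    ModularForm.eta (z + 1) = cexp (2 * Real.pi * I / 24) * ModularForm.eta z := by
  rw [eta_eq, eta_eq, mul_add (2 * Real.pi * I : ℂ), mul_one, Complex.exp_periodic, add_div,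
    Complex.exp_add]
  ring

lemma norm_eta_add_int (z : ℂ) (n : ℤ) : ‖ModularForm.eta (z + n)‖ = ‖ModularForm.eta z‖ := by
  have key (w : ℂ) : ‖ModularForm.eta (w + 1)‖ = ‖ModularForm.eta w‖ := by
    rw [eta_add_one, norm_mul, show (2 * Real.pi * I / 24 : ℂ) = (2 * Real.pi / 24 : ℝ) * I by
      push_cast; ring, Complex.norm_exp_ofReal_mul_I, one_mul]
  induction n using Int.induction_on with
  | zero => simp
  | succ n ih =>
    rw [← ih, Int.cast_add, Int.cast_one, ← add_assoc]
    exact key _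
  | pred n ih =>
    rw [← ih, ← key]
    congr 2
    push_cast
    ring

/-- The transformation law of `|η|` under `SL(2, ℤ)`, read off from that of `Δ = η ^ 24`. -/
lemma norm_eta_smul (γ : Matrix.SpecialLinearGroup (Fin 2) ℤ) (τ : ℍ) :
    ‖ModularForm.eta (γ • τ : ℍ)‖ = √‖denom γ τ‖ * ‖ModularForm.eta τ‖ := by
  have h := congr_fun (SlashInvariantForm.slash_action_generators_SL2Z ModularForm.discriminant_S_invariant
    ModularForm.discriminant_T_invariant γ) τ
  have h' := congr_arg norm h
  rw [ModularForm.SL_slash_apply, norm_mul, norm_zpow] at h'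
  simp only [ModularForm.discriminant, norm_pow] at h'
  have hd : 0 < ‖denom γ τ‖ := norm_pos_iff.2 (denom_ne_zero _ _)
  refine (pow_left_inj₀ (norm_nonneg _) (by positivity) (n := 24) (by norm_num)).1 ?_
  rw [mul_pow, show (24 : ℕ) = 2 * 12 by norm_num, pow_mul √_, Real.sq_sqrt (norm_nonneg _),
    show 2 * 12 = 24 by norm_num, ← h', zpow_neg, mul_left_comm]
  rw [show ‖denom γ τ‖ ^ 12 = ‖denom γ τ‖ ^ (12 : ℤ) by norm_cast, mul_inv_cancel₀ (by positivity),
    mul_one]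

/-- The action of `S` on the functions `τ ↦ |η((a τ + b) / d)|` with `a d = n`. The divisibility
conditions say that `(a b; 0 d) S = γ (a' b'; 0 d')` with an integral matrix `γ`. -/
lemma norm_eta_neg_inv {n a b d a' b' d' : ℤ} (ha : 0 < a) (hd : 0 < d) (ha' : 0 < a')
    (hd' : 0 < d') (hn : a * d = n) (hn' : a' * d' = n) (h1 : n ∣ b * d')
    (h2 : n ∣ b * b' + a * a') (h3 : n ∣ d * d') (h4 : n ∣ d * b') (τ : ℍ) :
    ‖ModularForm.eta ((a * (-1 / τ) + b) / d)‖
      = √(‖(τ : ℂ)‖ * (d / d')) * ‖ModularForm.eta ((a' * τ + b') / d')‖ := by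
  obtain ⟨p, hp⟩ := h1
  obtain ⟨q, hq⟩ := h2
  obtain ⟨r, hr⟩ := h3
  obtain ⟨s, hs⟩ := h4
  have hn0 : 0 < n := hn ▸ mul_pos ha hd
  have hdet : Matrix.det !![p, -q; r, -s] = 1 := by
    rw [Matrix.det_fin_two_of]
    refine mul_left_cancel₀ (mul_pos hn0 hn0).ne' ?_
    linear_combination hp * (n * s) + hs * (b * d') - hq * (n * r) - hr * (b * b' + a * a')
      + hn * (a' * d') + hn' * n
  set γ : Matrix.SpecialLinearGroup (Fin 2) ℤ := ⟨!![p, -q; r, -s], hdet⟩ with hγ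
  have hτ : (τ : ℂ) ≠ 0 := ne_zero τ
  have haC : (a' : ℂ) ≠ 0 := by exact_mod_cast ha'.ne'
  have hdC : (d : ℂ) ≠ 0 := by exact_mod_cast hd.ne'
  have hdC' : (d' : ℂ) ≠ 0 := by exact_mod_cast hd'.ne'
  have hnC : (n : ℂ) ≠ 0 := by exact_mod_cast hn0.ne'
  have him : 0 < (((a' : ℂ) * τ + b') / d').im := by
    rw [show ((a' : ℂ) * τ + b') / d' = ((a' / d' : ℝ) : ℂ) * τ + ((b' / d' : ℝ) : ℂ) by
      push_cast; ring]
    rw [add_im, ofReal_im, add_zero, im_ofReal_mul]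
    have : (0 : ℝ) < a' / d' := div_pos (by exact_mod_cast ha') (by exact_mod_cast hd')
    exact mul_pos this τ.im_pos
  set w : ℍ := ⟨_, him⟩ with hw
  have hp' : (p : ℂ) = b * d' / n := by
    rw [eq_div_iff hnC]; exact_mod_cast (mul_comm n p ▸ hp).symm
  have hq' : (q : ℂ) = (b * b' + a * a') / n := by
    rw [eq_div_iff hnC]; exact_mod_cast (mul_comm n q ▸ hq).symm
  have hr' : (r : ℂ) = d * d' / n := by
    rw [eq_div_iff hnC]; exact_mod_cast (mul_comm n r ▸ hr).symm
  have hs' : (s : ℂ) = d * b' / n := by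
    rw [eq_div_iff hnC]; exact_mod_cast (mul_comm n s ▸ hs).symm
  have hnn : (n : ℂ) = a' * d' := by exact_mod_cast hn'.symm
  have hden : denom γ w = τ * (d / d') := by
    rw [ModularGroup.denom_apply]
    simp [hγ, hw, hr', hs', hnn]
    field_simp
    ring
  have hsm : ((γ • w : ℍ) : ℂ) = (a * (-1 / τ) + b) / d := by
    rw [UpperHalfPlane.coe_specialLinearGroup_apply]
    simp [hγ, hw, hr', hs', hp', hq', hnn]
    field_simp
    ring
  rw [← hsm, norm_eta_smul, hden, norm_mul, hw]
  congr 3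
  rw [← ofReal_intCast, ← ofReal_intCast, ← ofReal_div, norm_real, Real.norm_of_nonneg]
  exact div_nonneg (by exact_mod_cast hd.le) (by exact_mod_cast hd'.le)

/-! ### The cube of the eta function -/

lemma HasSum.int_even_add_odd {f : ℤ → ℂ} {a b : ℂ} (he : HasSum (fun k ↦ f (2 * k)) a)
    (ho : HasSum (fun k ↦ f (2 * k + 1)) b) : HasSum f (a + b) := by
  have h2 := mul_right_injective₀ (two_ne_zero' ℤ)
  replace he := h2.hasSum_range_iff.2 he
  replace ho := ((add_left_injective (1 : ℤ)).comp h2).hasSum_range_iff.2 ho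
  refine he.add_isCompl ?_ ho
  simpa [Function.comp_def] using Int.isCompl_even_odd

/-- The theta series `∑ (4 n + 1) q ^ ((4 n + 1)² / 8)` of weight `3 / 2`. -/
noncomputable def thetaCubed (τ : ℂ) : ℂ :=
  ∑' n : ℤ, (4 * n + 1) * cexp (2 * Real.pi * I * ((4 * n + 1) ^ 2 / 8) * τ)

lemma hasSum_thetaCubed_jacobi {τ : ℂ} (hτ : 0 < τ.im) :
    HasSum (fun n : ℤ ↦ (4 * n + 1) * cexp (2 * Real.pi * I * ((4 * n + 1) ^ 2 / 8) * τ))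
      (cexp (Real.pi * I * τ / 4) *
        (4 / (2 * Real.pi * I) * jacobiTheta₂' τ (4 * τ) + jacobiTheta₂ τ (4 * τ))) := by
  have h4 : 0 < (4 * τ).im := by simpa using hτ
  refine HasSum.congr_fun ((((hasSum_jacobiTheta₂'_term τ h4).mul_left (4 / (2 * Real.pi * I))).add
    (hasSum_jacobiTheta₂_term τ h4)).mul_left (cexp (Real.pi * I * τ / 4))) fun n ↦ ?_
  have hpi : (Real.pi : ℂ) ≠ 0 := by exact_mod_cast Real.pi_ne_zero
  rw [jacobiTheta₂'_term, jacobiTheta₂_term,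
    show (2 * Real.pi * I * ((4 * n + 1) ^ 2 / 8) * τ : ℂ) = Real.pi * I * τ / 4
      + (2 * Real.pi * I * n * τ + Real.pi * I * n ^ 2 * (4 * τ)) by ring, Complex.exp_add]
  field_simp

lemma hasSum_thetaCubed {τ : ℂ} (hτ : 0 < τ.im) :
    HasSum (fun n : ℤ ↦ (4 * n + 1) * cexp (2 * Real.pi * I * ((4 * n + 1) ^ 2 / 8) * τ))
      (thetaCubed τ) :=
  (hasSum_thetaCubed_jacobi hτ).summable.hasSum

/-- The sum `∑ n (-i) ^ n q ^ (n² / 8)` only involves odd `n`, and the classes `1` and `3` modulo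
`4` contribute equally. -/
lemma jacobiTheta₂'_neg_quarter {τ : ℂ} (hτ : 0 < τ.im) :
    jacobiTheta₂' (-1 / 4) (τ / 4) = 4 * Real.pi * thetaCubed τ := by
  have h4 : 0 < (τ / 4).im := by simpa using hτ
  set F : ℤ → ℂ := fun n ↦ jacobiTheta₂'_term n (-1 / 4) (τ / 4) with hF
  have hI : cexp (-(Real.pi * I / 2)) = -I := by
    rw [Complex.exp_neg, show (Real.pi * I / 2 : ℂ) = Real.pi / 2 * I by ring, exp_pi_div_two_mul_I,
      inv_I]
  have hodd (l : ℤ) : F (2 * (2 * l) + 1)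
      = 2 * Real.pi * ((4 * l + 1) * cexp (2 * Real.pi * I * ((4 * l + 1) ^ 2 / 8) * τ)) := by
    simp only [hF, jacobiTheta₂'_term, jacobiTheta₂_term]
    rw [show 2 * Real.pi * I * ((2 * (2 * l) + 1 : ℤ) : ℂ) * (-1 / 4)
        + Real.pi * I * ((2 * (2 * l) + 1 : ℤ) : ℂ) ^ 2 * (τ / 4)
      = ((-l : ℤ) : ℂ) * (2 * Real.pi * I) + (-(Real.pi * I / 2)
        + 2 * Real.pi * I * ((4 * l + 1) ^ 2 / 8) * τ) by push_cast; ring, Complex.exp_add,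
      exp_int_mul_two_pi_mul_I, Complex.exp_add, hI]
    push_cast
    linear_combination (-2 * Real.pi * (4 * l + 1)
      * cexp (2 * Real.pi * I * ((4 * l + 1) ^ 2 / 8) * τ)) * I_sq
  have hodd' (l : ℤ) : F (2 * (2 * l + 1) + 1) = F (2 * (2 * (-1 - l)) + 1) := by
    rw [hodd]
    simp only [hF, jacobiTheta₂'_term, jacobiTheta₂_term]
    rw [show 2 * Real.pi * I * ((2 * (2 * l + 1) + 1 : ℤ) : ℂ) * (-1 / 4)
        + Real.pi * I * ((2 * (2 * l + 1) + 1 : ℤ) : ℂ) ^ 2 * (τ / 4)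
      = ((-l - 1 : ℤ) : ℂ) * (2 * Real.pi * I) + (-(-(Real.pi * I / 2))
        + 2 * Real.pi * I * ((4 * ((-1 - l : ℤ) : ℂ) + 1) ^ 2 / 8) * τ) by push_cast; ring,
      Complex.exp_add, exp_int_mul_two_pi_mul_I, Complex.exp_add, Complex.exp_neg (-_), hI, inv_neg,
      inv_I]
    push_cast
    linear_combination (2 * Real.pi * (4 * l + 3)
      * cexp (2 * Real.pi * I * ((4 * (-1 - l) + 1) ^ 2 / 8) * τ)) * I_sq
  have heven : HasSum (fun k : ℤ ↦ F (2 * k)) 0 := by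
    have hs : Summable fun k : ℤ ↦ F (2 * k) :=
      (hasSum_jacobiTheta₂'_term _ h4).summable.comp_injective
        (mul_right_injective₀ (two_ne_zero' ℤ))
    have h1 : ∑' k : ℤ, F (2 * k) = -∑' k : ℤ, F (2 * k) := by
      rw [← tsum_neg, ← (Equiv.neg ℤ).tsum_eq]
      refine tsum_congr fun k ↦ ?_
      simp only [hF, jacobiTheta₂'_term, jacobiTheta₂_term, Equiv.neg_apply]
      rw [show 2 * Real.pi * I * ((2 * -k : ℤ) : ℂ) * (-1 / 4)
          + Real.pi * I * ((2 * -k : ℤ) : ℂ) ^ 2 * (τ / 4)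
        = (k : ℂ) * (2 * Real.pi * I) + (2 * Real.pi * I * ((2 * k : ℤ) : ℂ) * (-1 / 4)
          + Real.pi * I * ((2 * k : ℤ) : ℂ) ^ 2 * (τ / 4)) by push_cast; ring, Complex.exp_add,
        exp_int_mul_two_pi_mul_I]
      push_cast
      ring
    have h2 : ∑' k : ℤ, F (2 * k) = 0 := by linear_combination h1 / 2
    exact h2 ▸ hs.hasSum
  have h1 := (hasSum_thetaCubed hτ).mul_left (2 * Real.pi : ℂ)
  have h2 : HasSum (fun k : ℤ ↦ F (2 * k + 1))
      (2 * Real.pi * thetaCubed τ + 2 * Real.pi * thetaCubed τ) := by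
    refine HasSum.int_even_add_odd (f := fun k ↦ F (2 * k + 1)) ?_ ?_
    · simpa only [hodd] using h1
    · simp only [hodd']
      rw [← (Equiv.subLeft (-1 : ℤ)).hasSum_iff] at h1
      exact h1.congr_fun fun l ↦ hodd _
  have h3 := heven.int_even_add_odd h2
  rw [jacobiTheta₂', show (fun n ↦ jacobiTheta₂'_term n (-1 / 4) (τ / 4)) = F from rfl, h3.tsum_eq]
  ring

lemma norm_thetaCubed_neg_inv {τ : ℂ} (hτ : 0 < τ.im) :
    ‖thetaCubed (-1 / τ)‖ = √‖τ‖ ^ 3 * ‖thetaCubed τ‖ := by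
  have hτ0 : τ ≠ 0 := fun h ↦ by simp [h] at hτ
  have him : 0 < (-1 / τ).im := by
    have := UpperHalfPlane.im_inv_neg_coe_pos ⟨τ, hτ⟩
    rwa [neg_div, one_div, ← inv_neg]
  have h := jacobiTheta₂'_functional_equation (-1 / 4) (τ / 4)
  rw [jacobiTheta₂'_neg_quarter hτ] at h
  have hJ := (hasSum_thetaCubed him).unique (hasSum_thetaCubed_jacobi him)
  have hpi : (Real.pi : ℂ) ≠ 0 := by exact_mod_cast Real.pi_ne_zero
  set c : ℂ := (-I * (τ / 4)) ^ (1 / 2 : ℂ) with hc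
  have hc2 : c ^ 2 = -I * (τ / 4) := by
    rw [hc, ← cpow_nat_mul]
    simp
  have hcn : ‖c‖ = √‖τ‖ / 2 := by
    refine (pow_left_inj₀ (norm_nonneg _) (by positivity) two_ne_zero).1 ?_
    rw [← norm_pow, hc2, div_pow, Real.sq_sqrt (norm_nonneg _), norm_mul, norm_div, norm_neg,
      norm_I, norm_ofNat]
    norm_num
  have hc0 : c ≠ 0 := by
    rw [← norm_ne_zero_iff, hcn]
    have : 0 < √‖τ‖ := Real.sqrt_pos.2 (norm_pos_iff.2 hτ0)
    positivity
  rw [show (-1 / 4 : ℂ) / (τ / 4) = -1 / τ by field_simp,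
    show (-1 : ℂ) / (τ / 4) = 4 * (-1 / τ) by field_simp,
    show -Real.pi * I * (-1 / 4 : ℂ) ^ 2 / (τ / 4) = Real.pi * I * (-1 / τ) / 4 by field_simp] at h
  have h1 : thetaCubed (-1 / τ) * I = 2 * c * τ * thetaCubed τ := by
    have h2 : 4 * Real.pi * thetaCubed τ = 1 / c * (4 / τ) * (Real.pi * I / 2)
        * thetaCubed (-1 / τ) := by
      rw [h, hJ]
      field_simp
      ring
    generalize thetaCubed (-1 / τ) = J at h2 ⊢
    field_simp at h2
    linear_combination -h2
  have h3 := congr_arg norm h1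
  rw [norm_mul, norm_I, mul_one, norm_mul, norm_mul, norm_mul, hcn] at h3
  rw [h3]
  have h4 : √‖τ‖ ^ 3 = √‖τ‖ * ‖τ‖ := by
    rw [pow_succ', Real.sq_sqrt (norm_nonneg τ)]
  rw [h4, norm_ofNat]
  ring

/-- The exponent `2 n² + n` of `q` in the series for `η³`, up to the factor `q ^ (1 / 8)`. -/
def thetaCubedExponent (n : ℤ) : ℕ := (2 * n ^ 2 + n).toNat

lemma thetaCubedExponent_cast (n : ℤ) : (thetaCubedExponent n : ℤ) = 2 * n ^ 2 + n := by
  rw [thetaCubedExponent, Int.toNat_of_nonneg]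
  rcases le_or_gt 0 n with h | h <;> nlinarith

lemma exp_thetaCubed (n : ℤ) (τ : ℂ) : cexp (2 * Real.pi * I * ((4 * n + 1) ^ 2 / 8) * τ)
    = cexp (2 * Real.pi * I * τ / 8) * cexp (2 * Real.pi * I * τ) ^ thetaCubedExponent n := by
  rw [← Complex.exp_nat_mul, ← Complex.exp_add]
  congr 1
  have : (thetaCubedExponent n : ℂ) = 2 * (n : ℂ) ^ 2 + n := by
    exact_mod_cast congr_arg (Int.cast (R := ℂ)) (thetaCubedExponent_cast n)
  rw [this]
  ring

lemma hasSum_thetaCubed_q {τ : ℂ} (hτ : 0 < τ.im) :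
    HasSum (fun n ↦ fiberSum (fun n : ℤ ↦ (4 * n + 1 : ℂ)) thetaCubedExponent n
      * cexp (2 * Real.pi * I * τ) ^ n) (cexp (-(2 * Real.pi * I * τ / 8)) * thetaCubed τ) := by
  refine hasSum_fiberSum (φ := fun n ↦ cexp (2 * Real.pi * I * τ) ^ n) ?_
  refine ((hasSum_thetaCubed hτ).mul_left _).congr_fun fun n ↦ ?_
  rw [exp_thetaCubed, Complex.exp_neg]
  field_simp

/-- Jacobi's identity `η³ = ∑ (4 n + 1) q ^ ((4 n + 1)² / 8)`. The quotient of the two sides has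
`SL(2, ℤ)`-invariant absolute value and value `1` at the cusp. -/
theorem eta_pow_three (τ : ℍ) : ModularForm.eta τ ^ 3 = thetaCubed τ := by
  set c := fiberSum (fun n : ℤ ↦ (4 * n + 1 : ℂ)) thetaCubedExponent with hcdef
  have hc (q : ℂ) (hq : ‖q‖ < 1) : Summable fun n ↦ c n * q ^ n := by
    rcases eq_or_ne q 0 with rfl | hq0
    · exact summable_of_ne_finset_zero (s := {0}) fun n hn ↦ by simp_all
    · have h1 := Function.Periodic.im_invQParam_pos_of_norm_lt_one one_pos hq hq0
      have h2 := (hasSum_thetaCubed_q h1).summable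
      rwa [← qParam_one, Function.Periodic.qParam_right_inv one_ne_zero hq0] at h2
  have hc0 : c 0 = 1 := by
    have h0 : thetaCubedExponent 0 = 0 := rfl
    rw [hcdef, fiberSum, tsum_eq_single ⟨0, h0⟩]
    · simp
    · rintro ⟨n, hn⟩ hne
      refine absurd (Subtype.ext ?_) hne
      have := thetaCubedExponent_cast n
      rw [show thetaCubedExponent n = 0 from hn] at this
      have h1 : n * (2 * n + 1) = 0 := by push_cast at this; linarith
      rcases mul_eq_zero.1 h1 with h | h
      · exact h
      · omega
  set ρ : ℂ → ℂ := fun q ↦ (∑' n, c n * q ^ n) / eulerProduct q ^ 3 with hρ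
  have hval (τ : ℂ) (hτ : 0 < τ.im) :
      ρ (cexp (2 * Real.pi * I * τ)) = thetaCubed τ / ModularForm.eta τ ^ 3 := by
    have he : eulerProduct (cexp (2 * Real.pi * I * τ)) ≠ 0 :=
      eulerProduct_ne_zero (norm_exp_two_pi_I_lt_one ⟨τ, hτ⟩)
    simp only [hρ]
    rw [(hasSum_thetaCubed_q hτ).tsum_eq, eta_eq, mul_pow, ← Complex.exp_nat_mul, Complex.exp_neg,
      show ((3 : ℕ) : ℂ) * (2 * Real.pi * I * τ / 24) = 2 * Real.pi * I * τ / 8 by push_cast; ring]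
    field_simp
  have key := eq_one_of_maximum_principle (ι := Unit) (κ := Unit) (N := 1)
    (h := fun _ τ ↦ ‖thetaCubed τ / ModularForm.eta τ ^ 3‖) (ρ := fun _ ↦ ρ)
    ⟨1, fun _ τ ↦ ?_⟩ ⟨1, fun _ τ ↦ ?_⟩ (fun _ ↦ ?_) (fun _ ↦ ?_)
    (fun _ ↦ ⟨(), 1, 0, one_pos, le_rfl, fun τ ↦ ?_⟩)
    (fun _ ↦ ⟨(), 1, one_pos, fun τ τ' h ↦ ?_⟩) ()
    (norm_exp_two_pi_I_lt_one τ)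
  · rw [hval τ τ.im_pos, div_eq_one_iff_eq (pow_ne_zero _ (ModularForm.eta_ne_zero τ.im_pos))] at key
    exact key.symm
  · have h1 := norm_eta_smul ModularGroup.S τ
    rw [ModularGroup.denom_S] at h1
    have hS : ((ModularGroup.S • τ : ℍ) : ℂ) = -1 / τ := by
      rw [modular_S_smul, coe_mk, inv_neg, neg_div, one_div]
    have h0 : 0 < √‖(τ : ℂ)‖ := Real.sqrt_pos.2 (norm_pos_iff.2 (ne_zero τ))
    simp only [norm_div, norm_pow]
    rw [h1, hS, norm_thetaCubed_neg_inv τ.im_pos, mul_pow, mul_div_mul_left _ _ (by positivity)]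
  · have hT : ((ModularGroup.T • τ : ℍ) : ℂ) = τ + 1 := by
      rw [modular_T_smul, coe_vadd, add_comm]; simp
    have him : 0 < ((τ : ℂ) + 1).im := by simpa using τ.im_pos
    simp only [hT]
    rw [← hval _ him, ← hval _ τ.im_pos, mul_add, mul_one, Complex.exp_periodic]
  · exact (differentiableOn_tsum_pow hc).div (differentiableOn_eulerProduct.pow 3)
      fun q hq ↦ pow_ne_zero _ (eulerProduct_ne_zero (by simpa using hq))
  · simp only [hρ]
    rw [tsum_eq_single 0 (fun n hn ↦ by simp [hn]), eulerProduct_zero, hc0]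
    simp
  · simp only [Int.cast_zero, add_zero, Nat.cast_one, div_one]
    rw [hval τ τ.im_pos]
  · have : (τ' : ℂ) = τ := by simpa using h
    simp only [this]
    rw [hval τ τ.im_pos]

/-! ### Theta series of one variable with periodic weights -/

/-- The theta series `∑ c(n) q ^ (n² / (2 N))` of one variable with a periodic weight `c`. -/
noncomputable def periodicTheta (N : ℕ) (c : ℤ → ℂ) (τ : ℂ) : ℂ :=
  ∑' n : ℤ, c n * cexp (Real.pi * I * n ^ 2 * (τ / N))

lemma norm_le_of_periodic {N : ℕ} (hN : 0 < N) {c : ℤ → ℂ} (hc : Function.Periodic c N) (n : ℤ) :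
    ‖c n‖ ≤ ∑ r ∈ Finset.range N, ‖c r‖ := by
  have hN' : (0 : ℤ) < N := by exact_mod_cast hN
  have h1 : c n = c ((n % N).toNat : ℤ) := by
    rw [Int.toNat_of_nonneg (Int.emod_nonneg _ hN'.ne')]
    conv_lhs => rw [← Int.emod_add_mul_ediv n N, mul_comm]
    exact hc.int_mul _ _
  rw [h1]
  refine Finset.single_le_sum (f := fun r : ℕ ↦ ‖c r‖) (fun _ _ ↦ norm_nonneg _) ?_
  rw [Finset.mem_range, Int.toNat_lt (Int.emod_nonneg _ hN'.ne')]
  exact Int.emod_lt_of_pos _ hN'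

lemma summable_periodicTheta {N : ℕ} (hN : 0 < N) {c : ℤ → ℂ} (hc : Function.Periodic c N) {τ : ℂ}
    (hτ : 0 < τ.im) : Summable fun n : ℤ ↦ c n * cexp (Real.pi * I * n ^ 2 * (τ / N)) := by
  have hτN : 0 < (τ / N).im := by
    rw [div_natCast_im]
    positivity
  refine .of_norm_bounded (((summable_jacobiTheta₂_term_iff 0 (τ / N)).2 hτN).norm.mul_left
    (∑ r ∈ Finset.range N, ‖c r‖)) fun n ↦ ?_
  rw [norm_mul, jacobiTheta₂_term, mul_zero, zero_add]
  gcongr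
  exact norm_le_of_periodic hN hc n

/-- Poisson summation over a shifted lattice. -/
lemma tsum_exp_shift (z : ℝ) {τ : ℂ} (hτ : 0 < τ.im) :
    ∑' n : ℤ, cexp (Real.pi * I * (n + z) ^ 2 * (-1 / τ))
      = (-I * τ) ^ (1 / 2 : ℂ) * jacobiTheta₂ z τ := by
  have hτ0 : τ ≠ 0 := fun h ↦ by simp [h] at hτ
  have h0 : (-I * τ) ^ (1 / 2 : ℂ) ≠ 0 := by simp [cpow_eq_zero_iff, hτ0]
  rw [jacobiTheta₂_functional_equation, ← mul_assoc, ← mul_assoc, mul_one_div_cancel h0, one_mul,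
    jacobiTheta₂, ← tsum_mul_left, ← (Equiv.neg ℤ).tsum_eq]
  refine tsum_congr fun n ↦ ?_
  rw [jacobiTheta₂_term, ← Complex.exp_add, Equiv.neg_apply]
  congr 1
  push_cast
  field_simp
  ring

/-- The discrete Fourier transform of a function on `ℤ` of period `N`. -/
noncomputable def periodicDFT (N : ℕ) (c : ℤ → ℂ) (n : ℤ) : ℂ :=
  ∑ r ∈ Finset.range N, c r * cexp (2 * Real.pi * I * (r * n / N))

lemma periodic_exp {N : ℕ} (hN : 0 < N) (r : ℕ) :
    Function.Periodic (fun n : ℤ ↦ cexp (2 * Real.pi * I * (r * n / N))) N := fun n ↦ by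
  have hNC : (N : ℂ) ≠ 0 := by exact_mod_cast hN.ne'
  simp only
  push_cast
  rw [show 2 * Real.pi * I * (r * (n + N) / N) = 2 * Real.pi * I * (r * n / N)
    + (r : ℤ) * (2 * Real.pi * I) by push_cast; field_simp, Complex.exp_add,
    exp_int_mul_two_pi_mul_I, mul_one]

/-- The action of `S` on theta series of one variable. -/
theorem periodicTheta_neg_inv {N : ℕ} (hN : 0 < N) {c : ℤ → ℂ} (hc : Function.Periodic c N) {τ : ℂ}
    (hτ : 0 < τ.im) : periodicTheta N c (-1 / τ)
      = (-I * (τ / N)) ^ (1 / 2 : ℂ) * periodicTheta N (periodicDFT N c) τ := by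
  have : NeZero N := ⟨hN.ne'⟩
  have hNC : (N : ℂ) ≠ 0 := by exact_mod_cast hN.ne'
  have hτ0 : τ ≠ 0 := fun h ↦ by simp [h] at hτ
  have hτN : 0 < (τ / N).im := by
    rw [div_natCast_im]
    positivity
  have him : 0 < (-1 / τ).im := by
    have := UpperHalfPlane.im_inv_neg_coe_pos ⟨τ, hτ⟩
    rwa [neg_div, one_div, ← inv_neg]
  have hs := summable_periodicTheta hN hc him
  rw [periodicTheta, ← (Int.divModEquiv N).symm.tsum_eq,
    ← (Equiv.prodComm _ _).tsum_eq]
  rw [← (Int.divModEquiv N).symm.summable_iff,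
    ← (Equiv.prodComm _ _).summable_iff] at hs
  refine (Summable.tsum_prod hs).trans ?_
  rw [tsum_fintype]
  have key (r : Fin N) : ∑' k : ℤ, c (k * N + r)
        * cexp (Real.pi * I * ((k * N + r : ℤ) : ℂ) ^ 2 * (-1 / τ / N))
      = (-I * (τ / N)) ^ (1 / 2 : ℂ)
        * ∑' n : ℤ, c r * cexp (2 * Real.pi * I * (r * n / N))
          * cexp (Real.pi * I * n ^ 2 * (τ / N)) := by
    have h1 := tsum_exp_shift (r / N : ℝ) hτN
    simp_rw [mul_assoc (c r), tsum_mul_left]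
    rw [mul_left_comm]
    trans c r * ∑' n : ℤ, cexp (Real.pi * I * (n + (r / N : ℝ)) ^ 2 * (-1 / (τ / N)))
    · rw [← tsum_mul_left]
      refine tsum_congr fun k ↦ ?_
      congr 1
      · rw [add_comm]
        exact hc.int_mul k r
      · congr 1
        push_cast
        field_simp
    · rw [h1, jacobiTheta₂]
      congr 2
      refine tsum_congr fun n ↦ ?_
      rw [jacobiTheta₂_term, ← Complex.exp_add]
      congr 1
      push_cast
      ring
  have hsum (r : ℕ) : Summable fun n : ℤ ↦ c r * cexp (2 * Real.pi * I * (r * n / N))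
          * cexp (Real.pi * I * n ^ 2 * (τ / N)) := by
    exact summable_periodicTheta (c := fun n : ℤ ↦ c r * cexp (2 * Real.pi * I * (r * n / N)))
      hN (fun n ↦ congr_arg (c r * ·) (periodic_exp hN r n)) hτ
  trans ∑ r : Fin N, (-I * (τ / N)) ^ (1 / 2 : ℂ)
        * ∑' n : ℤ, c r * cexp (2 * Real.pi * I * (r * n / N))
          * cexp (Real.pi * I * n ^ 2 * (τ / N))
  · refine Finset.sum_congr rfl fun r _ ↦ ?_
    exact key r
  · rw [← Finset.mul_sum, periodicTheta,
      Fin.sum_univ_eq_sum_range (fun r : ℕ ↦ ∑' n : ℤ, c r * cexp (2 * Real.pi * I * (r * n / N))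
          * cexp (Real.pi * I * n ^ 2 * (τ / N))) N, ← Summable.tsum_finsetSum fun r _ ↦ hsum r]
    simp_rw [periodicDFT, Finset.sum_mul]

/-! ### Products of two theta series over a parity class -/

/-- The indicator function of a parity class. -/
noncomputable def parityIndicator (ε : ZMod 2) (n : ℤ) : ℂ := if (n : ZMod 2) = ε then 1 else 0

lemma periodic_mul_cast {p : ℕ} (α : ZMod p → ℂ) (ε : ZMod 2) :
    Function.Periodic (fun n : ℤ ↦ parityIndicator ε n * α n) ((2 * p : ℕ) : ℤ) := fun n ↦ by
  simp only [parityIndicator]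
  push_cast
  rw [show (2 : ZMod 2) = 0 from rfl]
  simp

lemma parityIndicator_add (n : ℤ) : parityIndicator 0 n + parityIndicator 1 n = 1 := by
  rcases Int.even_or_odd n with h | h
  · have : (n : ZMod 2) = 0 := (ZMod.intCast_zmod_eq_zero_iff_dvd n 2).2 h.two_dvd
    simp [parityIndicator, this]
  · obtain ⟨k, rfl⟩ := h
    have : ((2 * k + 1 : ℤ) : ZMod 2) = 1 := by
      push_cast
      rw [show (2 : ZMod 2) = 0 from rfl]
      simp
    simp [parityIndicator, this]

/-- The discrete Fourier transform of `α` on `ℤ / p`, with the additive character `x ↦ e(a x / p)`. -/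
noncomputable def zmodDFT {p : ℕ} [NeZero p] (a : ZMod p) (α : ZMod p → ℂ) (y : ZMod p) : ℂ :=
  ∑ r, α r * ZMod.stdAddChar (a * r * y)

/-- The theta series `∑ α(x) β(y) q ^ (x² / (4 p) + y² / (4 r))` over `x ≡ y` modulo `2`. -/
noncomputable def pairTheta (p r : ℕ) (α : ZMod p → ℂ) (β : ZMod r → ℂ) (τ : ℂ) : ℂ :=
  ∑ ε : ZMod 2, periodicTheta (2 * p) (fun n ↦ parityIndicator ε n * α n) τ
    * periodicTheta (2 * r) (fun n ↦ parityIndicator ε n * β n) τ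

lemma parityIndicator_natCast (ε r : ℕ) :
    parityIndicator (ε : ZMod 2) r = if r % 2 = ε % 2 then 1 else 0 := by
  rw [parityIndicator, Int.cast_natCast]
  simp only [ZMod.natCast_eq_natCast_iff', ]

/-- The Fourier transform modulo `2 p` of a function of period `p` restricted to a parity class. -/
lemma periodicDFT_parity {p : ℕ} [NeZero p] (hp : Odd p) (α : ZMod p → ℂ) (ε : ℕ)
    (n : ℤ) : periodicDFT (2 * p) (fun n ↦ parityIndicator (ε : ZMod 2) n * α n) n
      = cexp (Real.pi * I * ε * n) * zmodDFT (2 : ZMod p)⁻¹ α n := by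
  have hp0 : (p : ℂ) ≠ 0 := by exact_mod_cast NeZero.ne p
  have h2 : IsUnit (2 : ZMod p) := by
    exact_mod_cast (ZMod.isUnit_iff_coprime 2 p).2 (Nat.coprime_two_left.2 hp)
  rw [periodicDFT, zmodDFT, Finset.mul_sum]
  simp_rw [parityIndicator_natCast, ite_mul, one_mul, zero_mul]
  rw [← Finset.sum_filter]
  refine Finset.sum_bij (fun r _ ↦ (r : ZMod p)) (fun _ _ ↦ Finset.mem_univ _) ?_ ?_ ?_
  · intro r hr r' hr' h
    rw [ZMod.natCast_eq_natCast_iff] at h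
    simp only [Finset.mem_filter, Finset.mem_range] at hr hr'
    have h1 : r ≡ r' [MOD 2 * p] := by
      refine (Nat.modEq_and_modEq_iff_modEq_mul (Nat.coprime_two_left.2 hp)).1 ⟨?_, h⟩
      exact hr.2.trans hr'.2.symm
    rwa [Nat.ModEq, Nat.mod_eq_of_lt hr.1, Nat.mod_eq_of_lt hr'.1] at h1
  · intro a _
    have ha := ZMod.val_lt a
    obtain ⟨k, hk⟩ := hp
    by_cases h : a.val % 2 = ε % 2
    · exact ⟨a.val, by simp only [Finset.mem_filter, Finset.mem_range]; omega, by simp⟩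
    · exact ⟨a.val + p, by simp only [Finset.mem_filter, Finset.mem_range]; omega, by simp⟩
  · intro r hr
    simp only [Finset.mem_filter, Finset.mem_range] at hr
    obtain ⟨j, hj⟩ := hp
    obtain ⟨k, hk⟩ : ∃ k : ℤ, (r : ℤ) = 2 * k + p * ε := by
      have h1 : (p * ε) % 2 = ε % 2 := by rw [hj, Nat.mul_mod]; simp
      refine ⟨((r : ℤ) - p * ε) / 2, ?_⟩
      have : ((r : ℤ) - (p * ε : ℕ)) % 2 = 0 := by omega
      push_cast at this
      omega
    have hψ : (2 : ZMod p)⁻¹ * (r : ZMod p) * (n : ZMod p) = ((k * n : ℤ) : ZMod p) := by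
      have h1 : (r : ZMod p) = 2 * (k : ZMod p) := by
        have := congr_arg (Int.cast (R := ZMod p)) hk
        push_cast at this
        simpa using this
      rw [h1, ← mul_assoc, ZMod.inv_mul_of_unit _ h2]
      push_cast
      ring
    rw [hψ, ZMod.stdAddChar_coe, Int.cast_natCast, mul_left_comm, ← Complex.exp_add]
    congr 2
    have hkC : (r : ℂ) = 2 * k + p * ε := by exact_mod_cast congr_arg (Int.cast (R := ℂ)) hk
    push_cast
    rw [hkC]
    field_simp
    ring

lemma exp_pi_mul_int (n : ℤ) :
    cexp (Real.pi * I * n) = parityIndicator 0 n - parityIndicator 1 n := by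
  rcases Int.even_or_odd' n with ⟨k, rfl | rfl⟩
  · rw [show Real.pi * I * ((2 * k : ℤ) : ℂ) = k * (2 * Real.pi * I) by push_cast; ring,
      exp_int_mul_two_pi_mul_I]
    have : ((2 * k : ℤ) : ZMod 2) = 0 := by
      push_cast
      rw [show (2 : ZMod 2) = 0 from rfl, zero_mul]
    simp [parityIndicator, this]
  · rw [show Real.pi * I * ((2 * k + 1 : ℤ) : ℂ) = k * (2 * Real.pi * I) + Real.pi * I by
      push_cast; ring, Complex.exp_add, exp_int_mul_two_pi_mul_I, exp_pi_mul_I]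
    have : ((2 * k + 1 : ℤ) : ZMod 2) = 1 := by
      push_cast
      rw [show (2 : ZMod 2) = 0 from rfl]
      simp
    simp [parityIndicator, this]

lemma periodicTheta_add {N : ℕ} (hN : 0 < N) {c c' : ℤ → ℂ} (hc : Function.Periodic c N)
    (hc' : Function.Periodic c' N) {τ : ℂ} (hτ : 0 < τ.im) :
    periodicTheta N (fun n ↦ c n + c' n) τ = periodicTheta N c τ + periodicTheta N c' τ := by
  rw [periodicTheta, periodicTheta, periodicTheta,
    ← (summable_periodicTheta hN hc hτ).tsum_add (summable_periodicTheta hN hc' hτ)]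
  exact tsum_congr fun n ↦ add_mul _ _ _

lemma periodicTheta_mul_left (N : ℕ) (a : ℂ) (c : ℤ → ℂ) (τ : ℂ) :
    periodicTheta N (fun n ↦ a * c n) τ = a * periodicTheta N c τ := by
  rw [periodicTheta, periodicTheta, ← tsum_mul_left]
  exact tsum_congr fun n ↦ mul_assoc _ _ _

/-- The action of `S` on a theta series restricted to the parity class `ε`. -/
lemma periodicTheta_parity_neg_inv {p : ℕ} [NeZero p] (hp : Odd p) (α : ZMod p → ℂ) {ε : ℕ}
    (hε : ε < 2) {τ : ℂ} (hτ : 0 < τ.im) :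
    periodicTheta (2 * p) (fun n ↦ parityIndicator (ε : ZMod 2) n * α n) (-1 / τ)
      = (-I * (τ / (2 * p : ℕ))) ^ (1 / 2 : ℂ) *
        (periodicTheta (2 * p) (fun n ↦ parityIndicator 0 n * zmodDFT (2 : ZMod p)⁻¹ α n) τ +
          (-1) ^ ε *
            periodicTheta (2 * p) (fun n ↦ parityIndicator 1 n * zmodDFT (2 : ZMod p)⁻¹ α n) τ) := by
  have hN : 0 < 2 * p := Nat.mul_pos two_pos (NeZero.pos p)
  rw [periodicTheta_neg_inv hN (periodic_mul_cast α _) hτ]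
  congr 1
  rw [← periodicTheta_mul_left (2 * p) ((-1) ^ ε), ← periodicTheta_add hN (periodic_mul_cast _ _)
    (fun n ↦ congr_arg ((-1) ^ ε * ·) (periodic_mul_cast _ 1 n)) hτ]
  congr 1
  funext n
  rw [periodicDFT_parity hp α]
  interval_cases ε
  · simp [← add_mul, parityIndicator_add]
  · rw [Nat.cast_one, mul_one, exp_pi_mul_int]
    ring

/-- The action of `S` on the theta series `pairTheta`. -/
theorem pairTheta_neg_inv {p r : ℕ} [NeZero p] [NeZero r] (hp : Odd p) (hr : Odd r)
    (α : ZMod p → ℂ) (β : ZMod r → ℂ) {τ : ℂ} (hτ : 0 < τ.im) :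
    pairTheta p r α β (-1 / τ) = -I * τ / √(p * r : ℝ) *
      pairTheta p r (zmodDFT (2 : ZMod p)⁻¹ α) (zmodDFT (2 : ZMod r)⁻¹ β) τ := by
  have hτ0 : τ ≠ 0 := fun h ↦ by simp [h] at hτ
  have hc (p : ℕ) [NeZero p] : (-I * (τ / (2 * p : ℕ))) ^ (1 / 2 : ℂ)
      = (-I * τ) ^ (1 / 2 : ℂ) / √(2 * p : ℝ) := by
    have hp0 : (0 : ℝ) < p := by exact_mod_cast NeZero.pos p
    have h1 : -I * (τ / (2 * p : ℕ)) = (((2 * p : ℝ)⁻¹ : ℝ) : ℂ) * (-I * τ) := by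
      push_cast
      field_simp
    have h2 : -I * τ ≠ 0 := by simp [hτ0]
    rw [h1, cpow_def_of_ne_zero (mul_ne_zero (by simpa using hp0.ne') h2),
      log_ofReal_mul (by positivity) h2, add_mul, Complex.exp_add, ← cpow_def_of_ne_zero h2]
    rw [mul_comm, div_eq_mul_inv]
    congr 1
    rw [Real.sqrt_eq_rpow, ← ofReal_inv, ← Real.rpow_neg (by positivity),
      Real.rpow_def_of_pos (by positivity), Real.log_inv, ofReal_exp]
    congr 1
    push_cast
    ring
  have h0 := periodicTheta_parity_neg_inv hp α (ε := 0) (by norm_num) hτ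
  have h1 := periodicTheta_parity_neg_inv hp α (ε := 1) (by norm_num) hτ
  have h0' := periodicTheta_parity_neg_inv hr β (ε := 0) (by norm_num) hτ
  have h1' := periodicTheta_parity_neg_inv hr β (ε := 1) (by norm_num) hτ
  rw [Nat.cast_zero] at h0 h0'
  rw [Nat.cast_one] at h1 h1'
  have hsq : ((-I * τ) ^ (1 / 2 : ℂ)) ^ 2 = -I * τ := by
    rw [← cpow_nat_mul]
    simp
  have hsqrt : (√(2 * p : ℝ) : ℂ) * √(2 * r : ℝ) = 2 * √(p * r : ℝ) := by
    rw [← ofReal_mul, ← Real.sqrt_mul (by positivity),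
      show (2 * p * (2 * r) : ℝ) = 2 ^ 2 * (p * r) by ring, Real.sqrt_mul (by positivity),
      Real.sqrt_sq (by norm_num)]
    push_cast
    rfl
  simp only [pairTheta]
  rw [show (Finset.univ : Finset (ZMod 2)) = {0, 1} from rfl, Finset.sum_pair (by decide),
    Finset.sum_pair (by decide), h0, h1, h0', h1', hc p, hc r]
  trans ((-I * τ) ^ (1 / 2 : ℂ)) ^ 2 / (√(2 * p : ℝ) * √(2 * r : ℝ)) * 2 *
    (periodicTheta (2 * p) (fun n ↦ parityIndicator 0 n * zmodDFT (2 : ZMod p)⁻¹ α n) τ *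
        periodicTheta (2 * r) (fun n ↦ parityIndicator 0 n * zmodDFT (2 : ZMod r)⁻¹ β n) τ +
      periodicTheta (2 * p) (fun n ↦ parityIndicator 1 n * zmodDFT (2 : ZMod p)⁻¹ α n) τ *
        periodicTheta (2 * r) (fun n ↦ parityIndicator 1 n * zmodDFT (2 : ZMod r)⁻¹ β n) τ)
  · ring
  · rw [hsq, hsqrt]
    ring

/-! ### Fourier transforms of quadratic phases -/

/-- For `b ∈ P¹(𝔽_p)`: the delta function at `0` if `b = ∞`, and the quadratic phase
`r ↦ e(c b r² / p)` if `b` is finite. The point `∞` is encoded as `none`. -/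
noncomputable def weilVector {p : ℕ} [NeZero p] (c : ZMod p) : Option (ZMod p) → ZMod p → ℂ
  | none => Pi.single 0 1
  | some b => fun r ↦ ZMod.stdAddChar (c * b * r ^ 2)

/-- The action of `S` on `P¹(𝔽_p)`, `b ↦ -1 / b`. -/
def projS {p : ℕ} : Option (ZMod p) → Option (ZMod p)
  | none => some 0
  | some b => if b = 0 then none else some (-b⁻¹)

/-- The action of `T` on `P¹(𝔽_p)`, `b ↦ b + 1`. -/
def projT {p : ℕ} : Option (ZMod p) → Option (ZMod p) := Option.map (· + 1)

/-- The quadratic Gauss sum `∑ e(a r² / p)`. -/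
noncomputable def quadGauss {p : ℕ} [NeZero p] (a : ZMod p) : ℂ := ∑ r, ZMod.stdAddChar (a * r ^ 2)

/-- The scalar by which the Fourier transform of a `weilVector` differs from a `weilVector`. -/
noncomputable def weilFactor {p : ℕ} [NeZero p] (c : ZMod p) : Option (ZMod p) → ℂ
  | none => 1
  | some b => quadGauss (c * b)

/-- The denominator attached to a point of `P¹(𝔽_p)`: the width of the cusp that it represents. -/
def cuspWidth {p : ℕ} : Option (ZMod p) → ℕ
  | none => 1
  | some _ => p

lemma cuspWidth_pos {p : ℕ} [NeZero p] (b : Option (ZMod p)) : 0 < cuspWidth b := by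
  cases b
  · exact one_pos
  · exact NeZero.pos p

lemma quadGauss_zero {p : ℕ} [NeZero p] : quadGauss (0 : ZMod p) = p := by
  simp [quadGauss]

lemma sum_stdAddChar_mul {p : ℕ} [NeZero p] (a : ZMod p) :
    ∑ r, ZMod.stdAddChar (a * r) = if a = 0 then (p : ℂ) else 0 := by
  have := AddChar.sum_mulShift a (ZMod.isPrimitive_stdAddChar p)
  simp_rw [mul_comm a, this, ZMod.card]
  split_ifs <;> simp

lemma weilVector_projT {p : ℕ} [NeZero p] (c : ZMod p) (b : Option (ZMod p)) (r : ZMod p) :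
    weilVector c b r * ZMod.stdAddChar (c * r ^ 2) = weilVector c (projT b) r := by
  match b with
  | none =>
    by_cases hr : r = 0
    · simp [weilVector, projT, hr]
    · simp [weilVector, projT, hr]
  | some b =>
    simp only [weilVector, projT, Option.map_some]
    rw [← AddChar.map_add_eq_mul]
    congr 1
    ring

section

variable {p : ℕ} [Fact p.Prime]

/-- The Fourier transform of a quadratic phase is a multiple of a quadratic phase, by completing
the square. -/
theorem zmodDFT_weilVector (hp : p ≠ 2) {c : ZMod p} (hc : c ≠ 0) (b : Option (ZMod p)) :
    zmodDFT (2 * c) (weilVector c b) = weilFactor c b • weilVector c (projS b) := by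
  have h2 : (2 : ZMod p) ≠ 0 := Ring.two_ne_zero (by rwa [ZMod.ringChar_zmod_n])
  funext y
  rw [Pi.smul_apply, smul_eq_mul, zmodDFT]
  match b with
  | none => simp [weilVector, weilFactor, projS, Pi.single_apply]
  | some b =>
    by_cases hb : b = 0
    · subst hb
      simp only [weilVector, weilFactor, projS, mul_zero, zero_mul, AddChar.map_zero_eq_one,
        one_mul, quadGauss_zero, if_true, Pi.single_apply, mul_ite, mul_one]
      simp_rw [mul_right_comm (2 * c) _ y, sum_stdAddChar_mul]
      simp [h2, hc]
    · simp only [weilVector, weilFactor, projS, hb, if_false]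
      rw [quadGauss, Finset.sum_mul]
      refine Fintype.sum_equiv (Equiv.addRight (b⁻¹ * y)) _ _ fun r ↦ ?_
      rw [Equiv.coe_addRight, ← AddChar.map_add_eq_mul, ← AddChar.map_add_eq_mul]
      congr 1
      field_simp
      ring

lemma norm_quadGauss_sq (hp : p ≠ 2) {a : ZMod p} (ha : a ≠ 0) : ‖quadGauss a‖ ^ 2 = p := by
  have h2 : (2 : ZMod p) ≠ 0 := Ring.two_ne_zero (by rwa [ZMod.ringChar_zmod_n])
  have h : quadGauss a * (starRingEnd ℂ) (quadGauss a) = p := by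
    rw [quadGauss, map_sum]
    simp_rw [← AddChar.map_neg_eq_conj]
    rw [Finset.sum_mul_sum, Finset.sum_comm]
    trans ∑ s : ZMod p, ∑ t : ZMod p, ZMod.stdAddChar (a * t ^ 2)
      * ZMod.stdAddChar (2 * a * t * s)
    · refine Finset.sum_congr rfl fun s _ ↦ ?_
      refine (Fintype.sum_equiv (Equiv.addRight s) _ _ fun t ↦ ?_).symm
      rw [Equiv.coe_addRight, ← AddChar.map_add_eq_mul, ← AddChar.map_add_eq_mul]
      congr 1
      ring
    · rw [Finset.sum_comm]
      simp_rw [← Finset.mul_sum, sum_stdAddChar_mul]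
      simp [h2, ha]
  rw [mul_conj, normSq_eq_norm_sq] at h
  exact_mod_cast h

lemma norm_weilFactor (hp : p ≠ 2) {c : ZMod p} (hc : c ≠ 0) (b : Option (ZMod p)) :
    ‖weilFactor c b‖ = √(p * (cuspWidth b / cuspWidth (projS b))) := by
  have hp0 : (p : ℝ) ≠ 0 := by exact_mod_cast (Fact.out : p.Prime).ne_zero
  match b with
  | none => simp [weilFactor, cuspWidth, projS, hp0]
  | some b =>
    by_cases hb : b = 0
    · subst hb
      simp [weilFactor, cuspWidth, projS, quadGauss_zero]
    · simp only [weilFactor, projS, cuspWidth, hb, if_false]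
      rw [div_self hp0, mul_one, ← norm_quadGauss_sq hp (mul_ne_zero hc hb),
        Real.sqrt_sq (norm_nonneg _)]

end

/-- The sign `1` at `∞` and `-1` at the finite points. It accounts for the fact that the quadratic
phases belonging to the two classes of forms differ by a nonresidue, so that their Gauss sums have
opposite signs. -/
def projSign {p : ℕ} : Option (ZMod p) → ℝ
  | none => 1
  | some _ => -1

/-- If `2` is not a square modulo `p`, then the values `r²` and `2 r²` cover `ℤ / p` twice, so the
quadratic Gauss sums of `a` and `2 a` cancel. -/
lemma quadGauss_two_mul {p : ℕ} [NeZero p]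
    (hp : (Finset.univ : Finset (ZMod p)).val.map (fun r ↦ r ^ 2)
      + (Finset.univ : Finset (ZMod p)).val.map (fun r ↦ 2 * r ^ 2) = 2 • Finset.univ.val)
    {a : ZMod p} (ha : a ≠ 0) : quadGauss (2 * a) = -quadGauss a := by
  have h := congr_arg (fun s ↦ (s.map fun r ↦ ZMod.stdAddChar (N := p) (a * r)).sum) hp
  simp only [Multiset.map_add, Multiset.map_map, Multiset.sum_add, Multiset.map_nsmul,
    Multiset.sum_nsmul] at h
  have h0 : ((Finset.univ : Finset (ZMod p)).val.map fun r ↦ ZMod.stdAddChar (N := p) (a * r)).sum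
      = 0 := (sum_stdAddChar_mul a).trans (if_neg ha)
  rw [h0, smul_zero] at h
  rw [eq_neg_iff_add_eq_zero, add_comm, ← h]
  simp only [quadGauss, Finset.sum, Function.comp_def]
  congr 4
  funext r
  congr 1
  ring

lemma projSign_mul_weilFactor {p : ℕ} [Fact p.Prime]
    (hp : (Finset.univ : Finset (ZMod p)).val.map (fun r ↦ r ^ 2)
      + (Finset.univ : Finset (ZMod p)).val.map (fun r ↦ 2 * r ^ 2) = 2 • Finset.univ.val)
    {c : ZMod p} (hc : c ≠ 0) (b : Option (ZMod p)) :
    projSign b * weilFactor c b = -projSign (projS b) * weilFactor (2 * c) b := by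
  match b with
  | none => simp [projSign, weilFactor, projS]
  | some b =>
    by_cases hb : b = 0
    · subst hb
      simp [projSign, weilFactor, projS]
    · simp only [projSign, weilFactor, projS, hb, if_false]
      rw [mul_assoc 2, quadGauss_two_mul hp (mul_ne_zero hc hb)]
      simp

/-- The action of `T` on a theta series restricted to the parity class `ε`. By the Chinese remainder
theorem the factor `e(n² / (4 p))` is the product of a phase modulo `p` and a phase that only
depends on the parity of `n`. -/
lemma periodicTheta_parity_add_one {p : ℕ} [NeZero p] (α : ZMod p → ℂ) {u v : ℤ}
    (huv : 4 * u + p * v = 1) {ε : ℕ} (hε : ε < 2) (τ : ℂ) :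
    periodicTheta (2 * p) (fun n ↦ parityIndicator (ε : ZMod 2) n * α n) (τ + 1)
      = cexp (2 * Real.pi * I * (ε * v / 4)) * periodicTheta (2 * p) (fun n ↦
        parityIndicator (ε : ZMod 2) n * (α n * ZMod.stdAddChar ((u : ZMod p) * (n : ZMod p) ^ 2)))
          τ := by
  rw [← periodicTheta_mul_left, periodicTheta, periodicTheta]
  refine tsum_congr fun n ↦ ?_
  by_cases hn : (n : ZMod 2) = (ε : ZMod 2)
  swap
  · simp [parityIndicator, hn]
  have hp0 : (p : ℂ) ≠ 0 := by exact_mod_cast NeZero.ne p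
  obtain ⟨k, hk⟩ : ∃ k : ℤ, n ^ 2 = 4 * k + ε := by
    rw [← Int.cast_natCast, ZMod.intCast_eq_intCast_iff] at hn
    obtain ⟨j, hj⟩ := hn.symm.dvd
    obtain rfl : n = ε + 2 * j := by push_cast at hj; linarith
    interval_cases ε
    · exact ⟨j ^ 2, by push_cast; ring⟩
    · exact ⟨j ^ 2 + j, by push_cast; ring⟩
  simp only [parityIndicator, if_pos hn, one_mul]
  rw [show (u : ZMod p) * (n : ZMod p) ^ 2 = ((u * n ^ 2 : ℤ) : ZMod p) by push_cast; rfl,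
    ZMod.stdAddChar_coe, mul_assoc (cexp _), mul_assoc (α n), mul_left_comm (cexp _), ← Complex.exp_add,
    ← Complex.exp_add]
  congr 1
  rw [Complex.exp_eq_exp_iff_exists_int]
  refine ⟨k * v, ?_⟩
  have hkC : (n : ℂ) ^ 2 = 4 * k + ε := by exact_mod_cast congr_arg (Int.cast (R := ℂ)) hk
  have huC : 4 * (u : ℂ) + p * v = 1 := by exact_mod_cast congr_arg (Int.cast (R := ℂ)) huv
  push_cast
  rw [hkC]
  field_simp
  linear_combination -4 * (4 * (k : ℂ) + ε) * huC

/-- The action of `T` on the theta series `pairTheta`: if `p + r` is divisible by `4`, then the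
phases that depend on the parity class cancel. -/
theorem pairTheta_add_one {p r : ℕ} [NeZero p] [NeZero r] (α : ZMod p → ℂ) (β : ZMod r → ℂ)
    {u v u' : ℤ} (h : 4 * u + p * v = 1) (h' : 4 * u' + r * -v = 1) (τ : ℂ) :
    pairTheta p r α β (τ + 1)
      = pairTheta p r (fun x ↦ α x * ZMod.stdAddChar ((u : ZMod p) * x ^ 2))
        (fun y ↦ β y * ZMod.stdAddChar ((u' : ZMod r) * y ^ 2)) τ := by
  have key {ε : ℕ} (hε : ε < 2) : periodicTheta (2 * p)
      (fun n ↦ parityIndicator (ε : ZMod 2) n * α n) (τ + 1)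
    * periodicTheta (2 * r) (fun n ↦ parityIndicator (ε : ZMod 2) n * β n) (τ + 1)
    = periodicTheta (2 * p) (fun n ↦ parityIndicator (ε : ZMod 2) n *
        (α n * ZMod.stdAddChar ((u : ZMod p) * (n : ZMod p) ^ 2))) τ
      * periodicTheta (2 * r) (fun n ↦ parityIndicator (ε : ZMod 2) n *
        (β n * ZMod.stdAddChar ((u' : ZMod r) * (n : ZMod r) ^ 2))) τ := by
    rw [periodicTheta_parity_add_one α h hε, periodicTheta_parity_add_one β h' hε,
      mul_mul_mul_comm, ← Complex.exp_add]
    rw [show (2 * Real.pi * I * (ε * v / 4) + 2 * Real.pi * I * (ε * (-v : ℤ) / 4) : ℂ) = 0 by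
      push_cast; ring, Complex.exp_zero, one_mul]
  have h0 := key (ε := 0) (by norm_num)
  have h1 := key (ε := 1) (by norm_num)
  rw [Nat.cast_zero] at h0
  rw [Nat.cast_one] at h1
  simp only [pairTheta]
  rw [show (Finset.univ : Finset (ZMod 2)) = {0, 1} from rfl, Finset.sum_pair (by decide),
    Finset.sum_pair (by decide), h0, h1]

/-! ### The theta series of discriminant -15 at the cusps of level 15 -/

lemma pairTheta_smul {p r : ℕ} (a b : ℂ) (α : ZMod p → ℂ) (β : ZMod r → ℂ) (τ : ℂ) :
    pairTheta p r (a • α) (b • β) τ = a * b * pairTheta p r α β τ := by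
  simp only [pairTheta, Pi.smul_apply, smul_eq_mul, mul_left_comm _ a, mul_left_comm _ b,
    periodicTheta_mul_left, Finset.mul_sum]
  exact Finset.sum_congr rfl fun ε _ ↦ by ring

/-- The reduction modulo `3` of an element of `ℤ / 15`. -/
abbrev mod3 : ZMod 15 →+* ZMod 3 := ZMod.castHom (by decide) (ZMod 3)

/-- The reduction modulo `5` of an element of `ℤ / 15`. -/
abbrev mod5 : ZMod 15 →+* ZMod 5 := ZMod.castHom (by decide) (ZMod 5)

/-- The transform of the theta series of `m² + m k + 4 k²` at the cusp attached to `b`, up to a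
constant. That form is equivalent to `(15 x² + y²) / 4` on the pairs with `x ≡ y` modulo `2`, and the
phases modulo `3` and `5` are those for which `T` acts by `b ↦ b + 1`: the exponent `4 y² / 15` is
congruent to `2 y² / 3 + 3 y² / 5` modulo `1`. -/
noncomputable def cuspThetaA (b : Option (ZMod 3) × Option (ZMod 5)) (τ : ℂ) : ℂ :=
  pairTheta 1 15 1 (fun y ↦ weilVector 2 b.1 (mod3 y) * weilVector 3 b.2 (mod5 y)) τ

/-- The transform of the theta series of `2 m² + m k + 2 k²` at the cusp attached to `b`, up to a
constant. That form is equivalent to `(5 x² + 3 y²) / 4` on the pairs with `x ≡ y` modulo `2`. -/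
noncomputable def cuspThetaB (b : Option (ZMod 3) × Option (ZMod 5)) (τ : ℂ) : ℂ :=
  pairTheta 3 5 (weilVector 1 b.1) (weilVector 4 b.2) τ

lemma stdAddChar_fifteen (y : ZMod 15) :
    ZMod.stdAddChar y = ZMod.stdAddChar (2 * mod3 y) * ZMod.stdAddChar (2 * mod5 y) := by
  obtain ⟨n, rfl⟩ := ZMod.intCast_surjective y
  rw [map_intCast mod3, map_intCast mod5, show (2 * n : ZMod 3) = ((2 * n : ℤ) : ZMod 3) by push_cast; rfl,
    show (2 * n : ZMod 5) = ((2 * n : ℤ) : ZMod 5) by push_cast; rfl, ZMod.stdAddChar_coe,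
    ZMod.stdAddChar_coe, ZMod.stdAddChar_coe, ← Complex.exp_add, Complex.exp_eq_exp_iff_exists_int]
  refine ⟨-n, ?_⟩
  push_cast
  ring

lemma sum_zmod_fifteen (f : ZMod 3 → ℂ) (g : ZMod 5 → ℂ) :
    ∑ y : ZMod 15, f (mod3 y) * g (mod5 y) = (∑ x, f x) * ∑ x, g x := by
  rw [Finset.sum_mul_sum, ← Finset.sum_product', Finset.univ_product_univ]
  exact Fintype.sum_bijective (fun y : ZMod 15 ↦ (mod3 y, mod5 y)) (by decide) _ _ fun _ ↦ rfl

lemma zmodDFT_fifteen (α : ZMod 3 → ℂ) (β : ZMod 5 → ℂ) (y : ZMod 15) :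
    zmodDFT (2 : ZMod 15)⁻¹ (fun y ↦ α (mod3 y) * β (mod5 y)) y
      = zmodDFT (2 * 2) α (mod3 y) * zmodDFT (2 * 3) β (mod5 y) := by
  rw [zmodDFT, zmodDFT, zmodDFT, ← sum_zmod_fifteen]
  refine Finset.sum_congr rfl fun r _ ↦ ?_
  rw [stdAddChar_fifteen, mul_mul_mul_comm, show (2 : ZMod 15)⁻¹ = 8 by decide +kernel]
  simp only [map_mul, ← mul_assoc]
  rfl

theorem cuspThetaA_neg_inv (b : Option (ZMod 3) × Option (ZMod 5)) {τ : ℂ} (hτ : 0 < τ.im) :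
    cuspThetaA b (-1 / τ) = -I * τ / √15 * (weilFactor 2 b.1 * weilFactor 3 b.2)
      * cuspThetaA (projS b.1, projS b.2) τ := by
  have h3 : (2 : ZMod 3) ≠ 0 := by decide
  have h5 : (3 : ZMod 5) ≠ 0 := by decide
  have : Fact (Nat.Prime 3) := ⟨by norm_num⟩
  have : Fact (Nat.Prime 5) := ⟨by norm_num⟩
  rw [cuspThetaA, pairTheta_neg_inv (by decide) (by decide) _ _ hτ, cuspThetaA, mul_assoc,
    show (((1 : ℕ) : ℝ) * ((15 : ℕ) : ℝ)) = 15 by norm_num]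
  congr 1
  have h1 : zmodDFT (2 : ZMod 1)⁻¹ 1 = 1 := by
    funext y
    simp [zmodDFT, Subsingleton.elim (_ : ZMod 1) 0]
  have h2 : zmodDFT (2 : ZMod 15)⁻¹ (fun y ↦ weilVector 2 b.1 (mod3 y) * weilVector 3 b.2 (mod5 y))
      = (weilFactor 2 b.1 * weilFactor 3 b.2) • fun y ↦ weilVector 2 (projS b.1) (mod3 y)
        * weilVector 3 (projS b.2) (mod5 y) := by
    funext y
    rw [zmodDFT_fifteen, zmodDFT_weilVector (by decide) h3,
      zmodDFT_weilVector (by decide) h5]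
    simp only [Pi.smul_apply, smul_eq_mul]
    ring
  rw [h1, h2, ← one_smul ℂ (1 : ZMod 1 → ℂ), pairTheta_smul, one_mul, one_smul]

theorem cuspThetaB_neg_inv (b : Option (ZMod 3) × Option (ZMod 5)) {τ : ℂ} (hτ : 0 < τ.im) :
    cuspThetaB b (-1 / τ) = -I * τ / √15 * (weilFactor 1 b.1 * weilFactor 4 b.2)
      * cuspThetaB (projS b.1, projS b.2) τ := by
  have h3 : (2 : ZMod 3)⁻¹ = 2 * 1 := by decide +kernel
  have h5 : (2 : ZMod 5)⁻¹ = 2 * 4 := by decide +kernel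
  have h5' : (4 : ZMod 5) ≠ 0 := by decide
  have : Fact (Nat.Prime 3) := ⟨by norm_num⟩
  have : Fact (Nat.Prime 5) := ⟨by norm_num⟩
  rw [cuspThetaB, pairTheta_neg_inv (by decide) (by decide) _ _ hτ, cuspThetaB, mul_assoc,
    show (((3 : ℕ) : ℝ) * ((5 : ℕ) : ℝ)) = 15 by norm_num]
  congr 1
  rw [h3, h5,
    zmodDFT_weilVector (by decide) one_ne_zero, zmodDFT_weilVector (by decide) h5',
    pairTheta_smul]

theorem cuspThetaA_add_one (b : Option (ZMod 3) × Option (ZMod 5)) (τ : ℂ) :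
    cuspThetaA b (τ + 1) = cuspThetaA (projT b.1, projT b.2) τ := by
  rw [cuspThetaA, pairTheta_add_one (u := 0) (v := 1) (u' := 4) _ _ (by norm_num) (by norm_num),
    cuspThetaA]
  congr 1
  · funext x
    simp
  · funext y
    rw [stdAddChar_fifteen, ← weilVector_projT, ← weilVector_projT, mul_mul_mul_comm]
    simp only [map_mul, map_pow, ← mul_assoc]
    rfl

theorem cuspThetaB_add_one (b : Option (ZMod 3) × Option (ZMod 5)) (τ : ℂ) :
    cuspThetaB b (τ + 1) = cuspThetaB (projT b.1, projT b.2) τ := by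
  rw [cuspThetaB, pairTheta_add_one (u := 1) (v := -1) (u' := -1) _ _ (by norm_num) (by norm_num),
    cuspThetaB]
  congr 1 <;> funext y <;> rw [← weilVector_projT] <;> rfl

/-- The theta series `∑ q ^ (n² / 4)` over the integers `n` of a fixed parity. -/
noncomputable def parityTheta (ε : ZMod 2) (τ : ℂ) : ℂ := periodicTheta 2 (parityIndicator ε) τ

lemma periodic_parityIndicator (ε : ZMod 2) :
    Function.Periodic (parityIndicator ε) ((2 : ℕ) : ℤ) := fun n ↦ by
  simp only [parityIndicator]
  push_cast
  rw [show (2 : ZMod 2) = 0 from rfl, add_zero]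

/-- A theta series restricted to the multiples of `k` is a rescaled theta series. -/
lemma periodicTheta_dvd {r k : ℕ} (hk : Odd k) {α : ZMod r → ℂ}
    (hα : ∀ n : ℤ, α n = if (k : ℤ) ∣ n then 1 else 0) (ε : ZMod 2) (τ : ℂ) :
    periodicTheta (2 * r) (fun n ↦ parityIndicator ε n * α n) τ
      = parityTheta ε (k ^ 2 * τ / r) := by
  have hk0 : (k : ℤ) ≠ 0 := by
    rintro h
    rw [Nat.cast_eq_zero] at h
    simp [h] at hk
  have hinj : Function.Injective fun n : ℤ ↦ (k : ℤ) * n := fun a b h ↦ mul_left_cancel₀ hk0 h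
  rw [periodicTheta, parityTheta, periodicTheta, ← hinj.tsum_eq]
  · refine tsum_congr fun n ↦ ?_
    rw [hα, if_pos (dvd_mul_right _ _), mul_one]
    congr 1
    · have : ((k : ℕ) : ZMod 2) = 1 := by
        obtain ⟨j, rfl⟩ := hk
        push_cast
        rw [show (2 : ZMod 2) = 0 from rfl, zero_mul, zero_add]
      simp [parityIndicator, this]
    · congr 1
      push_cast
      ring
  · intro n hn
    by_cases h : (k : ℤ) ∣ n
    · obtain ⟨m, rfl⟩ := h
      exact ⟨m, rfl⟩
    · simp [hα, h] at hn

/-- The product of two theta series over a common parity class, as a sum over `ℤ²`, where `f`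
parametrizes the pairs of integers of equal parity. -/
lemma sum_parityTheta_mul {z w : ℂ} (hz : 0 < z.im) (hw : 0 < w.im) {f : ℤ × ℤ → ℤ × ℤ}
    (hf : Function.Injective f) (hmem : ∀ v, Even ((f v).1 - (f v).2))
    (hsurj : ∀ v : ℤ × ℤ, Even (v.1 - v.2) → v ∈ Set.range f) :
    ∑ ε, parityTheta ε z * parityTheta ε w
      = ∑' v, cexp (Real.pi * I * ((f v).1 ^ 2 * z + (f v).2 ^ 2 * w) / 2) := by
  have hs (ε : ZMod 2) {z : ℂ} (hz : 0 < z.im) := (summable_periodicTheta (by norm_num)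
    (periodic_parityIndicator ε) hz).norm
  simp only [parityTheta, periodicTheta]
  rw [Finset.sum_congr rfl fun ε _ ↦ tsum_mul_tsum_of_summable_norm (hs ε hz) (hs ε hw),
    ← Summable.tsum_finsetSum fun ε _ ↦ (summable_mul_of_summable_norm (hs ε hz) (hs ε hw)),
    ← hf.tsum_eq]
  · refine tsum_congr fun v ↦ ?_
    have h : ((f v).1 : ZMod 2) = (f v).2 := by
      rw [← sub_eq_zero, ← Int.cast_sub, ZMod.intCast_zmod_eq_zero_iff_dvd]
      exact (hmem v).two_dvd
    simp only [parityIndicator, h, ite_mul, one_mul, zero_mul, mul_ite, mul_zero]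
    rw [Finset.sum_eq_single ((f v).2 : ZMod 2) (fun ε _ h ↦ by simp [h.symm]) (by simp), if_pos rfl,
      if_pos rfl, ← Complex.exp_add]
    congr 1
    push_cast
    ring
  · intro v hv
    refine hsurj v ?_
    by_contra h
    have h' : (v.1 : ZMod 2) ≠ v.2 := by
      intro h'
      rw [← sub_eq_zero, ← Int.cast_sub, ZMod.intCast_zmod_eq_zero_iff_dvd] at h'
      exact h (even_iff_two_dvd.2 h')
    refine hv (Finset.sum_eq_zero fun ε _ ↦ ?_)
    by_cases h1 : (v.1 : ZMod 2) = ε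
    · have h2 : (v.2 : ZMod 2) ≠ ε := fun h2 ↦ h' (h1.trans h2.symm)
      simp [parityIndicator, h2]
    · simp [parityIndicator, h1]

/-- The theta series of a quadratic form, as a function of `q`. -/
noncomputable def latticeTheta (Q : ℤ × ℤ → ℕ) (q : ℂ) : ℂ := ∑' v, q ^ Q v

lemma latticeTheta_formA {τ : ℂ} (hτ : 0 < τ.im) :
    ∑ ε, parityTheta ε τ * parityTheta ε (15 * τ)
      = latticeTheta (quadForm 1 1 4) (cexp (2 * Real.pi * I * τ)) := by
  rw [sum_parityTheta_mul hτ (by simpa using hτ) (f := fun v ↦ (2 * v.1 + v.2, v.2))]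
  · refine tsum_congr fun v ↦ ?_
    rw [← Complex.exp_nat_mul]
    congr 1
    have := congr_arg (Int.cast (R := ℂ)) (quadForm_cast (a := 1) (b := 1) (c := 4)
      (by norm_num) (by norm_num) v)
    push_cast at this
    rw [this]
    push_cast
    ring
  · rintro ⟨a, b⟩ ⟨c, d⟩ h
    simp only [Prod.mk.injEq] at h ⊢
    omega
  · exact fun v ↦ ⟨v.1, by simp; ring⟩
  · rintro ⟨x, y⟩ ⟨j, hj⟩
    exact ⟨(j, y), Prod.ext (show 2 * j + y = x by simp only at hj; omega) rfl⟩

lemma latticeTheta_formB {τ : ℂ} (hτ : 0 < τ.im) :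
    ∑ ε, parityTheta ε (3 * τ) * parityTheta ε (5 * τ)
      = latticeTheta (quadForm 2 1 2) (cexp (2 * Real.pi * I * τ)) := by
  rw [sum_parityTheta_mul (by simpa using hτ) (by simpa using hτ)
    (f := fun v ↦ (v.1 - v.2, v.1 + v.2))]
  · refine tsum_congr fun v ↦ ?_
    rw [← Complex.exp_nat_mul]
    congr 1
    have := congr_arg (Int.cast (R := ℂ)) (quadForm_cast (a := 2) (b := 1) (c := 2)
      (by norm_num) (by norm_num) v)
    push_cast at this
    rw [this]
    push_cast
    ring
  · rintro ⟨a, b⟩ ⟨c, d⟩ h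
    simp only [Prod.mk.injEq] at h ⊢
    omega
  · exact fun v ↦ ⟨-v.2, by simp; ring⟩
  · rintro ⟨x, y⟩ ⟨j, hj⟩
    exact ⟨(y + j, -j), by simp only [Prod.mk.injEq] at hj ⊢; omega⟩

lemma weilVector_none_intCast {p : ℕ} [NeZero p] (c : ZMod p) (n : ℤ) :
    weilVector c none n = if (p : ℤ) ∣ n then 1 else 0 := by
  simp only [weilVector, Pi.single_apply, ZMod.intCast_zmod_eq_zero_iff_dvd]

lemma weilVector_some_zero {p : ℕ} [NeZero p] (c : ZMod p) : weilVector c (some 0) = 1 := by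
  funext r
  simp [weilVector]

lemma pairTheta_dvd {p r j k : ℕ} (hj : Odd j) (hk : Odd k) {α : ZMod p → ℂ} {β : ZMod r → ℂ}
    (hα : ∀ n : ℤ, α n = if (j : ℤ) ∣ n then 1 else 0)
    (hβ : ∀ n : ℤ, β n = if (k : ℤ) ∣ n then 1 else 0) (τ : ℂ) :
    pairTheta p r α β τ
      = ∑ ε, parityTheta ε (j ^ 2 * τ / p) * parityTheta ε (k ^ 2 * τ / r) := by
  simp only [pairTheta, periodicTheta_dvd hj hα, periodicTheta_dvd hk hβ]

lemma cuspThetaA_dvd {k : ℕ} (hk : Odd k) {b : Option (ZMod 3) × Option (ZMod 5)}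
    (h : ∀ n : ℤ, weilVector 2 b.1 n * weilVector 3 b.2 n = if (k : ℤ) ∣ n then 1 else 0) (τ : ℂ) :
    cuspThetaA b τ = ∑ ε, parityTheta ε τ * parityTheta ε (k ^ 2 * τ / 15) := by
  rw [cuspThetaA, pairTheta_dvd (j := 1) odd_one hk (by simp) (fun n ↦ by
    rw [map_intCast mod3, map_intCast mod5, h])]
  simp

lemma cuspTheta_infty {τ : ℂ} (hτ : 0 < τ.im) :
    cuspThetaA (none, none) τ = latticeTheta (quadForm 1 1 4) (cexp (2 * Real.pi * I * τ)) ∧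
    cuspThetaB (none, none) τ = latticeTheta (quadForm 2 1 2) (cexp (2 * Real.pi * I * τ)) := by
  constructor
  · rw [cuspThetaA_dvd (k := 15) (by decide), ← latticeTheta_formA hτ]
    · refine Finset.sum_congr rfl fun ε _ ↦ ?_
      congr 2
      push_cast
      ring
    · intro n
      simp only [weilVector_none_intCast]
      have : (15 : ℤ) ∣ n ↔ 3 ∣ n ∧ 5 ∣ n := by omega
      by_cases h3 : (3 : ℤ) ∣ n <;> by_cases h5 : (5 : ℤ) ∣ n <;> simp [this, h3, h5]
  · rw [cuspThetaB, pairTheta_dvd (j := 3) (k := 5) (by decide) (by decide)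
      (weilVector_none_intCast _) (weilVector_none_intCast _), ← latticeTheta_formB hτ]
    refine Finset.sum_congr rfl fun ε _ ↦ ?_
    congr 2 <;> push_cast <;> ring

lemma cuspTheta_zero {τ : ℂ} (hτ : 0 < τ.im) :
    cuspThetaA (some 0, some 0) (15 * τ)
      = latticeTheta (quadForm 1 1 4) (cexp (2 * Real.pi * I * τ)) ∧
    cuspThetaB (some 0, some 0) (15 * τ)
      = latticeTheta (quadForm 2 1 2) (cexp (2 * Real.pi * I * τ)) := by
  constructor
  · rw [cuspThetaA_dvd (k := 1) (by decide) (by simp [weilVector_some_zero]),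
      ← latticeTheta_formA hτ]
    refine Finset.sum_congr rfl fun ε _ ↦ ?_
    rw [mul_comm]
    congr 2
    push_cast
    ring
  · rw [cuspThetaB, pairTheta_dvd (j := 1) (k := 1) (by decide) (by decide)
      (by simp [weilVector_some_zero]) (by simp [weilVector_some_zero]), ← latticeTheta_formB hτ]
    refine Finset.sum_congr rfl fun ε _ ↦ ?_
    rw [mul_comm]
    congr 2 <;> push_cast <;> ring

lemma cuspTheta_zero_infty {τ : ℂ} (hτ : 0 < τ.im) :
    cuspThetaA (some 0, none) (3 * τ)
      = latticeTheta (quadForm 2 1 2) (cexp (2 * Real.pi * I * τ)) ∧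
    cuspThetaB (some 0, none) (3 * τ)
      = latticeTheta (quadForm 1 1 4) (cexp (2 * Real.pi * I * τ)) := by
  constructor
  · rw [cuspThetaA_dvd (k := 5) (by decide)
      (by simp [weilVector_some_zero, weilVector_none_intCast]), ← latticeTheta_formB hτ]
    refine Finset.sum_congr rfl fun ε _ ↦ ?_
    congr 2
    push_cast
    ring
  · rw [cuspThetaB, pairTheta_dvd (j := 1) (k := 5) (by decide) (by decide)
      (by simp [weilVector_some_zero]) (weilVector_none_intCast _), ← latticeTheta_formA hτ]
    refine Finset.sum_congr rfl fun ε _ ↦ ?_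
    congr 2 <;> push_cast <;> ring

lemma cuspTheta_infty_zero {τ : ℂ} (hτ : 0 < τ.im) :
    cuspThetaA (none, some 0) (5 * τ)
      = latticeTheta (quadForm 2 1 2) (cexp (2 * Real.pi * I * τ)) ∧
    cuspThetaB (none, some 0) (5 * τ)
      = latticeTheta (quadForm 1 1 4) (cexp (2 * Real.pi * I * τ)) := by
  constructor
  · rw [cuspThetaA_dvd (k := 3) (by decide)
      (by simp [weilVector_some_zero, weilVector_none_intCast]), ← latticeTheta_formB hτ]
    refine Finset.sum_congr rfl fun ε _ ↦ ?_
    rw [mul_comm]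
    congr 2
    push_cast
    ring
  · rw [cuspThetaB, pairTheta_dvd (j := 3) (k := 1) (by decide) (by decide)
      (weilVector_none_intCast _) (by simp [weilVector_some_zero]), ← latticeTheta_formA hτ]
    refine Finset.sum_congr rfl fun ε _ ↦ ?_
    rw [mul_comm]
    congr 2 <;> push_cast <;> ring

/-! ### Quotients of theta series by eta functions -/

lemma hasSum_latticeTheta {Q : ℤ × ℤ → ℕ} (hQ : GrowsQuadratically Q) {q : ℂ} (hq : ‖q‖ < 1) :
    HasSum (fun v ↦ 1 * q ^ Q v) (latticeTheta Q q) := by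
  have := hQ.summable_pow (w := fun _ ↦ 1) (C := 1) (fun v ↦ by simp) hq
  simp only [one_mul] at this ⊢
  exact this.hasSum

lemma latticeTheta_eq {Q : ℤ × ℤ → ℕ} (hQ : GrowsQuadratically Q) {q : ℂ} (hq : ‖q‖ < 1) :
    HasSum (fun n ↦ fiberSum (fun _ ↦ 1) Q n * q ^ n) (latticeTheta Q q) :=
  hasSum_fiberSum (φ := fun n ↦ q ^ n) (hasSum_latticeTheta hQ hq)

lemma latticeTheta_zero {Q : ℤ × ℤ → ℕ} (hQ : GrowsQuadratically Q) (h0 : Q 0 = 0) :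
    latticeTheta Q 0 = 1 := by
  rw [latticeTheta, tsum_eq_single 0 fun v hv ↦ zero_pow (hQ.pos hv).ne', h0, pow_zero]

lemma differentiableOn_latticeTheta {Q : ℤ × ℤ → ℕ} (hQ : GrowsQuadratically Q) :
    DifferentiableOn ℂ (latticeTheta Q) (Metric.ball 0 1) :=
  (differentiableOn_tsum_pow fun _ hq ↦ (latticeTheta_eq hQ hq).summable).congr
    fun q hq ↦ (latticeTheta_eq hQ (by simpa using hq)).tsum_eq.symm

/-- The derivative at `q = 0` counts the representations of `1`. -/
lemma hasDerivAt_latticeTheta_zero {Q : ℤ × ℤ → ℕ} (hQ : GrowsQuadratically Q) {s : Finset (ℤ × ℤ)}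
    (hs : ∀ v, Q v = 1 ↔ v ∈ s) : HasDerivAt (latticeTheta Q) s.card 0 := by
  have h := hasDerivAt_tsum_pow_zero fun _ hq ↦ (latticeTheta_eq hQ hq).summable
  have h1 : fiberSum (fun _ ↦ 1) Q 1 = s.card := by
    rw [fiberSum]
    have : {v | Q v = 1} = (s : Set (ℤ × ℤ)) := Set.ext hs
    trans ∑' v : (s : Set (ℤ × ℤ)), (1 : ℂ)
    · rw [← this]
      rfl
    · simp
  rw [h1] at h
  refine h.congr_of_eventuallyEq ?_
  filter_upwards [Metric.ball_mem_nhds (0 : ℂ) one_pos] with q hq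
  exact (latticeTheta_eq hQ (by simpa using hq)).tsum_eq.symm

/-- The principal form `m² + m k + 4 k²` of discriminant `-15`. -/
abbrev formA : ℤ × ℤ → ℕ := quadForm 1 1 4

/-- The form `2 m² + m k + 2 k²` of discriminant `-15`, in the other class. -/
abbrev formB : ℤ × ℤ → ℕ := quadForm 2 1 2

lemma formA_growsQuadratically : GrowsQuadratically formA :=
  quadForm_growsQuadratically (by norm_num) (by norm_num)

lemma formB_growsQuadratically : GrowsQuadratically formB :=
  quadForm_growsQuadratically (by norm_num) (by norm_num)

lemma formA_eq_one_iff (v : ℤ × ℤ) :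
    formA v = 1 ↔ v ∈ ({(1, 0), (-1, 0)} : Finset (ℤ × ℤ)) := by
  have h := quadForm_cast (a := 1) (b := 1) (c := 4) (by norm_num) (by norm_num) v
  obtain ⟨m, k⟩ := v
  rw [← Nat.cast_inj (R := ℤ), h]
  simp only [Finset.mem_insert, Finset.mem_singleton, Prod.mk.injEq, Nat.cast_one]
  constructor
  · intro h
    have hk : k = 0 := by
      have : k ^ 2 < 1 := by nlinarith [sq_nonneg (2 * m + k)]
      exact pow_eq_zero_iff two_ne_zero |>.1 (by nlinarith [sq_nonneg k])
    subst hk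
    simp at h
    simpa using h
  · rintro (⟨rfl, rfl⟩ | ⟨rfl, rfl⟩) <;> norm_num

lemma formB_ne_one (v : ℤ × ℤ) : formB v = 1 ↔ v ∈ (∅ : Finset (ℤ × ℤ)) := by
  have h := quadForm_cast (a := 2) (b := 1) (c := 2) (by norm_num) (by norm_num) v
  obtain ⟨m, k⟩ := v
  rw [← Nat.cast_inj (R := ℤ), h]
  simp only [Finset.notMem_empty, iff_false, Nat.cast_one]
  intro h
  have hk : k = 0 := by
    have : k ^ 2 < 1 := by nlinarith [sq_nonneg (4 * m + k)]
    exact pow_eq_zero_iff two_ne_zero |>.1 (by nlinarith [sq_nonneg k])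
  subst hk
  simp at h
  omega

/-- Data `(a, b, d)` of the function `η((a τ + b) / d)` at the cusp attached to a point of
`P¹(𝔽_p)`: `η(p τ)` at `∞`, and `η((τ + b) / p)` at `b`. -/
def etaDatum (p : ℕ) : Option (ZMod p) → ℤ × ℤ × ℤ
  | none => (p, 0, 1)
  | some b => (1, b.cast, p)

/-- Data `(a, b, d)` of the function `η((a τ + b) / d)`, a transform of `η(15 τ)`, at the cusp
of level `15` attached to a point of `P¹(𝔽₃) × P¹(𝔽₅)`. -/
def etaDatum15 : Option (ZMod 3) × Option (ZMod 5) → ℤ × ℤ × ℤ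
  | (none, none) => (15, 0, 1)
  | (some b, none) => (5, 5 * b.cast, 3)
  | (none, some c) => (3, 3 * c.cast, 5)
  | (some b, some c) => (1, 10 * b.cast + 6 * c.cast, 15)

/-- The function `‖η((a τ + b) / d)‖` given by the datum `(a, b, d)`. -/
noncomputable def etaNorm (t : ℤ × ℤ × ℤ) (τ : ℂ) : ℝ :=
  ‖ModularForm.eta ((t.1 * τ + t.2.1) / t.2.2)‖

/-- Integrality conditions under which `S` takes the function with datum `t` to that with datum
`t'`, where both data have determinant `n`. -/
def SCompatible (n : ℤ) (t t' : ℤ × ℤ × ℤ) : Prop :=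
  0 < t.1 ∧ 0 < t.2.2 ∧ 0 < t'.1 ∧ 0 < t'.2.2 ∧ t.1 * t.2.2 = n ∧ t'.1 * t'.2.2 = n ∧
    n ∣ t.2.1 * t'.2.2 ∧ n ∣ t.2.1 * t'.2.1 + t.1 * t'.1 ∧ n ∣ t.2.2 * t'.2.2 ∧ n ∣ t.2.2 * t'.2.1

/-- Integrality conditions under which `T` takes the function with datum `t` to that with datum
`t'`. -/
def TCompatible (t t' : ℤ × ℤ × ℤ) : Prop :=
  t.1 = t'.1 ∧ t.2.2 = t'.2.2 ∧ t.2.2 ≠ 0 ∧ t.2.2 ∣ t.1 + t.2.1 - t'.2.1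

instance (n : ℤ) (t t' : ℤ × ℤ × ℤ) : Decidable (SCompatible n t t') := by
  unfold SCompatible; infer_instance

instance (t t' : ℤ × ℤ × ℤ) : Decidable (TCompatible t t') := by
  unfold TCompatible; infer_instance

lemma SCompatible.etaNorm_neg_inv {n : ℤ} {t t' : ℤ × ℤ × ℤ} (h : SCompatible n t t') (τ : ℍ) :
    etaNorm t (-1 / τ) = √(‖(τ : ℂ)‖ * (t.2.2 / t'.2.2)) * etaNorm t' τ := by
  obtain ⟨h1, h2, h3, h4, h5, h6, h7, h8, h9, h10⟩ := h
  exact norm_eta_neg_inv h1 h2 h3 h4 h5 h6 h7 h8 h9 h10 τ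

lemma TCompatible.etaNorm_add_one {t t' : ℤ × ℤ × ℤ} (h : TCompatible t t') (τ : ℂ) :
    etaNorm t (τ + 1) = etaNorm t' τ := by
  obtain ⟨h1, h2, h3, j, hj⟩ := h
  have hd : ((t'.2.2 : ℤ) : ℂ) ≠ 0 := by exact_mod_cast h2 ▸ h3
  have hjC : (t'.1 : ℂ) + t.2.1 - t'.2.1 = t'.2.2 * j := by
    rw [h1, h2] at hj
    exact_mod_cast congr_arg (Int.cast (R := ℂ)) hj
  rw [etaNorm, etaNorm, ← norm_eta_add_int ((t'.1 * τ + t'.2.1) / t'.2.2) j, h1,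
    h2]
  congr 2
  field_simp
  linear_combination hjC

lemma etaDatum_three_S : ∀ b, SCompatible 3 (etaDatum 3 b) (etaDatum 3 (projS b)) := by
  decide +kernel

lemma etaDatum_five_S : ∀ b, SCompatible 5 (etaDatum 5 b) (etaDatum 5 (projS b)) := by
  decide +kernel

lemma etaDatum15_S : ∀ b, SCompatible 15 (etaDatum15 b) (etaDatum15 (projS b.1, projS b.2)) := by
  decide +kernel

lemma etaDatum_three_T : ∀ b, TCompatible (etaDatum 3 b) (etaDatum 3 (projT b)) := by
  decide +kernel

lemma etaDatum_five_T : ∀ b, TCompatible (etaDatum 5 b) (etaDatum 5 (projT b)) := by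
  decide +kernel

lemma etaDatum15_T : ∀ b, TCompatible (etaDatum15 b) (etaDatum15 (projT b.1, projT b.2)) := by
  decide +kernel

lemma etaDatum_width {p : ℕ} (b : Option (ZMod p)) : (etaDatum p b).2.2 = cuspWidth b := by
  cases b <;> rfl

lemma etaDatum15_width (b : Option (ZMod 3) × Option (ZMod 5)) :
    (etaDatum15 b).2.2 = cuspWidth b.1 * cuspWidth b.2 := by
  obtain ⟨_ | _, _ | _⟩ := b <;> rfl

/-- The absolute value of the transform, at the cusp attached to `b`, of the modular function
`η(τ) η(15 τ) (Θ_A + Θ_B) / (2 (η(3 τ) η(5 τ))²)`. The sign is `-1` at the cusps where exactly one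
component of `b` is `∞`. -/
noncomputable def cuspRatio (b : Option (ZMod 3) × Option (ZMod 5)) (τ : ℂ) : ℝ :=
  ‖cuspThetaA b τ + (projSign b.1 * projSign b.2 : ℝ) * cuspThetaB b τ‖ / 2 *
    (‖ModularForm.eta τ‖ * etaNorm (etaDatum15 b) τ)
      / (etaNorm (etaDatum 3 b.1) τ * etaNorm (etaDatum 5 b.2) τ) ^ 2

lemma projSign_projT {p : ℕ} (b : Option (ZMod p)) : projSign (projT b) = projSign b := by
  cases b <;> rfl

lemma cuspRatio_add_one (b : Option (ZMod 3) × Option (ZMod 5)) (τ : ℂ) :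
    cuspRatio b (τ + 1) = cuspRatio (projT b.1, projT b.2) τ := by
  have h := norm_eta_add_int τ 1
  rw [Int.cast_one] at h
  rw [cuspRatio, cuspRatio, cuspThetaA_add_one, cuspThetaB_add_one, h,
    (etaDatum15_T b).etaNorm_add_one, (etaDatum_three_T b.1).etaNorm_add_one,
    (etaDatum_five_T b.2).etaNorm_add_one, projSign_projT, projSign_projT]

lemma projSign_mul_weilFactor_three (b : Option (ZMod 3)) :
    projSign b * weilFactor 1 b = -projSign (projS b) * weilFactor 2 b := by
  have h : (1 : ZMod 3) ≠ 0 ∧ (Finset.univ : Finset (ZMod 3)).val.map (fun r ↦ r ^ 2)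
      + (Finset.univ : Finset (ZMod 3)).val.map (fun r ↦ 2 * r ^ 2) = 2 • Finset.univ.val := by
    decide
  have : Fact (Nat.Prime 3) := ⟨by norm_num⟩
  exact projSign_mul_weilFactor h.2 h.1 b

lemma projSign_mul_weilFactor_five (b : Option (ZMod 5)) :
    projSign b * weilFactor 4 b = -projSign (projS b) * weilFactor 3 b := by
  have h : (4 : ZMod 5) ≠ 0 ∧ (Finset.univ : Finset (ZMod 5)).val.map (fun r ↦ r ^ 2)
      + (Finset.univ : Finset (ZMod 5)).val.map (fun r ↦ 2 * r ^ 2) = 2 • Finset.univ.val := by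
    decide
  have : Fact (Nat.Prime 5) := ⟨by norm_num⟩
  exact projSign_mul_weilFactor h.2 h.1 b

lemma cuspRatio_neg_inv (b : Option (ZMod 3) × Option (ZMod 5)) (τ : ℍ) :
    cuspRatio b (-1 / τ) = cuspRatio (projS b.1, projS b.2) τ := by
  have h2 : (2 : ZMod 3) ≠ 0 ∧ (3 : ZMod 5) ≠ 0 := by decide
  have : Fact (Nat.Prime 3) := ⟨by norm_num⟩
  have : Fact (Nat.Prime 5) := ⟨by norm_num⟩
  have h3 := projSign_mul_weilFactor_three b.1
  have h5 := projSign_mul_weilFactor_five b.2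
  have hn3 := norm_weilFactor (by decide) h2.1 b.1
  have hn5 := norm_weilFactor (by decide) h2.2 b.2
  have h1 : ‖ModularForm.eta (-1 / τ)‖ = √‖(τ : ℂ)‖ * ‖ModularForm.eta τ‖ := by
    simpa using norm_eta_neg_inv (n := 1) (a := 1) (b := 0) (d := 1) (a' := 1) (b' := 0) (d' := 1)
      (by simp) (by simp) (by simp) (by simp) (by simp) (by simp) (by simp) (by simp) (by simp)
      (by simp) τ
  have hV : ‖cuspThetaA b (-1 / τ) + (projSign b.1 * projSign b.2 : ℝ) * cuspThetaB b (-1 / τ)‖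
      = ‖(τ : ℂ)‖ / √15 * (‖weilFactor 2 b.1‖ * ‖weilFactor 3 b.2‖) *
        ‖cuspThetaA (projS b.1, projS b.2) τ + (projSign (projS b.1) * projSign (projS b.2) : ℝ) *
          cuspThetaB (projS b.1, projS b.2) τ‖ := by
    rw [cuspThetaA_neg_inv b τ.im_pos, cuspThetaB_neg_inv b τ.im_pos]
    have : ‖(τ : ℂ)‖ / √15 * (‖weilFactor 2 b.1‖ * ‖weilFactor 3 b.2‖)
        = ‖-I * τ / √15 * (weilFactor 2 b.1 * weilFactor 3 b.2)‖ := by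
      simp [abs_of_nonneg (Real.sqrt_nonneg _)]
    rw [this, ← norm_mul]
    congr 1
    push_cast
    linear_combination (-I * τ / √15 * cuspThetaB (projS b.1, projS b.2) τ) *
      (projSign b.2 * weilFactor 4 b.2 * h3 - projSign (projS b.1) * weilFactor 2 b.1 * h5)
  rw [cuspRatio, cuspRatio, hV, h1, (etaDatum15_S b).etaNorm_neg_inv,
    (etaDatum_three_S b.1).etaNorm_neg_inv, (etaDatum_five_S b.2).etaNorm_neg_inv, hn3, hn5]
  simp only [etaDatum_width, etaDatum15_width]
  have hT : 0 < ‖(τ : ℂ)‖ := norm_pos_iff.2 τ.ne_zero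
  have hw3 : (0 : ℝ) < cuspWidth b.1 := by exact_mod_cast cuspWidth_pos b.1
  have hw5 : (0 : ℝ) < cuspWidth b.2 := by exact_mod_cast cuspWidth_pos b.2
  have hw3' : (0 : ℝ) < cuspWidth (projS b.1) := by exact_mod_cast cuspWidth_pos _
  have hw5' : (0 : ℝ) < cuspWidth (projS b.2) := by exact_mod_cast cuspWidth_pos _
  push_cast
  set T := ‖(τ : ℂ)‖
  have e15 : √(T * (cuspWidth b.1 * cuspWidth b.2 / (cuspWidth (projS b.1) * cuspWidth (projS b.2))))
      = √T * √(cuspWidth b.1 / cuspWidth (projS b.1) : ℝ)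
        * √(cuspWidth b.2 / cuspWidth (projS b.2) : ℝ) := by
    rw [← Real.sqrt_mul (by positivity), ← Real.sqrt_mul (by positivity)]
    congr 1
    field_simp
  have e1 : √(15 : ℝ) = √3 * √5 := by
    rw [← Real.sqrt_mul (by norm_num)]
    norm_num
  rw [e15, e1, Real.sqrt_mul (by norm_num), Real.sqrt_mul (by norm_num), Real.sqrt_mul hT.le,
    Real.sqrt_mul hT.le]
  have q3 : (√3 : ℝ) ≠ 0 := by positivity
  have q5 : (√5 : ℝ) ≠ 0 := by positivity
  have hsT : √T * √T = T := Real.mul_self_sqrt hT.le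
  set s := √T
  have hs0 : s ≠ 0 := fun h ↦ by simp [h] at hsT; exact hT.ne' hsT.symm
  have g3 : √(cuspWidth b.1 / cuspWidth (projS b.1) : ℝ) ≠ 0 := by positivity
  have g5 : √(cuspWidth b.2 / cuspWidth (projS b.2) : ℝ) ≠ 0 := by positivity
  -- the remaining identity is rational in `√‖τ‖` and the square roots of the width quotients
  rw [← hsT]
  generalize √(cuspWidth b.1 / cuspWidth (projS b.1) : ℝ) = u at *
  generalize √(cuspWidth b.2 / cuspWidth (projS b.2) : ℝ) = w at *
  set E := etaNorm (etaDatum 3 (projS b.1)) τ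
  set F := etaNorm (etaDatum 5 (projS b.2)) τ
  have : (s * u * E * (s * w * F)) ^ 2 = (s ^ 4 * u ^ 2 * w ^ 2) * (E * F) ^ 2 := by ring
  rw [this, div_mul_eq_div_div]
  congr 1
  field_simp

/-! ### The theta series of discriminant -15 as eta quotients -/

/-- Half the sum `Θ₊` of the two theta series, as a function of `q`. -/
noncomputable def halfSum (q : ℂ) : ℂ := (latticeTheta formA q + latticeTheta formB q) / 2

/-- Half the difference `Θ₋` of the two theta series, as a function of `q`. It is `q + O(q²)`. -/
noncomputable def halfDiff (q : ℂ) : ℂ := (latticeTheta formA q - latticeTheta formB q) / 2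

/-- The functions `y Θ₊ / x²` (for `true`) and `x Θ₋ / y²` (for `false`), where
`x = η(3τ) η(5τ)`, `y = η(τ) η(15τ)`, as functions of `q`. The powers of `q` in the eta functions
cancel for `true`, and leave `Θ₋ / q` for `false`. -/
noncomputable def ratioFunction : Bool → ℂ → ℂ
  | true => fun q ↦ eulerProduct q * eulerProduct (q ^ 15)
      / (eulerProduct (q ^ 3) * eulerProduct (q ^ 5)) ^ 2 * halfSum q
  | false => fun q ↦ eulerProduct (q ^ 3) * eulerProduct (q ^ 5)
      / (eulerProduct q * eulerProduct (q ^ 15)) ^ 2 * dslope halfDiff 0 q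

lemma formA_zero : formA 0 = 0 := rfl

lemma formB_zero : formB 0 = 0 := rfl

lemma halfDiff_zero : halfDiff 0 = 0 := by
  rw [halfDiff, latticeTheta_zero formA_growsQuadratically formA_zero,
    latticeTheta_zero formB_growsQuadratically formB_zero, sub_self, zero_div]

lemma ratioFunction_zero (k : Bool) : ratioFunction k 0 = 1 := by
  cases k
  · have hA := hasDerivAt_latticeTheta_zero formA_growsQuadratically formA_eq_one_iff
    have hB := hasDerivAt_latticeTheta_zero formB_growsQuadratically formB_ne_one
    have h : HasDerivAt halfDiff 1 0 := by
      refine ((hA.sub hB).div_const 2).congr_deriv ?_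
      norm_num
    simp [ratioFunction, eulerProduct_zero, h.deriv]
  · simp [ratioFunction, eulerProduct_zero, halfSum,
      latticeTheta_zero formA_growsQuadratically formA_zero,
      latticeTheta_zero formB_growsQuadratically formB_zero]

lemma differentiableOn_eulerProduct_pow {n : ℕ} (hn : n ≠ 0) :
    DifferentiableOn ℂ (fun q ↦ eulerProduct (q ^ n)) (Metric.ball 0 1) :=
  differentiableOn_eulerProduct.comp (by fun_prop) fun q hq ↦ by
    simp only [mem_ball_zero_iff, norm_pow] at hq ⊢
    exact pow_lt_one₀ (norm_nonneg _) hq hn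

lemma eulerProduct_pow_ne_zero {q : ℂ} (hq : ‖q‖ < 1) {n : ℕ} (hn : n ≠ 0) :
    eulerProduct (q ^ n) ≠ 0 :=
  eulerProduct_ne_zero (by rw [norm_pow]; exact pow_lt_one₀ (norm_nonneg _) hq hn)

lemma differentiableOn_ratioFunction (k : Bool) :
    DifferentiableOn ℂ (ratioFunction k) (Metric.ball 0 1) := by
  have h1 := differentiableOn_eulerProduct
  have h3 := differentiableOn_eulerProduct_pow (n := 3) (by norm_num)
  have h5 := differentiableOn_eulerProduct_pow (n := 5) (by norm_num)
  have h15 := differentiableOn_eulerProduct_pow (n := 15) (by norm_num)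
  have hA := differentiableOn_latticeTheta formA_growsQuadratically
  have hB := differentiableOn_latticeTheta formB_growsQuadratically
  have n1 {q : ℂ} (hq : q ∈ Metric.ball (0 : ℂ) 1) := eulerProduct_ne_zero (by simpa using hq)
  have hn {q : ℂ} (hq : q ∈ Metric.ball (0 : ℂ) 1) {n : ℕ} (hn : n ≠ 0) :=
    eulerProduct_pow_ne_zero (q := q) (by simpa using hq) hn
  cases k
  · refine ((h3.mul h5).div ((h1.mul h15).pow 2) fun q hq ↦ ?_).mul ?_
    · exact pow_ne_zero _ (mul_ne_zero (n1 hq) (hn hq (by norm_num)))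
    · exact (differentiableOn_dslope (Metric.ball_mem_nhds _ one_pos)).2 ((hA.sub hB).div_const 2)
  · refine ((h1.mul h15).div ((h3.mul h5).pow 2) fun q hq ↦ ?_).mul ((hA.add hB).div_const 2)
    exact pow_ne_zero _ (mul_ne_zero (hn hq (by norm_num)) (hn hq (by norm_num)))

lemma eta_nat_mul (n : ℕ) (τ : ℂ) : ModularForm.eta (n * τ)
    = cexp (2 * Real.pi * I * τ / 24) ^ n * eulerProduct (cexp (2 * Real.pi * I * τ) ^ n) := by
  rw [eta_eq, ← Complex.exp_nat_mul, ← Complex.exp_nat_mul]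
  congr 2
  · ring
  · congr 1
    ring

lemma exp_div_pow (τ : ℂ) :
    cexp (2 * Real.pi * I * τ / 24) ^ 24 = cexp (2 * Real.pi * I * τ) := by
  rw [← Complex.exp_nat_mul]
  congr 1
  push_cast
  ring

lemma mul_dslope_halfDiff (q : ℂ) : q * dslope halfDiff 0 q = halfDiff q := by
  have := sub_smul_dslope halfDiff 0 q
  rwa [halfDiff_zero, sub_zero, sub_zero, smul_eq_mul] at this

lemma norm_ratioFunction_true (τ : ℂ) :
    ‖ratioFunction true (cexp (2 * Real.pi * I * τ))‖
      = ‖halfSum (cexp (2 * Real.pi * I * τ))‖ *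
        (‖ModularForm.eta τ‖ * ‖ModularForm.eta (15 * τ)‖)
          / (‖ModularForm.eta (3 * τ)‖ * ‖ModularForm.eta (5 * τ)‖) ^ 2 := by
  have h1 := eta_eq τ
  have h3 := eta_nat_mul 3 τ
  have h5 := eta_nat_mul 5 τ
  have h15 := eta_nat_mul 15 τ
  have hc := Complex.exp_ne_zero (2 * Real.pi * I * τ / 24)
  simp only [Nat.cast_ofNat] at h3 h5 h15
  rw [h1, h3, h5, h15, ratioFunction]
  generalize cexp (2 * Real.pi * I * τ) = q
  generalize cexp (2 * Real.pi * I * τ / 24) = c at *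
  simp only [← norm_mul, ← norm_pow, ← norm_div]
  congr 1
  have : (c ^ 3 * eulerProduct (q ^ 3) * (c ^ 5 * eulerProduct (q ^ 5))) ^ 2
      = c ^ 16 * (eulerProduct (q ^ 3) * eulerProduct (q ^ 5)) ^ 2 := by ring
  rw [this]
  field_simp

lemma norm_ratioFunction_false (τ : ℂ) :
    ‖ratioFunction false (cexp (2 * Real.pi * I * τ))‖
      = ‖halfDiff (cexp (2 * Real.pi * I * τ))‖ *
        (‖ModularForm.eta (3 * τ)‖ * ‖ModularForm.eta (5 * τ)‖)
          / (‖ModularForm.eta τ‖ * ‖ModularForm.eta (15 * τ)‖) ^ 2 := by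
  have h1 := eta_eq τ
  have h3 := eta_nat_mul 3 τ
  have h5 := eta_nat_mul 5 τ
  have h15 := eta_nat_mul 15 τ
  have hc := Complex.exp_ne_zero (2 * Real.pi * I * τ / 24)
  have hq := exp_div_pow τ
  simp only [Nat.cast_ofNat] at h3 h5 h15
  rw [h1, h3, h5, h15, ratioFunction, ← mul_dslope_halfDiff]
  generalize cexp (2 * Real.pi * I * τ) = q at *
  generalize cexp (2 * Real.pi * I * τ / 24) = c at *
  simp only [← norm_mul, ← norm_pow, ← norm_div]
  congr 1
  have : (c * eulerProduct q * (c ^ 15 * eulerProduct (q ^ 15))) ^ 2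
      = c ^ 32 * (eulerProduct q * eulerProduct (q ^ 15)) ^ 2 := by ring
  rw [this]
  generalize dslope halfDiff 0 q = D
  rw [← hq]
  field_simp

lemma cuspRatio_infty {τ : ℂ} (hτ : 0 < τ.im) :
    cuspRatio (none, none) τ = ‖ratioFunction true (cexp (2 * Real.pi * I * τ))‖ := by
  rw [norm_ratioFunction_true, cuspRatio, (cuspTheta_infty hτ).1, (cuspTheta_infty hτ).2, halfSum]
  simp [projSign, etaNorm, etaDatum, etaDatum15]

lemma cuspRatio_zero {τ : ℂ} (hτ : 0 < τ.im) :
    cuspRatio (some 0, some 0) (15 * τ) = ‖ratioFunction true (cexp (2 * Real.pi * I * τ))‖ := by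
  rw [norm_ratioFunction_true, cuspRatio, (cuspTheta_zero hτ).1, (cuspTheta_zero hτ).2, halfSum]
  have h3 : 15 * τ / 3 = 5 * τ := by ring
  have h5 : 15 * τ / 5 = 3 * τ := by ring
  simp [projSign, etaNorm, etaDatum, etaDatum15, h3, h5]
  ring

lemma cuspRatio_zero_infty {τ : ℂ} (hτ : 0 < τ.im) :
    cuspRatio (some 0, none) (3 * τ) = ‖ratioFunction false (cexp (2 * Real.pi * I * τ))‖ := by
  rw [norm_ratioFunction_false, cuspRatio, (cuspTheta_zero_infty hτ).1,
    (cuspTheta_zero_infty hτ).2, halfDiff, norm_div, ← norm_neg (_ - _), neg_sub]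
  have h3 : 15 * τ / 3 = 5 * τ := by ring
  have h5 : 5 * (3 * τ) = 15 * τ := by ring
  simp [projSign, etaNorm, etaDatum, etaDatum15, h3, h5, ← sub_eq_add_neg]

lemma cuspRatio_infty_zero {τ : ℂ} (hτ : 0 < τ.im) :
    cuspRatio (none, some 0) (5 * τ) = ‖ratioFunction false (cexp (2 * Real.pi * I * τ))‖ := by
  rw [norm_ratioFunction_false, cuspRatio, (cuspTheta_infty_zero hτ).1,
    (cuspTheta_infty_zero hτ).2, halfDiff, norm_div, ← norm_neg (_ - _), neg_sub]
  have h3 : 15 * τ / 5 = 3 * τ := by ring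
  have h5 : 3 * (5 * τ) = 15 * τ := by ring
  simp [projSign, etaNorm, etaDatum, etaDatum15, h3, h5, ← sub_eq_add_neg]
  ring

lemma cuspRatio_add_nat (b : Option (ZMod 3) × Option (ZMod 5)) (τ : ℂ) (n : ℕ) :
    cuspRatio b (τ + n) = cuspRatio (projT^[n] b.1, projT^[n] b.2) τ := by
  induction n generalizing b with
  | zero => simp
  | succ n ih =>
    rw [Nat.cast_succ, ← add_assoc, cuspRatio_add_one, ih]
    rfl

lemma projS_involutive {p : ℕ} [Fact p.Prime] : Function.Involutive (projS (p := p)) := by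
  intro b
  match b with
  | none => simp [projS]
  | some b =>
    by_cases hb : b = 0
    · simp [projS, hb]
    · simp [projS, hb]

/-- The cusps: the `T`-orbits on `P¹(𝔽₃) × P¹(𝔽₅)`. -/
lemma exists_cusp : ∀ b : Option (ZMod 3) × Option (ZMod 5), ∃ n : Fin 15,
    (projT^[n] none, projT^[n] none) = b ∨ (projT^[n] (some 0), projT^[n] (some 0)) = b ∨
    (projT^[n] (some 0), projT^[n] none) = b ∨ (projT^[n] none, projT^[n] (some 0)) = b := by
  decide +kernel

/-- The maximum principle applied to the two quotients and the functions `cuspRatio`. -/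
theorem ratioFunction_eq_one (k : Bool) {q : ℂ} (hq : ‖q‖ < 1) : ratioFunction k q = 1 := by
  have : Fact (Nat.Prime 3) := ⟨by norm_num⟩
  have : Fact (Nat.Prime 5) := ⟨by norm_num⟩
  refine eq_one_of_maximum_principle (ι := Option (ZMod 3) × Option (ZMod 5))
    (h := fun b τ ↦ cuspRatio b τ) (N := 15)
    ⟨(projS_involutive.toPerm _).prodCongr (projS_involutive.toPerm _), fun b τ ↦ ?_⟩
    ⟨(Equiv.optionCongr (Equiv.addRight 1)).prodCongr (Equiv.optionCongr (Equiv.addRight 1)),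
      fun b τ ↦ ?_⟩ differentiableOn_ratioFunction ratioFunction_zero (fun b ↦ ?_)
      (fun k ↦ ?_) k hq
  · have : ((ModularGroup.S • τ : ℍ) : ℂ) = -1 / τ := by
      rw [modular_S_smul, coe_mk, neg_div, one_div, inv_neg]
    rw [this, cuspRatio_neg_inv]
    rfl
  · have : ((ModularGroup.T • τ : ℍ) : ℂ) = τ + 1 := by
      rw [modular_T_smul, coe_vadd, add_comm]
      simp
    rw [this, cuspRatio_add_one]
    rfl
  · have him (τ : ℍ) (n d : ℕ) (hd : 0 < d) : 0 < ((τ + n) / d : ℂ).im := by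
      rw [div_natCast_im]
      have : (0 : ℝ) < d := by exact_mod_cast hd
      simp only [add_im, natCast_im, add_zero]
      exact div_pos τ.im_pos this
    obtain ⟨⟨n, -⟩, rfl | rfl | rfl | rfl⟩ := exists_cusp b
    · refine ⟨true, 1, n, one_pos, by norm_num, fun τ ↦ ?_⟩
      simp only
      rw [← cuspRatio_add_nat (none, none), Int.cast_natCast, ← cuspRatio_infty (him τ n 1 one_pos)]
      simp
    · refine ⟨true, 15, n, by norm_num, le_rfl, fun τ ↦ ?_⟩
      simp only
      rw [← cuspRatio_add_nat (some 0, some 0), Int.cast_natCast,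
        ← cuspRatio_zero (him τ n 15 (by norm_num))]
      congr 1
      push_cast
      ring
    · refine ⟨false, 3, n, by norm_num, by norm_num, fun τ ↦ ?_⟩
      simp only
      rw [← cuspRatio_add_nat (some 0, none), Int.cast_natCast,
        ← cuspRatio_zero_infty (him τ n 3 (by norm_num))]
      congr 1
      push_cast
      ring
    · refine ⟨false, 5, n, by norm_num, by norm_num, fun τ ↦ ?_⟩
      simp only
      rw [← cuspRatio_add_nat (none, some 0), Int.cast_natCast,
        ← cuspRatio_infty_zero (him τ n 5 (by norm_num))]
      congr 1
      push_cast
      ring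
  · cases k
    · refine ⟨(some 0, none), 3, by norm_num, fun τ τ' h ↦ ?_⟩
      rw [← cuspRatio_zero_infty τ.im_pos, h]
      rfl
    · refine ⟨(none, none), 1, one_pos, fun τ τ' h ↦ ?_⟩
      rw [← cuspRatio_infty τ.im_pos, h]
      simp

/-- The identity `x y Θ_A = x³ + y³` for `x = η(3τ) η(5τ)` and `y = η(τ) η(15τ)`. -/
theorem latticeTheta_formA_mul_eta (τ : ℍ) :
    ModularForm.eta τ * ModularForm.eta (3 * τ) * ModularForm.eta (5 * τ) *
      ModularForm.eta (15 * τ) * latticeTheta formA (cexp (2 * Real.pi * I * τ))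
      = (ModularForm.eta (3 * τ) * ModularForm.eta (5 * τ)) ^ 3
        + (ModularForm.eta τ * ModularForm.eta (15 * τ)) ^ 3 := by
  have hq : ‖cexp (2 * Real.pi * I * τ)‖ < 1 := by
    have := UpperHalfPlane.norm_exp_two_pi_I_lt_one τ
    exact this
  have ht := ratioFunction_eq_one true hq
  have hf := ratioFunction_eq_one false hq
  have h1 := eta_eq τ
  have h3 := eta_nat_mul 3 τ
  have h5 := eta_nat_mul 5 τ
  have h15 := eta_nat_mul 15 τ
  have hc := exp_div_pow τ
  simp only [Nat.cast_ofNat] at h3 h5 h15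
  have hd := mul_dslope_halfDiff (cexp (2 * Real.pi * I * τ))
  have hsum : latticeTheta formA (cexp (2 * Real.pi * I * τ))
      = halfSum (cexp (2 * Real.pi * I * τ)) + halfDiff (cexp (2 * Real.pi * I * τ)) := by
    rw [halfSum, halfDiff]
    ring
  have n1 := eulerProduct_ne_zero hq
  have n3 := eulerProduct_pow_ne_zero hq (n := 3) (by norm_num)
  have n5 := eulerProduct_pow_ne_zero hq (n := 5) (by norm_num)
  have n15 := eulerProduct_pow_ne_zero hq (n := 15) (by norm_num)
  rw [hsum, h1, h3, h5, h15, ← hd]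
  simp only [ratioFunction] at ht hf
  rw [div_mul_eq_mul_div, div_eq_one_iff_eq (by positivity)] at ht hf
  generalize dslope halfDiff 0 (cexp (2 * Real.pi * I * τ)) = D at *
  generalize halfSum (cexp (2 * Real.pi * I * τ)) = S at *
  generalize cexp (2 * Real.pi * I * τ) = q at *
  generalize cexp (2 * Real.pi * I * τ / 24) = c at *
  rw [show c * eulerProduct q * (c ^ 3 * eulerProduct (q ^ 3)) * (c ^ 5 * eulerProduct (q ^ 5)) *
      (c ^ 15 * eulerProduct (q ^ 15)) * (S + q * D) =
      c ^ 24 * (eulerProduct (q ^ 3) * eulerProduct (q ^ 5)) *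
        (eulerProduct q * eulerProduct (q ^ 15) * S) +
      c ^ 24 * (eulerProduct q * eulerProduct (q ^ 15)) * q *
        (eulerProduct (q ^ 3) * eulerProduct (q ^ 5) * D) by ring, ht, hf]
  linear_combination -(c ^ 24 * (eulerProduct q * eulerProduct (q ^ 15)) ^ 3) * hc

/-! ### Parity classes of lattice sums, and the form of weight three -/

/-- Splitting a lattice sum by the parity of `d`, where `g` and `g'` parametrize the two parts. -/
lemma tsum_eq_add_of_ranges {F : ℤ × ℤ → ℂ} (hF : Summable F) {g g' : ℤ × ℤ → ℤ × ℤ} (d : ℤ × ℤ → ℤ)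
    (hg : Function.Injective g) (hg' : Function.Injective g')
    (h : ∀ v, v ∈ Set.range g ↔ Even (d v)) (h' : ∀ v, v ∈ Set.range g' ↔ Odd (d v)) :
    ∑' v, F v = ∑' v, F (g v) + ∑' v, F (g' v) := by
  have hc : IsCompl (Set.range g) (Set.range g') := by
    have : Set.range g' = (Set.range g)ᶜ := by
      ext v
      rw [Set.mem_compl_iff, h, h', Int.not_even_iff_odd]
    rw [this]
    exact isCompl_compl
  have h1 := (hg.hasSum_range_iff (f := F)).2 (hF.comp_injective hg).hasSum
  have h2 := (hg'.hasSum_range_iff (f := F)).2 (hF.comp_injective hg').hasSum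
  exact (h1.add_isCompl hc h2).tsum_eq

lemma injective_fst (c : ℤ) : Function.Injective fun v : ℤ × ℤ ↦ (2 * v.1 + c, v.2) :=
  fun v w h ↦ by
    simp only [Prod.mk.injEq] at h
    exact Prod.ext (by omega) (by omega)

lemma injective_snd (c : ℤ) : Function.Injective fun v : ℤ × ℤ ↦ (v.1, 2 * v.2 + c) :=
  fun v w h ↦ by
    simp only [Prod.mk.injEq] at h
    exact Prod.ext (by omega) (by omega)

lemma injective_diag (c : ℤ) : Function.Injective fun v : ℤ × ℤ ↦ (v.2 + v.1 + c, v.2 - v.1) :=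
  fun v w h ↦ by
    simp only [Prod.mk.injEq] at h
    exact Prod.ext (by omega) (by omega)

lemma tsum_parity_fst {F : ℤ × ℤ → ℂ} (hF : Summable F) :
    ∑' v, F v = ∑' v : ℤ × ℤ, F (2 * v.1, v.2) + ∑' v : ℤ × ℤ, F (2 * v.1 + 1, v.2) := by
  refine tsum_eq_add_of_ranges hF Prod.fst (by simpa using injective_fst 0) (injective_fst 1)
    (fun v ↦ ⟨?_, ?_⟩) fun v ↦ ⟨?_, ?_⟩
  · rintro ⟨w, rfl⟩
    exact even_two_mul _
  · rintro ⟨j, hj⟩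
    exact ⟨(j, v.2), Prod.ext (by simp only; omega) rfl⟩
  · rintro ⟨w, rfl⟩
    exact odd_two_mul_add_one _
  · rintro ⟨j, hj⟩
    exact ⟨(j, v.2), Prod.ext (by simp only; omega) rfl⟩

lemma tsum_parity_snd {F : ℤ × ℤ → ℂ} (hF : Summable F) :
    ∑' v, F v = ∑' v : ℤ × ℤ, F (v.1, 2 * v.2) + ∑' v : ℤ × ℤ, F (v.1, 2 * v.2 + 1) := by
  refine tsum_eq_add_of_ranges hF Prod.snd (by simpa using injective_snd 0) (injective_snd 1)
    (fun v ↦ ⟨?_, ?_⟩) fun v ↦ ⟨?_, ?_⟩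
  · rintro ⟨w, rfl⟩
    exact even_two_mul _
  · rintro ⟨j, hj⟩
    exact ⟨(v.1, j), Prod.ext rfl (by simp only; omega)⟩
  · rintro ⟨w, rfl⟩
    exact odd_two_mul_add_one _
  · rintro ⟨j, hj⟩
    exact ⟨(v.1, j), Prod.ext rfl (by simp only; omega)⟩

lemma tsum_parity_diag {F : ℤ × ℤ → ℂ} (hF : Summable F) :
    ∑' v, F v = ∑' v : ℤ × ℤ, F (v.2 + v.1, v.2 - v.1)
      + ∑' v : ℤ × ℤ, F (v.2 + v.1 + 1, v.2 - v.1) := by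
  refine tsum_eq_add_of_ranges hF (fun v ↦ v.1 - v.2) (by simpa using injective_diag 0)
    (injective_diag 1) (fun v ↦ ⟨?_, ?_⟩) fun v ↦ ⟨?_, ?_⟩
  · rintro ⟨w, rfl⟩
    exact ⟨w.1, by ring⟩
  · rintro ⟨j, hj⟩
    exact ⟨(j, v.2 + j), Prod.ext (by simp only; omega) (by simp only; omega)⟩
  · rintro ⟨w, rfl⟩
    exact ⟨w.1, by ring⟩
  · rintro ⟨j, hj⟩
    exact ⟨(j, v.2 + j), Prod.ext (by simp only; omega) (by simp only; omega)⟩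

lemma tsum_reindex {F : ℤ × ℤ → ℂ} (f g : ℤ × ℤ → ℤ × ℤ) (h : ∀ v, g (f v) = v)
    (h' : ∀ v, f (g v) = v) : ∑' v, F (f v) = ∑' v, F v :=
  Equiv.tsum_eq ⟨f, g, h, h'⟩ F

lemma tsum_eq_zero_of_antisymm {F : ℤ × ℤ → ℂ} (f g : ℤ × ℤ → ℤ × ℤ) (h : ∀ v, g (f v) = v)
    (h' : ∀ v, f (g v) = v) (hF : ∀ v, F (f v) = -F v) : ∑' v, F v = 0 := by
  have := tsum_reindex (F := F) f g h h'
  simp_rw [hF, tsum_neg] at this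
  exact self_eq_neg.1 this.symm

lemma formA_cast (m k : ℤ) : (formA (m, k) : ℤ) = m ^ 2 + m * k + 4 * k ^ 2 := by
  simpa using quadForm_cast (a := 1) (b := 1) (c := 4) (by norm_num) (by norm_num) (m, k)

lemma formB_cast (m k : ℤ) : (formB (m, k) : ℤ) = 2 * m ^ 2 + m * k + 2 * k ^ 2 := by
  simpa using quadForm_cast (a := 2) (b := 1) (c := 2) (by norm_num) (by norm_num) (m, k)

/-- The harmonic weight `2 m² + 2 m k - 7 k²` for `m² + m k + 4 k²`. -/
def weightA (v : ℤ × ℤ) : ℤ := 2 * v.1 ^ 2 + 2 * v.1 * v.2 - 7 * v.2 ^ 2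

/-- The harmonic weight `m² + 8 m k + k²` for `2 m² + m k + 2 k²`. -/
def weightB (v : ℤ × ℤ) : ℤ := v.1 ^ 2 + 8 * v.1 * v.2 + v.2 ^ 2

lemma formA_eq {m k m' k' : ℤ} (h : m ^ 2 + m * k + 4 * k ^ 2 = m' ^ 2 + m' * k' + 4 * k' ^ 2) :
    formA (m, k) = formA (m', k') := by
  rw [← Nat.cast_inj (R := ℤ), formA_cast, formA_cast, h]

lemma formB_eq {m k m' k' : ℤ}
    (h : 2 * m ^ 2 + m * k + 2 * k ^ 2 = 2 * m' ^ 2 + m' * k' + 2 * k' ^ 2) :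
    formB (m, k) = formB (m', k') := by
  rw [← Nat.cast_inj (R := ℤ), formB_cast, formB_cast, h]

lemma formA_conj (m k : ℤ) : formA (m + k, -k) = formA (m, k) := formA_eq (by ring)

lemma formB_swap (m k : ℤ) : formB (k, m) = formB (m, k) := formB_eq (by ring)

lemma formA_two_mul_fst (m k : ℤ) : formA (2 * m, k) = 2 * formB (m, k) := by
  rw [← Nat.cast_inj (R := ℤ), formA_cast, Nat.cast_mul, formB_cast]
  push_cast
  ring

lemma formB_two_mul_fst (m k : ℤ) : formB (2 * m, k) = 2 * formA (k, m) := by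
  rw [← Nat.cast_inj (R := ℤ), formB_cast, Nat.cast_mul, formA_cast]
  push_cast
  ring

/-- For `φ n = q ^ n` the right-hand sum is the product of `∑ (4n+1) q ^ (3 (4n+1)² / 8)` and
`∑ (4l+1) q ^ (5 (4l+1)² / 8)`. With `m + 3k = 4n + 1` and `m - k = 4l + 1` it runs over the pairs
`(m, k)` with `m - k ≡ 1` modulo `4`, and the weight is `(m - k)(m + 3k)`, which becomes `P_A / 2` when
averaged over the automorphism `(m, k) ↦ (m + k, -k)` of the form. The classes `1` and `3` modulo `4` of `m - k` contribute equally and the even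
class contributes nothing. -/
lemma tsum_weightA {φ : ℕ → ℂ}
    (hs : Summable fun v : ℤ × ℤ ↦ (((v.1 - v.2) * (v.1 + 3 * v.2) : ℤ) : ℂ) * φ (formA v)) :
    ∑' v, (weightA v : ℂ) * φ (formA v) = 4 * ∑' v : ℤ × ℤ,
      (((4 * v.1 + 1) * (4 * v.2 + 1) : ℤ) : ℂ)
        * φ (formA (v.1 + 3 * v.2 + 1, v.1 - v.2)) := by
  set W : ℤ × ℤ → ℂ := fun v ↦ (((v.1 - v.2) * (v.1 + 3 * v.2) : ℤ) : ℂ) * φ (formA v) with hW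
  have hconj : ∑' v : ℤ × ℤ, W (v.1 + v.2, -v.2) = ∑' v, W v :=
    tsum_reindex (fun v ↦ (v.1 + v.2, -v.2)) (fun v ↦ (v.1 + v.2, -v.2)) (by simp) (by simp)
  have h1 : ∑' v, (weightA v : ℂ) * φ (formA v) = 2 * ∑' v, W v := by
    have hs' : Summable fun v : ℤ × ℤ ↦ W (v.1 + v.2, -v.2) :=
      hs.comp_injective (i := fun v : ℤ × ℤ ↦ (v.1 + v.2, -v.2)) fun v w h ↦ by
        simp only [Prod.mk.injEq] at h
        exact Prod.ext (by omega) (by omega)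
    rw [two_mul]
    nth_rw 2 [← hconj]
    rw [← hs.tsum_add hs']
    refine tsum_congr fun v ↦ ?_
    simp only [hW, formA_conj, weightA]
    push_cast
    ring
  have heven : ∑' v : ℤ × ℤ, W (v.2 + v.1, v.2 - v.1) = 0 := by
    refine tsum_eq_zero_of_antisymm (fun v ↦ (v.1, v.1 - v.2)) (fun v ↦ (v.1, v.1 - v.2))
      (fun v ↦ by simp) (fun v ↦ by simp) fun v ↦ ?_
    simp only [hW]
    rw [formA_eq (m := v.1 - v.2 + v.1) (k := v.1 - v.2 - v.1) (m' := v.2 + v.1) (k' := v.2 - v.1)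
      (by ring), ← neg_mul]
    congr 1
    push_cast
    ring
  have hneg : ∑' v : ℤ × ℤ, W (v.2 + (2 * v.1 + 1) + 1, v.2 - (2 * v.1 + 1))
      = ∑' v : ℤ × ℤ, W (v.2 + 2 * v.1 + 1, v.2 - 2 * v.1) := by
    rw [← tsum_reindex (F := fun v : ℤ × ℤ ↦ W (v.2 + 2 * v.1 + 1, v.2 - 2 * v.1))
      (fun v ↦ (-v.1 - 1, -v.2 - 1)) (fun v ↦ (-v.1 - 1, -v.2 - 1)) (by simp) (by simp)]
    refine tsum_congr fun v ↦ ?_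
    simp only [hW]
    congr 1
    · push_cast
      ring
    · congr 1
      exact formA_eq (by ring)
  rw [h1, tsum_parity_diag hs, heven, zero_add, tsum_parity_fst
    (F := fun v : ℤ × ℤ ↦ W (v.2 + v.1 + 1, v.2 - v.1)) (hs.comp_injective (injective_diag 1)), hneg,
    ← tsum_reindex (F := fun v : ℤ × ℤ ↦ W (v.2 + 2 * v.1 + 1, v.2 - 2 * v.1))
      (fun v ↦ (v.2, v.1 + v.2)) (fun v ↦ (v.2 - v.1, v.1)) (by simp) (by simp), ← two_mul,
    ← mul_assoc]
  norm_num
  refine tsum_congr fun v ↦ ?_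
  simp only [hW]
  congr 1
  · push_cast
    ring
  · congr 1
    exact formA_eq (by ring)

/-- For `φ n = q ^ n` the right-hand sum is the product of `∑ (4n+1) q ^ ((4n+1)² / 8)` and
`∑ (4l+1) q ^ (15 (4l+1)² / 8)`. It runs over the pairs `(m, k)` with `m = 4l + 1` and
`m + 4k = 4n + 1`, and the weight `m (m + 4k)` becomes `P_B / 2` when averaged over the swap of `m`
and `k`. The classes `1` and `3` modulo `4` of `m` contribute equally and the even class contributes
nothing. -/
lemma tsum_weightB {φ : ℕ → ℂ}
    (hs : Summable fun v : ℤ × ℤ ↦ ((v.1 * (v.1 + 4 * v.2) : ℤ) : ℂ) * φ (formB v)) :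
    ∑' v, (weightB v : ℂ) * φ (formB v) = 4 * ∑' v : ℤ × ℤ,
      (((4 * v.1 + 1) * (4 * v.2 + 1) : ℤ) : ℂ) * φ (formB (4 * v.2 + 1, v.1 - v.2)) := by
  set W : ℤ × ℤ → ℂ := fun v ↦ ((v.1 * (v.1 + 4 * v.2) : ℤ) : ℂ) * φ (formB v) with hW
  have hswap : ∑' v : ℤ × ℤ, W (v.2, v.1) = ∑' v, W v :=
    tsum_reindex (fun v ↦ (v.2, v.1)) (fun v ↦ (v.2, v.1)) (by simp) (by simp)
  have h1 : ∑' v, (weightB v : ℂ) * φ (formB v) = 2 * ∑' v, W v := by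
    have hs' : Summable fun v : ℤ × ℤ ↦ W (v.2, v.1) :=
      hs.comp_injective (i := fun v : ℤ × ℤ ↦ (v.2, v.1)) fun v w h ↦ by
        simp only [Prod.mk.injEq] at h
        exact Prod.ext (by omega) (by omega)
    rw [two_mul]
    nth_rw 2 [← hswap]
    rw [← hs.tsum_add hs']
    refine tsum_congr fun v ↦ ?_
    simp only [hW, formB_swap, weightB]
    push_cast
    ring
  have heven : ∑' v : ℤ × ℤ, W (2 * v.1, v.2) = 0 := by
    refine tsum_eq_zero_of_antisymm (fun v ↦ (-v.1, v.2 + v.1)) (fun v ↦ (-v.1, v.2 + v.1))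
      (fun v ↦ by simp) (fun v ↦ by simp) fun v ↦ ?_
    simp only [hW]
    rw [formB_eq (m := 2 * -v.1) (k := v.2 + v.1) (m' := 2 * v.1) (k' := v.2) (by ring), ← neg_mul]
    congr 1
    push_cast
    ring
  have hneg : ∑' v : ℤ × ℤ, W (2 * (2 * v.1 + 1) + 1, v.2)
      = ∑' v : ℤ × ℤ, W (2 * (2 * v.1) + 1, v.2) := by
    rw [← tsum_reindex (F := fun v : ℤ × ℤ ↦ W (2 * (2 * v.1) + 1, v.2))
      (fun v ↦ (-v.1 - 1, -v.2)) (fun v ↦ (-v.1 - 1, -v.2)) (by simp) (by simp)]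
    refine tsum_congr fun v ↦ ?_
    simp only [hW]
    congr 1
    · push_cast
      ring
    · congr 1
      exact formB_eq (by ring)
  rw [h1, tsum_parity_fst hs, heven, zero_add, tsum_parity_fst
    (F := fun v : ℤ × ℤ ↦ W (2 * v.1 + 1, v.2)) (hs.comp_injective (injective_fst 1)), hneg,
    ← tsum_reindex (F := fun v : ℤ × ℤ ↦ W (2 * (2 * v.1) + 1, v.2))
      (fun v ↦ (v.2, v.1 - v.2)) (fun v ↦ (v.2 + v.1, v.1)) (by simp) (by simp), ← two_mul,
    ← mul_assoc]
  norm_num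
  refine tsum_congr fun v ↦ ?_
  simp only [hW]
  congr 1
  · push_cast
    ring
  · congr 1
    exact formB_eq (by ring)

lemma exp_pow_formA (τ : ℂ) (n l : ℤ) :
    cexp (2 * Real.pi * I * ((4 * n + 1) ^ 2 / 8) * (3 * τ))
      * cexp (2 * Real.pi * I * ((4 * l + 1) ^ 2 / 8) * (5 * τ))
      = cexp (2 * Real.pi * I * τ) ^ formA (n + 3 * l + 1, n - l) := by
  rw [← Complex.exp_nat_mul, ← Complex.exp_add]
  congr 1
  have := congr_arg (Int.cast (R := ℂ)) (formA_cast (n + 3 * l + 1) (n - l))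
  push_cast at this
  rw [this]
  ring

lemma exp_pow_formB (τ : ℂ) (n l : ℤ) :
    cexp (2 * Real.pi * I * ((4 * n + 1) ^ 2 / 8) * τ)
      * cexp (2 * Real.pi * I * ((4 * l + 1) ^ 2 / 8) * (15 * τ))
      = cexp (2 * Real.pi * I * τ) ^ formB (4 * l + 1, n - l) := by
  rw [← Complex.exp_nat_mul, ← Complex.exp_add]
  congr 1
  have := congr_arg (Int.cast (R := ℂ)) (formB_cast (4 * l + 1) (n - l))
  push_cast at this
  rw [this]
  ring

lemma im_natCast_mul_pos (τ : ℍ) {a : ℕ} (ha : 0 < a) : 0 < (a * τ : ℂ).im := by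
  have : (0 : ℝ) < a := by exact_mod_cast ha
  simpa using mul_pos this τ.im_pos

lemma eta_mul_pow_three (τ : ℍ) {a : ℕ} (ha : 0 < a) :
    ModularForm.eta (a * τ) ^ 3 = thetaCubed (a * τ) :=
  eta_pow_three ⟨_, im_natCast_mul_pos τ ha⟩

lemma thetaCubed_mul {z w : ℂ} (hz : 0 < z.im) (hw : 0 < w.im) :
    thetaCubed z * thetaCubed w = ∑' v : ℤ × ℤ, (((4 * v.1 + 1) * (4 * v.2 + 1) : ℤ) : ℂ) *
      (cexp (2 * Real.pi * I * ((4 * v.1 + 1) ^ 2 / 8) * z)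
        * cexp (2 * Real.pi * I * ((4 * v.2 + 1) ^ 2 / 8) * w)) := by
  rw [thetaCubed, thetaCubed, tsum_mul_tsum_of_summable_norm (hasSum_thetaCubed hz).summable.norm
    (hasSum_thetaCubed hw).summable.norm]
  refine tsum_congr fun v ↦ ?_
  push_cast
  ring

lemma norm_quadratic_le {Q : ℤ × ℤ → ℕ} (hQ : GrowsQuadratically Q) (a b c : ℤ) (v : ℤ × ℤ) :
    ‖((a * v.1 ^ 2 + b * v.1 * v.2 + c * v.2 ^ 2 : ℤ) : ℂ)‖
      ≤ (2 * (|a| + |b| + |c|) : ℤ) * Q v := by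
  rw [Complex.norm_intCast]
  norm_cast
  have h := hQ v
  have h1 : |a * v.1 ^ 2 + b * v.1 * v.2 + c * v.2 ^ 2| ≤ (|a| + |b| + |c|) * (v.1 ^ 2 + v.2 ^ 2) := by
    have h2 : |v.1 * v.2| ≤ v.1 ^ 2 + v.2 ^ 2 := by
      rw [abs_le]
      constructor <;> nlinarith [sq_nonneg (v.1 + v.2), sq_nonneg (v.1 - v.2)]
    calc _ ≤ |a * v.1 ^ 2| + |b * v.1 * v.2| + |c * v.2 ^ 2| := abs_add_three _ _ _
      _ = |a| * v.1 ^ 2 + |b| * |v.1 * v.2| + |c| * v.2 ^ 2 := by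
        rw [abs_mul, abs_mul c, abs_sq, abs_sq, mul_assoc b, abs_mul b]
      _ ≤ _ := by
        nlinarith [abs_nonneg a, abs_nonneg b, abs_nonneg c, sq_nonneg v.1, sq_nonneg v.2,
          mul_le_mul_of_nonneg_left h2 (abs_nonneg b), mul_nonneg (abs_nonneg a) (sq_nonneg v.2),
          mul_nonneg (abs_nonneg c) (sq_nonneg v.1)]
  nlinarith [abs_nonneg a, abs_nonneg b, abs_nonneg c]

lemma summable_quadratic_mul_pow {Q : ℤ × ℤ → ℕ} (hQ : GrowsQuadratically Q) (a b c : ℤ) {q : ℂ}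
    (hq : ‖q‖ < 1) : Summable fun v : ℤ × ℤ ↦
      ((a * v.1 ^ 2 + b * v.1 * v.2 + c * v.2 ^ 2 : ℤ) : ℂ) * q ^ Q v :=
  hQ.summable_pow (C := (2 * (|a| + |b| + |c|) : ℤ)) (fun v ↦ (norm_quadratic_le hQ a b c v).trans (by
    have : (0 : ℝ) ≤ (2 * (|a| + |b| + |c|) : ℤ) := by exact_mod_cast (by positivity)
    gcongr
    linarith)) hq

/-- The form `f⁺` as a sum of theta series with harmonic weights. -/
theorem fPlus_eq (τ : ℍ) :
    fPlus τ = 1 / 4 * ∑' v, (weightA v : ℂ) * cexp (2 * Real.pi * I * τ) ^ formA v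
      + 1 / 4 * ∑' v, (weightB v : ℂ) * cexp (2 * Real.pi * I * τ) ^ formB v := by
  have hq : ‖cexp (2 * Real.pi * I * τ)‖ < 1 := UpperHalfPlane.norm_exp_two_pi_I_lt_one τ
  have h0 : binaryTheta τ = latticeTheta formA (cexp (2 * Real.pi * I * τ)) := by
    refine tsum_congr fun v ↦ ?_
    rw [← Complex.exp_nat_mul]
    congr 1
    have := congr_arg (Int.cast (R := ℂ)) (formA_cast v.1 v.2)
    push_cast at this
    rw [this]
    ring
  have h1 := eta_pow_three τ
  have h3 := eta_mul_pow_three τ (a := 3) (by norm_num)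
  have h5 := eta_mul_pow_three τ (a := 5) (by norm_num)
  have h15 := eta_mul_pow_three τ (a := 15) (by norm_num)
  simp only [Nat.cast_ofNat] at h3 h5 h15
  have e1 := thetaCubed_mul (im_natCast_mul_pos τ (a := 3) (by norm_num))
    (im_natCast_mul_pos τ (a := 5) (by norm_num))
  have e2 := thetaCubed_mul τ.im_pos (im_natCast_mul_pos τ (a := 15) (by norm_num))
  simp only [Nat.cast_ofNat] at e1 e2
  rw [fPlus, h0, latticeTheta_formA_mul_eta, mul_pow, mul_pow, h1, h3, h5, h15,
    e1, e2]
  simp only [exp_pow_formA, exp_pow_formB]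
  rw [tsum_weightA (φ := fun n ↦ cexp (2 * Real.pi * I * τ) ^ n),
    tsum_weightB (φ := fun n ↦ cexp (2 * Real.pi * I * τ) ^ n)]
  · ring
  · refine (summable_quadratic_mul_pow formB_growsQuadratically 1 4 0 hq).congr fun v ↦ ?_
    push_cast
    ring
  · refine (summable_quadratic_mul_pow formA_growsQuadratically 1 2 (-3) hq).congr fun v ↦ ?_
    push_cast
    ring

/-! ### Brackets of unary theta series -/

lemma two_mul_im_pos {a : ℕ} (ha : 0 < a) {z : ℂ} (hz : 0 < z.im) : 0 < (2 * a * z : ℂ).im := by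
  have : (0 : ℝ) < 2 * a := by positivity
  rw [show (2 * a * z : ℂ) = ((2 * a : ℝ) : ℂ) * z by push_cast; rfl, im_ofReal_mul]
  positivity

lemma jacobiTheta₂_term_unary (a : ℕ) (n : ℤ) (z : ℂ) :
    jacobiTheta₂_term n 0 (2 * a * z) = cexp (2 * Real.pi * I * (a * (n : ℂ) ^ 2) * z) := by
  rw [jacobiTheta₂_term]
  congr 1
  ring

lemma unaryTheta_eq (a : ℕ) (τ : ℍ) : unaryTheta a τ = jacobiTheta₂ 0 (2 * a * τ) :=
  tsum_congr fun n ↦ (jacobiTheta₂_term_unary a n τ).symm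

lemma hasSum_unaryTheta {a : ℕ} (ha : 0 < a) (τ : ℍ) :
    HasSum (fun n : ℤ ↦ cexp (2 * Real.pi * I * (a * (n : ℂ) ^ 2) * τ)) (unaryTheta a τ) := by
  have := hasSum_jacobiTheta₂_term 0 (two_mul_im_pos ha τ.im_pos)
  simpa only [jacobiTheta₂_term_unary, ← unaryTheta_eq] using this

lemma hasSum_deriv_unaryTheta {a : ℕ} (ha : 0 < a) (τ : ℍ) :
    HasSum (fun n : ℤ ↦ a * (n : ℂ) ^ 2 * cexp (2 * Real.pi * I * (a * (n : ℂ) ^ 2) * τ))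
      (Derivative.normalizedDerivOfComplex (unaryTheta a) τ) := by
  have hτ := two_mul_im_pos ha τ.im_pos
  have h1 : HasDerivAt (fun z : ℂ ↦ jacobiTheta₂ 0 (2 * a * z))
      (jacobiTheta₂_fderiv 0 (2 * a * τ) (0, 2 * a)) τ := by
    have hc : HasDerivAt (fun z : ℂ ↦ ((0 : ℂ), 2 * a * z)) (0, 2 * a) τ :=
      (hasDerivAt_const _ _).prodMk (by simpa using (hasDerivAt_id (τ : ℂ)).const_mul (2 * a : ℂ))
    exact (hasFDerivAt_jacobiTheta₂ 0 hτ).comp_hasDerivAt (τ : ℂ) hc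
  have h2 : deriv (unaryTheta a ∘ ofComplex) τ = jacobiTheta₂_fderiv 0 (2 * a * τ) (0, 2 * a) := by
    refine (h1.congr_of_eventuallyEq ?_).deriv
    filter_upwards [isOpen_upperHalfPlaneSet.mem_nhds τ.im_pos] with z hz
    rw [Function.comp_apply, unaryTheta_eq, ofComplex_apply_of_im_pos hz]
  have h3 := (ContinuousLinearMap.apply ℂ ℂ ((0 : ℂ), (2 * a : ℂ))).hasSum
    (hasSum_jacobiTheta₂_term_fderiv 0 hτ)
  rw [Derivative.normalizedDerivOfComplex, h2]
  refine (h3.mul_left (2 * Real.pi * I)⁻¹).congr_fun fun n ↦ ?_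
  rw [← jacobiTheta₂_term_unary, jacobiTheta₂_term]
  have hpi : (Real.pi : ℂ) ≠ 0 := by exact_mod_cast Real.pi_ne_zero
  simp [jacobiTheta₂_term_fderiv]
  field_simp
  rw [I_sq]
  ring

lemma cexp_pow_quadForm {a b : ℕ} (ha : 0 < a) (hb : 0 < b) (τ : ℂ) (v : ℤ × ℤ) :
    cexp (2 * Real.pi * I * τ) ^ quadForm a 0 b v
      = cexp (2 * Real.pi * I * (a * (v.1 : ℂ) ^ 2) * τ)
        * cexp (2 * Real.pi * I * (b * (v.2 : ℂ) ^ 2) * τ) := by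
  have ha' : (1 : ℤ) ≤ a := by omega
  have hb' : (1 : ℤ) ≤ b := by omega
  have := congr_arg (Int.cast (R := ℂ)) (quadForm_cast (a := a) (b := 0) (c := b) ha'
    (by nlinarith) v)
  push_cast at this
  rw [← Complex.exp_nat_mul, this, ← Complex.exp_add]
  congr 1
  ring

lemma hasSum_mul_prod {f g : ℤ → ℂ} {a b : ℂ} (hf : HasSum f a) (hg : HasSum g b) :
    HasSum (fun v : ℤ × ℤ ↦ f v.1 * g v.2) (a * b) :=
  hf.mul hg (summable_mul_of_summable_norm hf.summable.norm hg.summable.norm)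

/-- The bracket of two unary theta series is the theta series of a binary form with a harmonic
weight. -/
lemma hasSum_rankinCohen_unaryTheta {a b : ℕ} (ha : 0 < a) (hb : 0 < b) (τ : ℍ) :
    HasSum (fun v : ℤ × ℤ ↦ 1 / 2 * ((b * v.2 ^ 2 - a * v.1 ^ 2 : ℤ) : ℂ)
        * cexp (2 * Real.pi * I * τ) ^ quadForm a 0 b v)
      (rankinCohen (1 / 2) (1 / 2) (unaryTheta a) (unaryTheta b) τ) := by
  have h1 := hasSum_unaryTheta ha τ
  have h2 := hasSum_unaryTheta hb τ
  have h1' := hasSum_deriv_unaryTheta ha τ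
  have h2' := hasSum_deriv_unaryTheta hb τ
  have p1 := hasSum_mul_prod h1 h2'
  have p2 := hasSum_mul_prod h1' h2
  have p := (p1.sub p2).mul_left (1 / 2)
  rw [rankinCohen, mul_assoc (1 / 2 : ℂ), mul_assoc (1 / 2 : ℂ), ← mul_sub]
  refine p.congr_fun fun v ↦ ?_
  rw [cexp_pow_quadForm ha hb]
  push_cast
  ring

lemma hasSum_bracketForm₁ (τ : ℍ) :
    HasSum (fun v : ℤ × ℤ ↦ 1 / 2 * ((5 * v.2 ^ 2 - 3 * v.1 ^ 2 : ℤ) : ℂ)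
        * cexp (2 * Real.pi * I * τ) ^ quadForm 3 0 5 v) (bracketForm₁ τ) :=
  hasSum_rankinCohen_unaryTheta (a := 3) (b := 5) (by norm_num) (by norm_num) τ

lemma hasSum_bracketForm₂ (τ : ℍ) :
    HasSum (fun v : ℤ × ℤ ↦ 1 / 2 * ((v.1 ^ 2 - 15 * v.2 ^ 2 : ℤ) : ℂ)
        * cexp (2 * Real.pi * I * τ) ^ quadForm 1 0 15 v) (bracketForm₂ τ) := by
  have h := hasSum_rankinCohen_unaryTheta (a := 15) (b := 1) (by norm_num) (by norm_num) τ
  rw [← (Equiv.prodComm ℤ ℤ).hasSum_iff] at h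
  refine h.congr_fun fun v ↦ ?_
  simp only [Function.comp_apply, Equiv.prodComm_apply, Prod.fst_swap, Prod.snd_swap]
  congr 2
  · push_cast
    ring
  · simp only [quadForm, Prod.fst_swap, Prod.snd_swap]
    congr 1
    push_cast
    ring

/-! ### Lattice sums over sublattices of index two -/

/-- The part of the sum for `A` over even `m`, from `A(2m, k) = 2 B(m, k)`. The weight
`P_A(2m, k)` becomes `P_B / 2` when averaged over the swap of `m` and `k`. -/
lemma tsum_weightA_even_fst {φ : ℕ → ℂ} {t : ℂ} (hφ : ∀ n, φ (2 * n) = t * φ n)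
    (hA : Summable fun v ↦ (weightA v : ℂ) * φ (formA v)) :
    ∑' v : ℤ × ℤ, (weightA (2 * v.1, v.2) : ℂ) * φ (formA (2 * v.1, v.2))
      = t / 2 * ∑' v, (weightB v : ℂ) * φ (formB v) := by
  set F : ℤ × ℤ → ℂ := fun v ↦ (weightA (2 * v.1, v.2) : ℂ) * φ (formA (2 * v.1, v.2)) with hF
  have hs : Summable F := hA.comp_injective (by simpa using injective_fst 0)
  have hs' : Summable fun v : ℤ × ℤ ↦ F (v.2, v.1) := hs.comp_injective Prod.swap_injective
  have hswap : ∑' v : ℤ × ℤ, F (v.2, v.1) = ∑' v, F v :=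
    tsum_reindex (fun v ↦ (v.2, v.1)) (fun v ↦ (v.2, v.1)) (by simp) (by simp)
  have h : 2 * ∑' v, F v = t * ∑' v, (weightB v : ℂ) * φ (formB v) := by
    rw [two_mul]
    nth_rw 2 [← hswap]
    rw [← hs.tsum_add hs', ← tsum_mul_left]
    refine tsum_congr fun v ↦ ?_
    simp only [hF, formA_two_mul_fst, formB_swap, hφ, weightA, weightB]
    push_cast
    ring
  linear_combination h / 2

/-- The part of the sum for `B` over even `m`, from `B(2m, k) = 2 A(k, m)`. -/
lemma tsum_weightB_even_fst {φ : ℕ → ℂ} {t : ℂ} (hφ : ∀ n, φ (2 * n) = t * φ n)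
    (hB : Summable fun v ↦ (weightB v : ℂ) * φ (formB v)) :
    ∑' v : ℤ × ℤ, (weightB (2 * v.1, v.2) : ℂ) * φ (formB (2 * v.1, v.2))
      = t / 2 * ∑' v, (weightA v : ℂ) * φ (formA v) := by
  set F : ℤ × ℤ → ℂ := fun v ↦ (weightB (2 * v.2, v.1) : ℂ) * φ (formB (2 * v.2, v.1)) with hF
  have hs : Summable F :=
    hB.comp_injective (i := fun v : ℤ × ℤ ↦ (2 * v.2, v.1)) fun v w h ↦ by
      simp only [Prod.mk.injEq] at h
      exact Prod.ext (by omega) (by omega)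
  have hs' : Summable fun v : ℤ × ℤ ↦ F (v.1 + v.2, -v.2) :=
    hs.comp_injective (i := fun v : ℤ × ℤ ↦ (v.1 + v.2, -v.2)) fun v w h ↦ by
      simp only [Prod.mk.injEq] at h
      exact Prod.ext (by omega) (by omega)
  have hconj : ∑' v : ℤ × ℤ, F (v.1 + v.2, -v.2) = ∑' v, F v :=
    tsum_reindex (fun v ↦ (v.1 + v.2, -v.2)) (fun v ↦ (v.1 + v.2, -v.2)) (by simp) (by simp)
  have h : 2 * ∑' v, F v = t * ∑' v, (weightA v : ℂ) * φ (formA v) := by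
    rw [two_mul]
    nth_rw 2 [← hconj]
    rw [← hs.tsum_add hs', ← tsum_mul_left]
    refine tsum_congr fun v ↦ ?_
    simp only [hF, formB_two_mul_fst, formA_conj, hφ, weightA, weightB]
    push_cast
    ring
  have hswap : ∑' v : ℤ × ℤ, F (v.2, v.1) = ∑' v, F v :=
    tsum_reindex (fun v ↦ (v.2, v.1)) (fun v ↦ (v.2, v.1)) (by simp) (by simp)
  refine hswap.trans ?_
  linear_combination h / 2

lemma tsum_weight_even_even {Q : ℤ × ℤ → ℕ} {w : ℤ × ℤ → ℤ} {φ : ℕ → ℂ} {t : ℂ}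
    (hφ : ∀ n, φ (2 * n) = t * φ n) (hQ : ∀ v, Q (2 * v.1, 2 * v.2) = 2 * (2 * Q v))
    (hw : ∀ v, w (2 * v.1, 2 * v.2) = 4 * w v) :
    ∑' v : ℤ × ℤ, (w (2 * v.1, 2 * v.2) : ℂ) * φ (Q (2 * v.1, 2 * v.2))
      = 4 * t ^ 2 * ∑' v, (w v : ℂ) * φ (Q v) := by
  rw [← tsum_mul_left]
  refine tsum_congr fun v ↦ ?_
  rw [hQ, hφ, hφ, hw]
  push_cast
  ring

/-- The part of the sum for `A` over even `k`. The automorphism `(m, k) ↦ (m + k, -k)` exchanges the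
two parity classes with `k` odd, so each of them is the part with `m` even less the part with both
`m` and `k` even. -/
lemma tsum_weightA_even_snd {φ : ℕ → ℂ} {t : ℂ} (hφ : ∀ n, φ (2 * n) = t * φ n)
    (hA : Summable fun v ↦ (weightA v : ℂ) * φ (formA v)) :
    ∑' v : ℤ × ℤ, (weightA (v.1, 2 * v.2) : ℂ) * φ (formA (v.1, 2 * v.2))
      = (1 + 8 * t ^ 2) * ∑' v, (weightA v : ℂ) * φ (formA v)
        - t * ∑' v, (weightB v : ℂ) * φ (formB v) := by
  have h1 := tsum_weightA_even_fst hφ hA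
  have h2 := tsum_weight_even_even (Q := formA) (w := weightA) hφ (fun v ↦ by
    rw [formA_two_mul_fst, formB_swap, formB_two_mul_fst]) (fun v ↦ by simp only [weightA]; ring)
  set F : ℤ × ℤ → ℂ := fun v ↦ (weightA v : ℂ) * φ (formA v) with hF
  have hconj (v : ℤ × ℤ) : F (v.1 + v.2, -v.2) = F v := by
    simp only [hF, formA_conj, weightA]
    congr 2
    ring
  have i1 : Function.Injective fun v : ℤ × ℤ ↦ (2 * v.1, v.2) := by simpa using injective_fst 0
  have s1 := tsum_parity_snd (F := F) hA
  have s2 := tsum_parity_fst (F := fun v ↦ F (v.1, 2 * v.2 + 1)) (hA.comp_injective (injective_snd 1))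
  have s3 := tsum_parity_snd (F := fun v ↦ F (2 * v.1, v.2)) (hA.comp_injective i1)
  have s4 : ∑' v : ℤ × ℤ, F (2 * v.1 + 1, 2 * v.2 + 1) = ∑' v : ℤ × ℤ, F (2 * v.1, 2 * v.2 + 1) := by
    rw [← tsum_reindex (F := fun v : ℤ × ℤ ↦ F (2 * v.1, 2 * v.2 + 1))
      (fun v ↦ (v.1 + v.2 + 1, -v.2 - 1)) (fun v ↦ (v.1 + v.2, -v.2 - 1))
      (fun v ↦ Prod.ext (by simp only; ring) (by simp only; ring))
      (fun v ↦ Prod.ext (by simp only; ring) (by simp only; ring))]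
    refine tsum_congr fun v ↦ ?_
    rw [← hconj (2 * v.1 + 1, 2 * v.2 + 1)]
    congr 2 <;> simp only <;> ring
  simp only at s2 s3
  linear_combination -s1 - s2 - s4 + 2 * s3 - 2 * h1 + 2 * h2

/-- The part of the sum for `B` over `m ≡ k` modulo `2`. The swap exchanges the two parity classes
with `m` and `k` of different parity. -/
lemma tsum_weightB_even_diag {φ : ℕ → ℂ} {t : ℂ} (hφ : ∀ n, φ (2 * n) = t * φ n)
    (hB : Summable fun v ↦ (weightB v : ℂ) * φ (formB v)) :
    ∑' v : ℤ × ℤ, (weightB (v.2 + v.1, v.2 - v.1) : ℂ) * φ (formB (v.2 + v.1, v.2 - v.1))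
      = (1 + 8 * t ^ 2) * ∑' v, (weightB v : ℂ) * φ (formB v)
        - t * ∑' v, (weightA v : ℂ) * φ (formA v) := by
  have h1 := tsum_weightB_even_fst hφ hB
  have h2 := tsum_weight_even_even (Q := formB) (w := weightB) hφ (fun v ↦ by
    rw [formB_two_mul_fst, formA_two_mul_fst, formB_swap]) (fun v ↦ by simp only [weightB]; ring)
  set F : ℤ × ℤ → ℂ := fun v ↦ (weightB v : ℂ) * φ (formB v) with hF
  have hswap (v : ℤ × ℤ) : F (v.2, v.1) = F v := by
    simp only [hF, formB_swap, weightB]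
    congr 2
    ring
  have i1 : Function.Injective fun v : ℤ × ℤ ↦ (2 * v.1, v.2) := by simpa using injective_fst 0
  have s1 := tsum_parity_fst (F := F) hB
  have s2 := tsum_parity_snd (F := fun v ↦ F (2 * v.1 + 1, v.2)) (hB.comp_injective (injective_fst 1))
  have s3 := tsum_parity_snd (F := fun v ↦ F (2 * v.1, v.2)) (hB.comp_injective i1)
  have s4 : ∑' v : ℤ × ℤ, F (2 * v.1 + 1, 2 * v.2) = ∑' v : ℤ × ℤ, F (2 * v.1, 2 * v.2 + 1) := by
    rw [← tsum_reindex (F := fun v : ℤ × ℤ ↦ F (2 * v.1, 2 * v.2 + 1))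
      (fun v ↦ (v.2, v.1)) (fun v ↦ (v.2, v.1)) (by simp) (by simp)]
    exact tsum_congr fun v ↦ (hswap _).symm
  have s5 := tsum_parity_diag (F := fun v ↦ F (v.2 + v.1, v.2 - v.1))
    (hB.comp_injective (i := fun v : ℤ × ℤ ↦ (v.2 + v.1, v.2 - v.1)) (by simpa using injective_diag 0))
  have s6 : ∑' v : ℤ × ℤ, F (v.2 - v.1 + (v.2 + v.1), v.2 - v.1 - (v.2 + v.1))
      = ∑' v : ℤ × ℤ, F (2 * v.1, 2 * v.2) := by
    rw [← tsum_reindex (F := fun v : ℤ × ℤ ↦ F (2 * v.1, 2 * v.2))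
      (fun v ↦ (v.2, -v.1)) (fun v ↦ (-v.2, v.1)) (by simp) (by simp)]
    refine tsum_congr fun v ↦ ?_
    congr 2 <;> ring
  have s7 : ∑' v : ℤ × ℤ, F (v.2 - v.1 + (v.2 + v.1 + 1), v.2 - v.1 - (v.2 + v.1 + 1))
      = ∑' v : ℤ × ℤ, F (2 * v.1 + 1, 2 * v.2 + 1) := by
    rw [← tsum_reindex (F := fun v : ℤ × ℤ ↦ F (2 * v.1 + 1, 2 * v.2 + 1))
      (fun v ↦ (v.2, -v.1 - 1)) (fun v ↦ (-v.2 - 1, v.1)) (by simp) (by simp)]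
    refine tsum_congr fun v ↦ ?_
    congr 2 <;> ring
  simp only at s2 s3 s5
  linear_combination s5 + s6 + s7 - s1 - s2 - s4 + s3 - 2 * h1 + 2 * h2

/-! ### The L-series -/

lemma norm_mul_quadratic_le {Q : ℤ × ℤ → ℕ} (hQ : GrowsQuadratically Q) (κ : ℂ) {w : ℤ × ℤ → ℤ}
    {a b c : ℤ} (hw : ∀ v, w v = a * v.1 ^ 2 + b * v.1 * v.2 + c * v.2 ^ 2) (v : ℤ × ℤ) :
    ‖κ * (w v : ℂ)‖ ≤ ‖κ‖ * (2 * (|a| + |b| + |c|) : ℤ) * Q v := by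
  rw [norm_mul, mul_assoc, hw]
  gcongr
  exact norm_quadratic_le hQ a b c v

lemma weightA_eq (v : ℤ × ℤ) : weightA v = 2 * v.1 ^ 2 + 2 * v.1 * v.2 + -7 * v.2 ^ 2 := by
  rw [weightA]
  ring

lemma weightB_eq (v : ℤ × ℤ) : weightB v = 1 * v.1 ^ 2 + 8 * v.1 * v.2 + 1 * v.2 ^ 2 := by
  rw [weightB]
  ring

lemma fourierCoefficient_bracketForm₁ : fourierCoefficient bracketForm₁
    = fiberSum (fun v ↦ 1 / 2 * ((5 * v.2 ^ 2 - 3 * v.1 ^ 2 : ℤ) : ℂ)) (quadForm 3 0 5) :=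
  fourierCoefficient_latticeSum hasSum_bracketForm₁

lemma fourierCoefficient_bracketForm₂ : fourierCoefficient bracketForm₂
    = fiberSum (fun v ↦ 1 / 2 * ((v.1 ^ 2 - 15 * v.2 ^ 2 : ℤ) : ℂ)) (quadForm 1 0 15) :=
  fourierCoefficient_latticeSum hasSum_bracketForm₂

lemma fourierCoefficient_fPlus : fourierCoefficient fPlus
    = fiberSum (fun v ↦ 1 / 4 * (weightA v : ℂ)) formA
      + fiberSum (fun v ↦ 1 / 4 * (weightB v : ℂ)) formB := by
  refine fourierCoefficient_eq fun τ ↦ ?_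
  have hq : ‖cexp (2 * Real.pi * I * τ)‖ < 1 := UpperHalfPlane.norm_exp_two_pi_I_lt_one τ
  have hA := (summable_quadratic_mul_pow formA_growsQuadratically 2 2 (-7) hq).hasSum
  have hB := (summable_quadratic_mul_pow formB_growsQuadratically 1 8 1 hq).hasSum
  simp only [← weightA_eq, ← weightB_eq] at hA hB
  rw [fPlus_eq]
  have hA' := hA.mul_left (1 / 4)
  have hB' := hB.mul_left (1 / 4)
  simp only [← mul_assoc] at hA' hB'
  simpa only [Pi.add_apply, add_mul] using
    (hasSum_fiberSum (φ := fun n ↦ cexp (2 * Real.pi * I * τ) ^ n) hA').add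
      (hasSum_fiberSum (φ := fun n ↦ cexp (2 * Real.pi * I * τ) ^ n) hB')

/-- The term at the origin vanishes, so that a sum over `ℤ²` is a sum over the non-zero pairs. -/
lemma hasSum_nonzeroPair {F : ℤ × ℤ → ℂ} {a : ℂ} (h : HasSum F a) (h0 : F 0 = 0) :
    HasSum (fun p : NonzeroPair ↦ F p.1) a := by
  refine (Function.Injective.hasSum_iff (g := fun p : NonzeroPair ↦ p.1) Subtype.val_injective
    fun v hv ↦ ?_).2 h
  have : v = 0 := by
    by_contra h
    exact hv ⟨⟨v, h⟩, rfl⟩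
  rw [this, h0]

lemma lSeries_bracketForm₁ {s : ℂ} (hs : 2 < s.re) :
    LSeriesSummable (fourierCoefficient bracketForm₁) s ∧
      HasSum (fun v : ℤ × ℤ ↦ 1 / 2 * ((5 * v.2 ^ 2 - 3 * v.1 ^ 2 : ℤ) : ℂ)
          / ((3 * v.1 ^ 2 + 5 * v.2 ^ 2 : ℤ) : ℂ) ^ s) (formLSeries bracketForm₁ s) := by
  have hQ : GrowsQuadratically (quadForm 3 0 5) :=
    quadForm_growsQuadratically (by norm_num) (by norm_num)
  obtain ⟨h1, h2⟩ := lSeries_fiberSum hQ (norm_mul_quadratic_le hQ (1 / 2)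
    (w := fun v ↦ 5 * v.2 ^ 2 - 3 * v.1 ^ 2) (a := -3) (b := 0) (c := 5) fun v ↦ by ring) hs
  rw [formLSeries, fourierCoefficient_bracketForm₁]
  refine ⟨h1, h2.congr_fun fun v ↦ ?_⟩
  rw [← Int.cast_natCast, quadForm_cast (by norm_num) (by norm_num)]
  congr 3
  ring

lemma lSeries_bracketForm₂ {s : ℂ} (hs : 2 < s.re) :
    LSeriesSummable (fourierCoefficient bracketForm₂) s ∧
      HasSum (fun v : ℤ × ℤ ↦ 1 / 2 * ((v.1 ^ 2 - 15 * v.2 ^ 2 : ℤ) : ℂ)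
          / ((v.1 ^ 2 + 15 * v.2 ^ 2 : ℤ) : ℂ) ^ s) (formLSeries bracketForm₂ s) := by
  have hQ : GrowsQuadratically (quadForm 1 0 15) :=
    quadForm_growsQuadratically (by norm_num) (by norm_num)
  obtain ⟨h1, h2⟩ := lSeries_fiberSum hQ (norm_mul_quadratic_le hQ (1 / 2)
    (w := fun v ↦ v.1 ^ 2 - 15 * v.2 ^ 2) (a := 1) (b := 0) (c := -15) fun v ↦ by ring) hs
  rw [formLSeries, fourierCoefficient_bracketForm₂]
  refine ⟨h1, h2.congr_fun fun v ↦ ?_⟩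
  rw [← Int.cast_natCast, quadForm_cast (by norm_num) (by norm_num)]
  congr 3
  ring

lemma hasSum_weight {s : ℂ} (hs : 2 < s.re) :
    (LSeriesSummable (fiberSum (fun v ↦ 1 / 4 * (weightA v : ℂ)) formA) s ∧
      HasSum (fun v ↦ 1 / 4 * (weightA v : ℂ) / (formA v : ℂ) ^ s)
        (LSeries (fiberSum (fun v ↦ 1 / 4 * (weightA v : ℂ)) formA) s)) ∧
    (LSeriesSummable (fiberSum (fun v ↦ 1 / 4 * (weightB v : ℂ)) formB) s ∧
      HasSum (fun v ↦ 1 / 4 * (weightB v : ℂ) / (formB v : ℂ) ^ s)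
        (LSeries (fiberSum (fun v ↦ 1 / 4 * (weightB v : ℂ)) formB) s)) :=
  ⟨lSeries_fiberSum formA_growsQuadratically
    (norm_mul_quadratic_le formA_growsQuadratically (1 / 4) weightA_eq) hs,
  lSeries_fiberSum formB_growsQuadratically
    (norm_mul_quadratic_le formB_growsQuadratically (1 / 4) weightB_eq) hs⟩

lemma lSeries_fPlus {s : ℂ} (hs : 2 < s.re) :
    LSeriesSummable (fourierCoefficient fPlus) s ∧
      HasSum (fun v : ℤ × ℤ ↦
          1 / 4 * ((2 * v.1 ^ 2 + 2 * v.1 * v.2 - 7 * v.2 ^ 2 : ℤ) : ℂ)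
              / ((v.1 ^ 2 + v.1 * v.2 + 4 * v.2 ^ 2 : ℤ) : ℂ) ^ s
            + 1 / 4 * ((v.1 ^ 2 + 8 * v.1 * v.2 + v.2 ^ 2 : ℤ) : ℂ)
              / ((2 * v.1 ^ 2 + v.1 * v.2 + 2 * v.2 ^ 2 : ℤ) : ℂ) ^ s) (formLSeries fPlus s) := by
  obtain ⟨⟨h1, h2⟩, h3, h4⟩ := hasSum_weight hs
  rw [formLSeries, fourierCoefficient_fPlus, LSeries_add h1 h3]
  refine ⟨h1.add h3, (h2.add h4).congr_fun fun v ↦ ?_⟩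
  rw [← formA_cast, ← formB_cast, Int.cast_natCast, Int.cast_natCast, weightA, weightB]

/-- The `L`-series of `f₁ + f₂` and of `f⁺` agree up to the Euler factor at `2`. -/
theorem lSeries_add_eq {s : ℂ} (hs : 2 < s.re) :
    formLSeries bracketForm₁ s + formLSeries bracketForm₂ s
      = (1 - (2 : ℂ) ^ (-s) + (2 : ℂ) ^ (3 - 2 * s)) * formLSeries fPlus s := by
  obtain ⟨⟨hA0, hA⟩, hB0, hB⟩ := hasSum_weight hs
  set φ : ℕ → ℂ := fun n ↦ ((n : ℂ) ^ s)⁻¹ with hφdef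
  set t : ℂ := (2 : ℂ) ^ (-s) with ht
  have hφ (n : ℕ) : φ (2 * n) = t * φ n := by
    simp only [hφdef, ht]
    rw [Nat.cast_mul, natCast_mul_natCast_cpow, mul_inv, cpow_neg, Nat.cast_ofNat]
  have ht8 : (2 : ℂ) ^ (3 - 2 * s) = 8 * t ^ 2 := by
    rw [cpow_sub _ _ two_ne_zero, ht, cpow_neg, inv_pow, ← cpow_nat_mul, Nat.cast_ofNat,
      div_eq_mul_inv, cpow_ofNat]
    norm_num
  have hA' : HasSum (fun v ↦ (weightA v : ℂ) * φ (formA v)) _ :=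
    (hA.mul_left 4).congr_fun fun v ↦ by simp only [hφdef]; ring
  have hB' : HasSum (fun v ↦ (weightB v : ℂ) * φ (formB v)) _ :=
    (hB.mul_left 4).congr_fun fun v ↦ by simp only [hφdef]; ring
  have hf : formLSeries fPlus s = LSeries (fiberSum (fun v ↦ 1 / 4 * (weightA v : ℂ)) formA) s
      + LSeries (fiberSum (fun v ↦ 1 / 4 * (weightB v : ℂ)) formB) s := by
    rw [formLSeries, fourierCoefficient_fPlus, LSeries_add hA0 hB0]
  have e1 := tsum_weightA_even_snd hφ hA'.summable
  have e2 := tsum_weightB_even_diag hφ hB'.summable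
  rw [hA'.tsum_eq, hB'.tsum_eq] at e1 e2
  -- `3 m² + 5 k² = B(k + m, k - m)` and `m² + 15 k² = A(m - k, 2 k)`
  have f1 : formLSeries bracketForm₁ s = 1 / 4 * ∑' v : ℤ × ℤ,
      (weightB (v.2 + v.1, v.2 - v.1) : ℂ) * φ (formB (v.2 + v.1, v.2 - v.1)) := by
    rw [← (lSeries_bracketForm₁ hs).2.tsum_eq, ← tsum_mul_left]
    refine tsum_congr fun v ↦ ?_
    simp only [hφdef]
    rw [← Int.cast_natCast (formB _), formB_cast, weightB, div_eq_mul_inv, ← mul_assoc]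
    congr 1
    · push_cast
      ring
    · congr 3
      ring
  have f2 : formLSeries bracketForm₂ s = 1 / 4 * ∑' v : ℤ × ℤ,
      (weightA (v.1, 2 * v.2) : ℂ) * φ (formA (v.1, 2 * v.2)) := by
    rw [← (lSeries_bracketForm₂ hs).2.tsum_eq, ← tsum_reindex
      (F := fun v : ℤ × ℤ ↦ (weightA (v.1, 2 * v.2) : ℂ) * φ (formA (v.1, 2 * v.2)))
      (fun v ↦ (v.1 - v.2, v.2)) (fun v ↦ (v.1 + v.2, v.2)) (by simp) (by simp), ← tsum_mul_left]
    refine tsum_congr fun v ↦ ?_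
    simp only [hφdef]
    rw [← Int.cast_natCast (formA _), formA_cast, weightA, div_eq_mul_inv, ← mul_assoc]
    congr 1
    · push_cast
      ring
    · congr 3
      ring
  rw [f1, f2, e1, e2, hf, ht8]
  ring

lemma lSeries_add_eq_three :
    formLSeries bracketForm₁ 3 + formLSeries bracketForm₂ 3 = formLSeries fPlus 3 := by
  rw [lSeries_add_eq (by norm_num), show (3 : ℂ) - 2 * 3 = -3 by norm_num, cpow_neg, cpow_ofNat]
  norm_num

theorem proposition2 :
    -- the identity of lattice sums, which converge absolutely
    (Summable (fun p : NonzeroPair => leftTerm p.1.1 p.1.2) ∧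
      Summable (fun p : NonzeroPair => rightTerm p.1.1 p.1.2) ∧
      ∑' p : NonzeroPair, leftTerm p.1.1 p.1.2 = ∑' p : NonzeroPair, rightTerm p.1.1 p.1.2) ∧
    -- the same identity for the values of the L-series at `3`
    formLSeries bracketForm₁ 3 + formLSeries bracketForm₂ 3 = formLSeries fPlus 3 ∧
    -- the L-series on their half-plane of absolute convergence
    ∀ s : ℂ, 2 < s.re →
      LSeriesSummable (fourierCoefficient bracketForm₁) s ∧
      LSeriesSummable (fourierCoefficient bracketForm₂) s ∧
      LSeriesSummable (fourierCoefficient fPlus) s ∧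
      HasSum (fun p : NonzeroPair =>
          1 / 2 * ((5 * p.1.2 ^ 2 - 3 * p.1.1 ^ 2 : ℤ) : ℂ)
            / ((3 * p.1.1 ^ 2 + 5 * p.1.2 ^ 2 : ℤ) : ℂ) ^ s)
        (formLSeries bracketForm₁ s) ∧
      HasSum (fun p : NonzeroPair =>
          1 / 2 * ((p.1.1 ^ 2 - 15 * p.1.2 ^ 2 : ℤ) : ℂ)
            / ((p.1.1 ^ 2 + 15 * p.1.2 ^ 2 : ℤ) : ℂ) ^ s)
        (formLSeries bracketForm₂ s) ∧
      HasSum (fun p : NonzeroPair =>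
          1 / 4 * ((2 * p.1.1 ^ 2 + 2 * p.1.1 * p.1.2 - 7 * p.1.2 ^ 2 : ℤ) : ℂ)
              / ((p.1.1 ^ 2 + p.1.1 * p.1.2 + 4 * p.1.2 ^ 2 : ℤ) : ℂ) ^ s
            + 1 / 4 * ((p.1.1 ^ 2 + 8 * p.1.1 * p.1.2 + p.1.2 ^ 2 : ℤ) : ℂ)
              / ((2 * p.1.1 ^ 2 + p.1.1 * p.1.2 + 2 * p.1.2 ^ 2 : ℤ) : ℂ) ^ s)
        (formLSeries fPlus s) ∧
      formLSeries bracketForm₁ s + formLSeries bracketForm₂ s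
        = (1 - (2 : ℂ) ^ (-s) + (2 : ℂ) ^ (3 - 2 * s)) * formLSeries fPlus s := by
  have h1 (s : ℂ) (hs : 2 < s.re) := hasSum_nonzeroPair (lSeries_bracketForm₁ hs).2 (by simp)
  have h2 (s : ℂ) (hs : 2 < s.re) := hasSum_nonzeroPair (lSeries_bracketForm₂ hs).2 (by simp)
  have h3 (s : ℂ) (hs : 2 < s.re) := hasSum_nonzeroPair (lSeries_fPlus hs).2 (by simp)
  refine ⟨?_, lSeries_add_eq_three, fun s hs ↦ ⟨(lSeries_bracketForm₁ hs).1,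
    (lSeries_bracketForm₂ hs).1, (lSeries_fPlus hs).1, h1 s hs, h2 s hs, h3 s hs, lSeries_add_eq hs⟩⟩
  have h3re : 2 < (3 : ℂ).re := by norm_num
  have hl : HasSum (fun p : NonzeroPair ↦ ((leftTerm p.1.1 p.1.2 : ℝ) : ℂ))
      (2 * formLSeries fPlus 3) := by
    rw [← lSeries_add_eq_three]
    refine (((h1 3 h3re).add (h2 3 h3re)).mul_left 2).congr_fun fun p ↦ ?_
    simp only [leftTerm, cpow_ofNat]
    push_cast
    ring
  have hr : HasSum (fun p : NonzeroPair ↦ ((rightTerm p.1.1 p.1.2 : ℝ) : ℂ))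
      (2 * formLSeries fPlus 3) := by
    refine ((h3 3 h3re).mul_left 2).congr_fun fun p ↦ ?_
    simp only [rightTerm, cpow_ofNat]
    push_cast
    ring
  refine ⟨summable_ofReal.1 hl.summable, summable_ofReal.1 hr.summable, ?_⟩
  rw [← ofReal_inj, ofReal_tsum, ofReal_tsum, hl.tsum_eq, hr.tsum_eq]
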